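/- Let $S$ be a closed orientable hyperbolic surface, with universal covering $\pi:\mathbb{H}^2\to S$ and group $\Gamma$ of covering transformations; let $d$ be the hyperbolic distance on $\mathbb{H}^2$. If $f$ is a homeomorphism of $S$ isotopic to the identity ($f\in\mathrm{Homeo}_0(S)$), its preferred lift $\widetilde f:\mathbb{H}^2\to\mathbb{H}^2$ is the lift of $f$ that commutes with every element of $\Gamma$. For $x\in S$ with lift $\widetilde x$ put $L_n(x)=d(\widetilde x,\widetilde f^n(\widetilde x))$ (independent of the lift). The rotation speed of $x$ is $$\vartheta(x)=\lim_{n\to+\infty}\tfrac1n L_n(x)=\lim_{n\to+\infty}\tfrac1n L_n(f^{-n}(x)),$$ when both limits exist and coincide. Let $\mathcal{M}^{\mathrm{erg}}_{\vartheta>0}(f)$ be the set of ergodic $f$-invariant Borel probability measures $\mu$ on $S$ for which there is a constant $\vartheta_\mu>0$ with $\vartheta(x)=\vartheta_\mu$ for $\mu$-a.e. $x$. A geodesic of $S$ is a local isometry $\gamma:\mathbb{R}\to S$, and $\dot\gamma(\mathbb{R})\subset \mathrm{T}^1S$ is the set of its velocity vectors. A geodesic $\gamma$ is a tracking geodesic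 for $x$ if $\vartheta(x)$ exists and is positive and every lift $\widetilde x$ of $x$ has a lift $\widetilde\gamma$ of $\gamma$ with $$\lim_{n\to+\infty}\tfrac1n d\big(\widetilde f^{n}(\widetilde x),\widetilde\gamma(n\vartheta(x))\big)=\lim_{n\to+\infty}\tfrac1n d\big(\widetilde f^{-n}(\widetilde x),\widetilde\gamma(-n\vartheta(x))\big)=0.\qquad(*)$$ It is normalized if there are lifts $\widetilde x$, $\widetilde\gamma$ satisfying $(*)$ with $d(\widetilde x,\widetilde\gamma(0))=d(\widetilde x,\widetilde\gamma(\mathbb{R}))$. Let $S_T$ be the set of points that admit a tracking geodesic; each $x\in S_T$ has a unique normalized tracking geodesic, denoted $\gamma_x$. **Proposition.** For every closed orientable hyperbolic surface $S$ there exist $f\in\mathrm{Homeo}_0(S)$ and $\mu\in\mathcal{M}^{\mathrm{erg}}_{\vartheta>0}(f)$ such that $\mu(S\setminus S_T)=0$ and the $\mu$-a.e. defined map $x\mapsto\dot\gamma_x(\mathbb{R})$ is not $\mu$-a.e. constant. More precisely, for every measurable set $E\subset S$ with $\mu(E)>0$, the set $\{\dot\gamma_x(\mathbb{R})\mid x\in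 E\cap S_T\}$ is uncountable. -/

import Mathlib

open Filter Topology MeasureTheory
open scoped UpperHalfPlane MatrixGroups

noncomputable section

/-- A complete orientable hyperbolic structure on a metric space `S`, given by its universal
covering: `proj : ℍ → S` is the universal covering map from the hyperbolic plane, it is a local
isometry, and the group `deck` of covering transformations acts on `ℍ` by orientation preserving
isometries, i.e. by Möbius transformations with real coefficients. A closed orientable hyperbolic
surface is a compact `S` with such a structure. -/
structure HyperbolicSurface (S : Type*) [MetricSpace S] where
  /-- the universal covering map -/
  proj : ℍ → S
  /-- the group of covering transformations -/
  deck : Subgroup (Equiv.Perm ℍ)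
  deck_le : deck ≤ (MulAction.toPermHom SL(2, ℝ) ℍ).range
  isQuotientCoveringMap : IsQuotientCoveringMap proj deck
  locally_isometric : ∀ z : ℍ, ∃ r > 0, ∀ u ∈ Metric.ball z r, ∀ v ∈ Metric.ball z r,
    dist (proj u) (proj v) = dist u v

/-- `f` belongs to `Homeo₀(S)`: it is isotopic to the identity through homeomorphisms. -/
def IsIsotopicToId {S : Type*} [TopologicalSpace S] (f : S ≃ₜ S) : Prop :=
  ∃ H : unitInterval → S ≃ₜ S, Continuous (fun p : unitInterval × S => H p.1 p.2) ∧
    (∀ x, H 0 x = x) ∧ ∀ x, H 1 x = f x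

/-- A geodesic of a metric space: a local isometry defined on `ℝ`. -/
def IsGeodesic {S : Type*} [MetricSpace S] (γ : ℝ → S) : Prop :=
  ∀ t : ℝ, ∃ ε > 0, ∀ s ∈ Metric.ball t ε, ∀ s' ∈ Metric.ball t ε, dist (γ s) (γ s') = dist s s'

namespace HyperbolicSurface

variable {S : Type*} [MetricSpace S] (X : HyperbolicSurface S)

/-- The preferred lift of `f`: the lift to the universal cover that commutes with all covering
transformations. -/
structure IsPreferredLift (f : S ≃ₜ S) (F : ℍ ≃ₜ ℍ) : Prop where
  lift : ∀ z, X.proj (F z) = f (X.proj z)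
  comm : ∀ φ ∈ X.deck, ∀ z, F (φ z) = φ (F z)

/-- The rotation distance `L_n(x)`: the distance from a lift `z` of `x` to its image under the
`n`-th iterate of the preferred lift `F`. It does not depend on the lift, see
`rotationDistance_proj`. -/
def rotationDistance (F : ℍ ≃ₜ ℍ) (n : ℕ) (x : S) : ℝ :=
  dist (Function.surjInv X.isQuotientCoveringMap.surjective x)
    (F^[n] (Function.surjInv X.isQuotientCoveringMap.surjective x))

theorem IsPreferredLift.iterate_comm {X : HyperbolicSurface S} {f : S ≃ₜ S} {F : ℍ ≃ₜ ℍ}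
    (hF : X.IsPreferredLift f F) {φ : Equiv.Perm ℍ} (hφ : φ ∈ X.deck) (n : ℕ) (z : ℍ) :
    F^[n] (φ z) = φ (F^[n] z) := by
  induction n with
  | zero => rfl
  | succ n ih => rw [Function.iterate_succ_apply', Function.iterate_succ_apply', ih, hF.comm φ hφ]

theorem dist_deck {φ : Equiv.Perm ℍ} (hφ : φ ∈ X.deck) (z w : ℍ) :
    dist (φ z) (φ w) = dist z w := by
  obtain ⟨g, rfl⟩ := X.deck_le hφ
  exact dist_smul g z w

/-- The rotation distance can be computed from any lift. -/
theorem rotationDistance_proj {f : S ≃ₜ S} {F : ℍ ≃ₜ ℍ} (hF : X.IsPreferredLift f F)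
    (n : ℕ) (z : ℍ) : X.rotationDistance F n (X.proj z) = dist z (F^[n] z) := by
  have h := Function.surjInv_eq X.isQuotientCoveringMap.surjective (X.proj z)
  obtain ⟨φ, hφ⟩ := X.isQuotientCoveringMap.apply_eq_iff_mem_orbit.mp h
  have hφ' : (φ : Equiv.Perm ℍ) z =
      Function.surjInv X.isQuotientCoveringMap.surjective (X.proj z) := hφ
  unfold rotationDistance
  rw [← hφ', hF.iterate_comm φ.2, X.dist_deck φ.2]

/-- The rotation speed `ϑ(x)` exists and equals `v`. -/
def HasRotationSpeed (f : S ≃ₜ S) (F : ℍ ≃ₜ ℍ) (x : S) (v : ℝ) : Prop :=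
  Tendsto (fun n : ℕ => 1 / (n : ℝ) * X.rotationDistance F n x) atTop (𝓝 v) ∧
  Tendsto (fun n : ℕ => 1 / (n : ℝ) * X.rotationDistance F n (f.symm^[n] x)) atTop (𝓝 v)

/-- `μ` is an ergodic `f`-invariant probability measure with positive rotation speed. -/
structure IsErgodicPos [MeasurableSpace S] (f : S ≃ₜ S) (F : ℍ ≃ₜ ℍ) (μ : Measure S) : Prop where
  isProbabilityMeasure : IsProbabilityMeasure μ
  ergodic : Ergodic f μ
  pos_speed : ∃ v : ℝ, 0 < v ∧ ∀ᵐ x ∂μ, X.HasRotationSpeed f F x v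

/-- `γ'` is a lift of the curve `γ` to the universal cover. -/
def IsLift (γ : ℝ → S) (γ' : ℝ → ℍ) : Prop :=
  Continuous γ' ∧ ∀ t, X.proj (γ' t) = γ t

/-- The tracking equation: the curve `γ'` travelled at speed `v` stays at sublinear distance from
the two-sided orbit of `z`. -/
def Tracks (F : ℍ ≃ₜ ℍ) (z : ℍ) (γ' : ℝ → ℍ) (v : ℝ) : Prop :=
  Tendsto (fun n : ℕ => 1 / (n : ℝ) * dist (F^[n] z) (γ' (n * v))) atTop (𝓝 0) ∧
  Tendsto (fun n : ℕ => 1 / (n : ℝ) * dist (F.symm^[n] z) (γ' (-(n * v)))) atTop (𝓝 0)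

/-- `γ` is a tracking geodesic for the point `x`. -/
def IsTrackingGeodesic (f : S ≃ₜ S) (F : ℍ ≃ₜ ℍ) (x : S) (γ : ℝ → S) : Prop :=
  IsGeodesic γ ∧ ∃ v : ℝ, 0 < v ∧ X.HasRotationSpeed f F x v ∧
    ∀ z, X.proj z = x → ∃ γ', X.IsLift γ γ' ∧ Tracks F z γ' v

/-- The tracking geodesic `γ` for `x` is normalized: for some lifts of `x` and `γ` related by the
tracking equation, the point of parameter `0` is a closest point of the geodesic to the lift
of `x`. -/
def IsNormalizedTrackingGeodesic (f : S ≃ₜ S) (F : ℍ ≃ₜ ℍ) (x : S) (γ : ℝ → S) : Prop :=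
  X.IsTrackingGeodesic f F x γ ∧
    ∃ (v : ℝ) (z : ℍ) (γ' : ℝ → ℍ), X.HasRotationSpeed f F x v ∧ X.proj z = x ∧
      X.IsLift γ γ' ∧ Tracks F z γ' v ∧ dist z (γ' 0) = Metric.infDist z (Set.range γ')

/-- The set `S_T` of points that admit a tracking geodesic. -/
def trackedSet (f : S ≃ₜ S) (F : ℍ ≃ₜ ℍ) : Set S :=
  {x | ∃ γ, X.IsTrackingGeodesic f F x γ}

/-- The chain rule for the factors `c z + d` of two Möbius transformations. -/
theorem denom_mul_SL (g h : SL(2, ℝ)) (z : ℍ) :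
    UpperHalfPlane.denom (g * h : SL(2, ℝ)) z =
      UpperHalfPlane.denom g (h • z : ℍ) * UpperHalfPlane.denom h z := by
  have hdet : 0 < (h : GL (Fin 2) ℝ).det.val := by simp
  have key := UpperHalfPlane.denom_cocycle_σ (g : GL (Fin 2) ℝ) (h : GL (Fin 2) ℝ) z
  rw [UpperHalfPlane.σ, if_pos hdet, ← map_mul] at key
  exact key

/-- Two tangent vectors `(z, u)`, `(w, v)` of `ℍ` are identified if the differential of a covering
transformation maps one to the other; the differential at `z` of `z ↦ (a z + b) / (c z + d)`, where
`a d - b c = 1`, is the multiplication by `1 / (c z + d) ^ 2`. -/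
def tangentSetoid : Setoid (ℍ × ℂ) where
  r p q := ∃ g : SL(2, ℝ), MulAction.toPermHom SL(2, ℝ) ℍ g ∈ X.deck ∧
    g • p.1 = q.1 ∧ p.2 / UpperHalfPlane.denom g p.1 ^ 2 = q.2
  iseqv := by
    refine ⟨fun p => ⟨1, by rw [map_one]; exact X.deck.one_mem, by simp,
      by simp [UpperHalfPlane.denom]⟩, ?_, ?_⟩
    · rintro ⟨z, u⟩ ⟨w, v⟩ ⟨g, hg, hz, hu⟩
      simp only at hz hu
      subst hz hu
      refine ⟨g⁻¹, by rw [map_inv]; exact X.deck.inv_mem hg, by simp, ?_⟩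
      have h := denom_mul_SL g⁻¹ g z
      have h1 : UpperHalfPlane.denom (g⁻¹ * g : SL(2, ℝ)) z = 1 := by
        simp [UpperHalfPlane.denom]
      rw [h1] at h
      simp only
      rw [div_div, ← mul_pow, mul_comm, ← h, one_pow, div_one]
    · rintro ⟨z, u⟩ ⟨w, v⟩ ⟨y, t⟩ ⟨g, hg, hz, hu⟩ ⟨k, hk, hw, hv⟩
      simp only at hz hu hw hv
      subst hz hu hw hv
      refine ⟨k * g, by rw [map_mul]; exact X.deck.mul_mem hk hg, by simp [mul_smul], ?_⟩
      simp only
      rw [denom_mul_SL, div_div, ← mul_pow, mul_comm]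

/-- The tangent bundle of the surface, the quotient of the tangent bundle `ℍ × ℂ` of `ℍ` by the
covering transformations. It contains the unit tangent bundle. -/
def TangentBundle : Type := Quotient X.tangentSetoid

/-- The set `γ̇(ℝ)` of the velocity vectors of a curve `γ` in the surface, computed by means of the
lifts of `γ`. If `γ` is a geodesic, it is contained in the unit tangent bundle. -/
def velocitySet (γ : ℝ → S) : Set X.TangentBundle :=
  {p | ∃ γ' : ℝ → ℍ, X.IsLift γ γ' ∧
    ∃ t : ℝ, p = Quotient.mk X.tangentSetoid (γ' t, deriv (fun s => (γ' s : ℂ)) t)}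

end HyperbolicSurface

end

/-!
The homeomorphism is a horseshoe whose two legs go around the surface along different closed
geodesics. Its invariant Cantor set is coded by the sequences in `ℤ → Bool`, and the measure is the
image of the law of independent fair coin tosses.

*Two covering transformations.* The group of covering transformations moves every point by a definite
amount and is cocompact. Hence it contains a hyperbolic element, and another element which moves the
attracting fixed point of the first one away from both of its fixed points. After a conjugation and
the passage to powers (`IsFreeCocompact.exists_expanding`) this gives matrices `M false`, `M true`
that map a cone of directions into disjoint smaller cones and expand its vectors. The products of
these matrices along a sequence `x` are therefore diagonalized by a continuous family of frames
(`exists_frames`): `M (x 0) * G (shift x) = G x * SL2.diag (τ x)` with `τ ≥ log 2`. The slope `m x`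
of the first vector of `G x`, that is, the forward end point of the corresponding geodesic,
determines the forward part of `x` (`forward_eq_of_slope_eq`).

*The homeomorphism.* A map of `ℍ` that commutes with the covering transformations, and is isotopic to
the identity through such maps, is the preferred lift of a homeomorphism isotopic to the identity
(`HyperbolicSurface.exists_isPreferredLift`). A planar horseshoe in a small disc is cut in the middle:
a contraction brings the two halves of the Cantor set near two different points of the disc, then
these two points are pushed around the surface, so that small neighborhoods return by the covering
transformations given by `M false` and `M true` (`HyperbolicSurface.exists_double_push`), and then an
expansion completes the horseshoe. The pushes are compositions of twists, that is, of rotations cut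
off by a function of the distance to the centre; they exist because the complement of the orbit of a
point is connected. The preferred lift `F` of the composition maps the point with itinerary `x` to
the image of the point with itinerary `shift x` under `M (x 0)`, up to the conjugation
(`HyperbolicSurface.exists_coding`). In terms of frames, `F` moves the frame of `x` by `τ x` along its
geodesic, up to covering transformations. This is what a `FramedHorseshoe` records.

*Tracking.* The orbit of the point of `x` stays within a bounded distance of the geodesic of the frame
of `x`, at the parameters given by the Birkhoff sums of `τ`. By the ergodic theorem
(`Ergodic.ae_tendsto_birkhoffSum_div`), applied to the shift and to its inverse, these sums grow
linearly in both directions with the speed `∫ τ > 0` for almost every `x`. So almost every point has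
a tracking geodesic, and any tracking geodesic can be normalized by a change of its origin
(`HyperbolicSurface.IsTrackingGeodesic.exists_normalized`).

*Velocity sets.* If two geodesics of the surface have the same velocity vectors, their lifts differ by
a covering transformation and a translation of the parameter
(`HyperbolicSurface.exists_frame_eq`). As there are countably many covering transformations, the
sequences whose geodesics have a given velocity set take countably many slopes `m x`; each slope
prescribes the forward part of the sequence, which happens with probability zero. Thus the fibers of
the map from points to velocity sets are null sets
(`FramedHorseshoe.coinTosses_velocitySet_eq_zero`), and a set of positive measure has uncountably
many images.
-/

/-! ### Covering transformations as matrices -/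

noncomputable section

namespace HyperbolicSurface

variable {S : Type*} [MetricSpace S] (X : HyperbolicSurface S)

/-- The group of covering transformations, as a group of matrices. It contains `-1`, which acts
trivially on `ℍ`. -/
def matrixGroup : Subgroup SL(2, ℝ) :=
  X.deck.comap (MulAction.toPermHom SL(2, ℝ) ℍ)

theorem neg_mem_matrixGroup {g : SL(2, ℝ)} (hg : g ∈ X.matrixGroup) : -g ∈ X.matrixGroup := by
  have : MulAction.toPermHom SL(2, ℝ) ℍ (-g) = MulAction.toPermHom SL(2, ℝ) ℍ g :=
    Equiv.ext fun z => by
      change -g • z = g • z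
      apply UpperHalfPlane.ext
      rw [UpperHalfPlane.coe_specialLinearGroup_apply, UpperHalfPlane.coe_specialLinearGroup_apply]
      simp only [Matrix.SpecialLinearGroup.coe_neg, Matrix.neg_apply, map_neg, Complex.ofReal_neg,
        neg_mul, ← neg_add, neg_div_neg_eq]
  change MulAction.toPermHom SL(2, ℝ) ℍ (-g) ∈ X.deck
  rw [this]; exact hg

theorem proj_smul {g : SL(2, ℝ)} (hg : g ∈ X.matrixGroup) (z : ℍ) : X.proj (g • z) = X.proj z :=
  X.isQuotientCoveringMap.map_smul (⟨_, hg⟩ : X.deck) (e := z)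

theorem proj_eq_iff {z w : ℍ} : X.proj z = X.proj w ↔ ∃ g ∈ X.matrixGroup, g • z = w := by
  constructor
  · intro h
    obtain ⟨φ, hφ⟩ := X.isQuotientCoveringMap.apply_eq_iff_mem_orbit.mp h.symm
    obtain ⟨g, hg⟩ := X.deck_le φ.2
    refine ⟨g, ?_, ?_⟩
    · change MulAction.toPermHom SL(2, ℝ) ℍ g ∈ X.deck
      rw [hg]; exact φ.2
    · rw [← hφ]
      change (MulAction.toPermHom SL(2, ℝ) ℍ g) z = (φ : Equiv.Perm ℍ) z
      rw [hg]
  · rintro ⟨g, hg, rfl⟩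
    exact (X.proj_smul hg z).symm

theorem continuous_proj : Continuous X.proj := X.isQuotientCoveringMap.isCoveringMap.continuous

theorem isOpenMap_proj : IsOpenMap X.proj := X.isQuotientCoveringMap.isCoveringMap.isOpenMap

/-- Compactness of the surface, expressed by a finite cover of `ℍ` by the translates of balls that
are disjoint from their translates. -/
theorem exists_finset_balls [CompactSpace S] : ∃ (t : Finset ℍ) (r : ℍ → ℝ), (∀ z, 0 < r z) ∧
    (∀ z, ∀ g ∈ X.matrixGroup, ∀ w ∈ Metric.ball z (2 * r z), g • w ∈ Metric.ball z (2 * r z) →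
      ∀ v : ℍ, g • v = v) ∧
    ∀ w : ℍ, ∃ z ∈ t, ∃ g ∈ X.matrixGroup, g • w ∈ Metric.ball z (r z) := by
  have h1 : ∀ z : ℍ, ∃ r > 0, ∀ g ∈ X.matrixGroup, ∀ w ∈ Metric.ball z (2 * r),
      g • w ∈ Metric.ball z (2 * r) → ∀ v : ℍ, g • v = v := by
    intro z
    obtain ⟨U, hU, hdis⟩ := X.isQuotientCoveringMap.disjoint z
    obtain ⟨ε, hε, hεU⟩ := Metric.mem_nhds_iff.mp hU
    refine ⟨ε / 2, by positivity, fun g hg w hw hgw v => ?_⟩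
    rw [mul_div_cancel₀ _ (two_ne_zero)] at hw hgw
    have := hdis ⟨_, hg⟩ ⟨g • w, ⟨w, hεU hw, rfl⟩, hεU hgw⟩
    have h2 : MulAction.toPermHom SL(2, ℝ) ℍ g = 1 := congrArg Subtype.val this
    exact congrArg (fun e : Equiv.Perm ℍ => e v) h2
  choose r hr hdis using h1
  have hcov : (Set.univ : Set S) ⊆ ⋃ z : ℍ, X.proj '' Metric.ball z (r z) := by
    intro s _
    obtain ⟨z, rfl⟩ := X.isQuotientCoveringMap.surjective s
    exact Set.mem_iUnion.mpr ⟨z, z, Metric.mem_ball_self (hr z), rfl⟩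
  obtain ⟨t, ht⟩ := isCompact_univ.elim_finite_subcover _
    (fun z => X.isOpenMap_proj _ Metric.isOpen_ball) hcov
  refine ⟨t, r, hr, hdis, fun w => ?_⟩
  have := ht (Set.mem_univ (X.proj w))
  simp only [Set.mem_iUnion] at this
  obtain ⟨z, hz, v, hv, hvw⟩ := this
  obtain ⟨g, hg, hgw⟩ := X.proj_eq_iff.mp hvw.symm
  exact ⟨z, hz, g, hg, hgw ▸ hv⟩

/-- Covering transformations other than the identity move every point by a definite amount. -/
theorem exists_pos_displacement [CompactSpace S] : ∃ r > 0, ∀ g ∈ X.matrixGroup,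
    ∀ z : ℍ, dist z (g • z) < r → ∀ w : ℍ, g • w = w := by
  obtain ⟨t, r, hr, hdis, hcov⟩ := X.exists_finset_balls
  have hne : t.Nonempty := by
    obtain ⟨z, hz, -⟩ := hcov UpperHalfPlane.I
    exact ⟨z, hz⟩
  refine ⟨t.inf' hne r, ?_, fun g hg w hw v => ?_⟩
  · rw [gt_iff_lt, Finset.lt_inf'_iff]
    exact fun z _ => hr z
  · obtain ⟨z, hz, k, hk, hkw⟩ := hcov w
    have hle : t.inf' hne r ≤ r z := Finset.inf'_le _ hz
    have hrz := hr z
    have h := hdis z (k * g * k⁻¹) (mul_mem (mul_mem hk hg) (inv_mem hk)) (k • w)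
      (Metric.ball_subset_ball (by linarith) hkw) ?_ (k • v)
    · rw [mul_smul, mul_smul, inv_smul_smul] at h
      exact smul_left_cancel k h
    · rw [mul_smul, mul_smul, inv_smul_smul, Metric.mem_ball]
      have h1 : dist (k • g • w) (k • w) = dist w (g • w) := by rw [dist_smul, dist_comm]
      have h2 := dist_triangle (k • g • w) (k • w) z
      rw [Metric.mem_ball] at hkw
      linarith

/-- The group of covering transformations is cocompact. -/
theorem exists_dist_le [CompactSpace S] : ∃ R : ℝ, ∀ w : ℍ, ∃ g ∈ X.matrixGroup,
    dist (g • w) UpperHalfPlane.I ≤ R := by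
  obtain ⟨t, r, hr, hdis, hcov⟩ := X.exists_finset_balls
  refine ⟨∑ z ∈ t, (r z + dist z UpperHalfPlane.I), fun w => ?_⟩
  obtain ⟨z, hz, k, hk, hkw⟩ := hcov w
  refine ⟨k, hk, ?_⟩
  have h1 := Finset.single_le_sum (f := fun z => r z + dist z UpperHalfPlane.I)
    (fun i _ => add_nonneg (hr i).le dist_nonneg) hz
  have h2 := dist_triangle (k • w) z UpperHalfPlane.I
  rw [Metric.mem_ball] at hkw
  linarith

theorem countable_deck : Countable X.deck := by
  obtain ⟨U, hU, hdis⟩ := X.isQuotientCoveringMap.disjoint UpperHalfPlane.I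
  obtain ⟨V, hVU, hVo, hV⟩ := mem_nhds_iff.mp hU
  have hcs := X.isQuotientCoveringMap.continuous_const_smul
  refine Pairwise.countable_of_isOpen_disjoint (α := ℍ)
    (s := fun φ : X.deck => (fun z => φ⁻¹ • z) ⁻¹' V) ?_
    (fun φ => hVo.preimage (hcs φ⁻¹)) (fun φ => ⟨φ • UpperHalfPlane.I, by simpa using hV⟩)
  intro φ ψ hne
  refine Set.disjoint_left.mpr fun z hz hz' => hne ?_
  have := hdis (φ⁻¹ * ψ) ⟨φ⁻¹ • z, ⟨ψ⁻¹ • z, hVU hz', by simp [mul_smul]⟩, hVU hz⟩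
  rwa [inv_mul_eq_one] at this

end HyperbolicSurface

end

/-! ### A pair of expanding covering transformations -/

noncomputable section

/-- The matrix of determinant one with the given entries. -/
def mkSL (a b c d : ℝ) (h : a * d - b * c = 1) : SL(2, ℝ) :=
  ⟨!![a, b; c, d], by rw [Matrix.det_fin_two_of]; exact h⟩

@[simp] theorem mkSL_zero_zero (a b c d : ℝ) (h) : mkSL a b c d h 0 0 = a := rfl
@[simp] theorem mkSL_zero_one (a b c d : ℝ) (h) : mkSL a b c d h 0 1 = b := rfl
@[simp] theorem mkSL_one_zero (a b c d : ℝ) (h) : mkSL a b c d h 1 0 = c := rfl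
@[simp] theorem mkSL_one_one (a b c d : ℝ) (h) : mkSL a b c d h 1 1 = d := rfl

namespace SL2

theorem ext' {g h : SL(2, ℝ)} (h00 : g 0 0 = h 0 0) (h01 : g 0 1 = h 0 1) (h10 : g 1 0 = h 1 0)
    (h11 : g 1 1 = h 1 1) : g = h := by
  ext i j
  fin_cases i <;> fin_cases j <;> assumption

theorem det_eq (g : SL(2, ℝ)) : g 0 0 * g 1 1 - g 0 1 * g 1 0 = 1 := by
  rw [← Matrix.det_fin_two]; exact g.2

theorem mul_apply' (g h : SL(2, ℝ)) (i j : Fin 2) : (g * h) i j = g i 0 * h 0 j + g i 1 * h 1 j := by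
  rw [Matrix.SpecialLinearGroup.coe_mul, Matrix.mul_apply, Fin.sum_univ_two]

theorem inv_zero_zero (g : SL(2, ℝ)) : g⁻¹ 0 0 = g 1 1 := by
  rw [Matrix.SpecialLinearGroup.SL2_inv_expl]; rfl
theorem inv_zero_one (g : SL(2, ℝ)) : g⁻¹ 0 1 = - g 0 1 := by
  rw [Matrix.SpecialLinearGroup.SL2_inv_expl]; rfl
theorem inv_one_zero (g : SL(2, ℝ)) : g⁻¹ 1 0 = - g 1 0 := by
  rw [Matrix.SpecialLinearGroup.SL2_inv_expl]; rfl
theorem inv_one_one (g : SL(2, ℝ)) : g⁻¹ 1 1 = g 0 0 := by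
  rw [Matrix.SpecialLinearGroup.SL2_inv_expl]; rfl

theorem coe_smul' (g : SL(2, ℝ)) (z : ℍ) :
    ((g • z : ℍ) : ℂ) = (g 0 0 * z + g 0 1) / (g 1 0 * z + g 1 1) :=
  UpperHalfPlane.coe_specialLinearGroup_apply g z

theorem denom_ne (g : SL(2, ℝ)) (z : ℍ) : ((g 1 0 : ℂ) * z + g 1 1) ≠ 0 :=
  UpperHalfPlane.denom_ne_zero (g : GL (Fin 2) ℝ) z

theorem smul_eq_iff (g : SL(2, ℝ)) (z w : ℍ) :
    g • z = w ↔ (g 0 0 * z + g 0 1 : ℂ) = w * (g 1 0 * z + g 1 1) := by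
  rw [← div_eq_iff (denom_ne g z), ← coe_smul', UpperHalfPlane.coe_inj]

/-- A matrix that fixes every point is scalar. -/
theorem eq_of_forall_smul_eq {g : SL(2, ℝ)} (h : ∀ z : ℍ, g • z = z) :
    g 0 1 = 0 ∧ g 1 0 = 0 ∧ g 0 0 = g 1 1 := by
  have h1 := (smul_eq_iff g _ _).mp (h UpperHalfPlane.I)
  have h2 := (smul_eq_iff g _ _).mp (h ⟨2 * Complex.I, by simp⟩)
  simp only [UpperHalfPlane.coe_I, Complex.ext_iff] at h1 h2
  simp at h1 h2
  obtain ⟨h1, h1'⟩ := h1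
  obtain ⟨h2, h2'⟩ := h2
  refine ⟨by linarith, by linarith, by linarith⟩

/-- The diagonal matrix with entries `exp (t / 2)`, `exp (- t / 2)`, which acts on `ℍ` as the
translation of length `t` along the imaginary axis. -/
def diag (t : ℝ) : SL(2, ℝ) :=
  mkSL (Real.exp (t / 2)) 0 0 (Real.exp (-(t / 2))) (by rw [← Real.exp_add]; simp)

theorem diag_add (s t : ℝ) : diag (s + t) = diag s * diag t := by
  apply ext' <;> simp [diag, mul_apply', ← Real.exp_add] <;> ring_nf

theorem diag_zero : diag 0 = 1 := by
  apply ext' <;> simp [diag]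

theorem coe_diag_smul (t : ℝ) (z : ℍ) : ((diag t • z : ℍ) : ℂ) = Real.exp t * z := by
  rw [coe_smul']
  simp only [diag, mkSL_zero_zero, mkSL_zero_one, mkSL_one_zero, mkSL_one_one,
    Complex.ofReal_zero, zero_mul, add_zero, zero_add]
  rw [div_eq_iff (by exact_mod_cast (Real.exp_pos _).ne'), mul_right_comm, ← Complex.ofReal_mul,
    ← Real.exp_add]
  congr 3; ring

theorem im_diag_smul_I (t : ℝ) : (diag t • UpperHalfPlane.I).im = Real.exp t := by
  have := congrArg Complex.im (coe_diag_smul t UpperHalfPlane.I)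
  rwa [UpperHalfPlane.coe_im, UpperHalfPlane.coe_I, Complex.im_ofReal_mul, Complex.I_im,
    mul_one] at this

theorem dist_diag_smul_I (s t : ℝ) :
    dist (diag s • UpperHalfPlane.I) (diag t • UpperHalfPlane.I) = |s - t| := by
  have hre (t : ℝ) : (diag t • UpperHalfPlane.I).re = 0 := by
    have := congrArg Complex.re (coe_diag_smul t UpperHalfPlane.I)
    simpa using this
  rw [UpperHalfPlane.dist_of_re_eq (by rw [hre, hre]), im_diag_smul_I, im_diag_smul_I,
    Real.log_exp, Real.log_exp, Real.dist_eq]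

end SL2

/-- The properties of the group of covering transformations of a closed hyperbolic surface that are
used to find a pair of covering transformations which generate a free semigroup. -/
structure IsFreeCocompact (Γ : Subgroup SL(2, ℝ)) : Prop where
  neg_mem : ∀ g ∈ Γ, -g ∈ Γ
  displacement : ∃ r > 0, ∀ g ∈ Γ, ∀ z : ℍ, dist z (g • z) < r → ∀ w : ℍ, g • w = w
  cocompact : ∃ R : ℝ, ∀ w : ℍ, ∃ g ∈ Γ, dist (g • w) UpperHalfPlane.I ≤ R

namespace IsFreeCocompact

variable {Γ : Subgroup SL(2, ℝ)}

theorem conj (h : IsFreeCocompact Γ) (C : SL(2, ℝ)) :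
    IsFreeCocompact (Γ.comap (MulAut.conj C).toMonoidHom) := by
  obtain ⟨h0, ⟨r, hr, h1⟩, R, h2⟩ := h
  refine ⟨fun g hg => ?_, ⟨r, hr, fun g hg z hz w => ?_⟩, R + dist (C⁻¹ • UpperHalfPlane.I) UpperHalfPlane.I,
    fun w => ?_⟩
  · have hg' : C * g * C⁻¹ ∈ Γ := hg
    change C * -g * C⁻¹ ∈ Γ
    rw [mul_neg, neg_mul]
    exact h0 _ hg'
  · have hg' : C * g * C⁻¹ ∈ Γ := hg
    have := h1 _ hg' (C • z) (by
      rw [mul_smul, mul_smul, inv_smul_smul, dist_smul]; exact hz) (C • w)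
    rw [mul_smul, mul_smul, inv_smul_smul] at this
    exact smul_left_cancel C this
  · obtain ⟨g, hg, hgw⟩ := h2 (C • w)
    refine ⟨C⁻¹ * g * C, ?_, ?_⟩
    · change C * (C⁻¹ * g * C) * C⁻¹ ∈ Γ
      convert hg using 1; group
    · have h3 := dist_triangle ((C⁻¹ * g * C) • w) (C⁻¹ • UpperHalfPlane.I) UpperHalfPlane.I
      have h4 : dist ((C⁻¹ * g * C) • w) (C⁻¹ • UpperHalfPlane.I) =
          dist (g • C • w) UpperHalfPlane.I := by
        rw [mul_smul, mul_smul, dist_smul]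
      linarith

/-- The group contains no parabolic elements: they would have arbitrarily small displacement. -/
theorem zero_one_eq_zero_of_sq_eq_one (h : IsFreeCocompact Γ) {g : SL(2, ℝ)} (hg : g ∈ Γ)
    (hc : g 1 0 = 0) (ha : g 0 0 ^ 2 = 1) : g 0 1 = 0 := by
  obtain ⟨r, hr, h1⟩ := h.displacement
  have hdet := SL2.det_eq g
  rw [hc, mul_zero, sub_zero] at hdet
  have had : g 0 0 = g 1 1 := by
    have h0 : g 0 0 ≠ 0 := by intro h0; rw [h0] at ha; norm_num at ha
    exact mul_left_cancel₀ h0 (by rw [hdet, ← sq, ha])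
  have hd0 : g 1 1 ≠ 0 := by rintro h0; rw [h0] at hdet; simp at hdet
  have hd1 : |g 1 1| = 1 := by rw [← had]; exact (abs_eq zero_le_one).mpr (sq_eq_one_iff.mp ha)
  set y : ℝ := |g 0 1| / r + 1 with hy
  have hy0 : 0 < y := by positivity
  let z : ℍ := ⟨y * Complex.I, by simpa using hy0⟩
  have hzc : (z : ℂ) = y * Complex.I := rfl
  have hzim : z.im = y := by simp [z, UpperHalfPlane.im]
  have hgz : ((g • z : ℍ) : ℂ) = z + g 0 1 / g 1 1 := by
    rw [SL2.coe_smul', hc, had]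
    have : (g 1 1 : ℂ) ≠ 0 := by exact_mod_cast hd0
    rw [Complex.ofReal_zero, zero_mul, zero_add, add_div, mul_div_cancel_left₀ _ this]
  have him : (g • z).im = y := by
    have := congrArg Complex.im hgz
    rw [← Complex.ofReal_div] at this
    simpa [hzim] using this
  have hdist : dist z (g • z) < r := by
    refine (UpperHalfPlane.dist_le_dist_coe_div_sqrt _ _).trans_lt ?_
    rw [him, hzim, Real.sqrt_mul_self hy0.le, hgz, dist_self_add_right, norm_div,
      Complex.norm_real, Complex.norm_real, Real.norm_eq_abs, Real.norm_eq_abs, hd1, div_one,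
      div_lt_iff₀ hy0, hy]
    have : r * (|g 0 1| / r + 1) = |g 0 1| + r := by field_simp
    linarith
  exact (SL2.eq_of_forall_smul_eq (h1 g hg z hdist)).1

theorem exists_not_scalar (h : IsFreeCocompact Γ) : ∃ g ∈ Γ, ¬ ∀ w : ℍ, g • w = w := by
  by_contra! hall
  obtain ⟨R, hR⟩ := h.cocompact
  obtain ⟨g, hg, hgw⟩ := hR (SL2.diag (|R| + 1) • UpperHalfPlane.I)
  have h0 : dist (SL2.diag (|R| + 1) • UpperHalfPlane.I) UpperHalfPlane.I = |R| + 1 := by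
    have := SL2.dist_diag_smul_I (|R| + 1) 0
    rwa [SL2.diag_zero, one_smul, sub_zero, abs_of_nonneg (a := |R| + 1) (by positivity)] at this
  rw [hall g hg, h0] at hgw
  have h2 := le_abs_self R
  linarith

/-- A covering transformation other than the identity is not elliptic. -/
theorem four_le_sq_trace (h : IsFreeCocompact Γ) {g : SL(2, ℝ)} (hg : g ∈ Γ)
    (hne : ¬ ∀ w : ℍ, g • w = w) : 4 ≤ (g 0 0 + g 1 1) ^ 2 := by
  by_contra! hlt
  have hdet : (0 : ℝ) < (g : GL (Fin 2) ℝ).val.det := by simp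
  have hell : (g : GL (Fin 2) ℝ).IsElliptic := by
    change Matrix.discr _ < 0
    rw [Matrix.discr_fin_two, Matrix.trace_fin_two]
    have : (g : GL (Fin 2) ℝ).val.det = 1 := by simp
    rw [this]
    change (g 0 0 + g 1 1) ^ 2 - 4 * 1 < 0
    linarith
  have hfix := (UpperHalfPlane.gl_smul_eq_self_iff_eq_fixedPt
    (z := UpperHalfPlane.fixedPt _ hell) hdet hell).mpr rfl
  obtain ⟨r, hr, h1⟩ := h.displacement
  exact hne (h1 g hg _ (by
    have : g • UpperHalfPlane.fixedPt _ hell = UpperHalfPlane.fixedPt _ hell := hfix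
    rw [this, dist_self]; exact hr))

/-- Up to conjugation, the group contains a hyperbolic diagonal matrix. -/
theorem exists_conj_diag (h : IsFreeCocompact Γ) : ∃ (C : SL(2, ℝ)) (t : ℝ), 0 < t ∧
    C * SL2.diag t * C⁻¹ ∈ Γ := by
  obtain ⟨g, hg, hne⟩ := h.exists_not_scalar
  have htr := h.four_le_sq_trace hg hne
  have hdet := SL2.det_eq g
  -- an eigenvalue of `g`
  obtain ⟨l, hl⟩ : ∃ l : ℝ, l * l - (g 0 0 + g 1 1) * l + 1 = 0 := by
    obtain ⟨l, hl⟩ := exists_quadratic_eq_zero (a := (1 : ℝ)) (b := -(g 0 0 + g 1 1)) (c := 1)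
      one_ne_zero ⟨√((g 0 0 + g 1 1) ^ 2 - 4), by
        rw [discrim, Real.mul_self_sqrt (by linarith)]; ring⟩
    exact ⟨l, by linarith⟩
  have hl0 : l ≠ 0 := by rintro rfl; simp at hl
  -- an eigenvector for this eigenvalue
  obtain ⟨v, w, hvw, h1, h2⟩ : ∃ v w : ℝ, v ^ 2 + w ^ 2 ≠ 0 ∧ g 0 0 * v + g 0 1 * w = l * v ∧
      g 1 0 * v + g 1 1 * w = l * w := by
    by_cases hb : g 0 1 = 0 ∧ g 0 0 = l
    · by_cases hd : g 1 0 = 0 ∧ g 1 1 = l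
      · exact ⟨1, 0, by norm_num, by rw [hb.1, hb.2]; ring, by rw [hd.1]; ring⟩
      · refine ⟨l - g 1 1, g 1 0, ?_, by rw [hb.1, hb.2]; ring, by ring⟩
        intro h0
        have h3 : g 1 0 = 0 := by nlinarith [sq_nonneg (l - g 1 1), sq_nonneg (g 1 0)]
        have h4 : l - g 1 1 = 0 := by nlinarith [sq_nonneg (l - g 1 1), sq_nonneg (g 1 0)]
        exact hd ⟨h3, by linarith⟩
    · refine ⟨g 0 1, l - g 0 0, ?_, by ring, by linear_combination - hl - hdet⟩
      intro h0
      have h3 : g 0 1 = 0 := by nlinarith [sq_nonneg (l - g 0 0), sq_nonneg (g 0 1)]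
      have h4 : l - g 0 0 = 0 := by nlinarith [sq_nonneg (l - g 0 0), sq_nonneg (g 0 1)]
      exact hb ⟨h3, by linarith⟩
  have hvw' : 0 < v ^ 2 + w ^ 2 := lt_of_le_of_ne (by positivity) hvw.symm
  let D : SL(2, ℝ) := mkSL v (-w / (v ^ 2 + w ^ 2)) w (v / (v ^ 2 + w ^ 2)) (by field_simp; ring)
  -- the conjugate of `g` is upper triangular
  have hΓ := h.conj D
  set k : SL(2, ℝ) := D⁻¹ * g * D with hk
  have hkΓ : k ∈ Γ.comap (MulAut.conj D).toMonoidHom := by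
    change D * (D⁻¹ * g * D) * D⁻¹ ∈ Γ
    convert hg using 1; group
  have hDk : D * k = g * D := by rw [hk]; group
  have k00 : k 0 0 = l := by
    rw [hk, SL2.mul_apply', SL2.mul_apply', SL2.mul_apply', SL2.inv_zero_zero, SL2.inv_zero_one]
    simp only [D, mkSL_zero_zero, mkSL_zero_one, mkSL_one_zero, mkSL_one_one]
    field_simp
    linear_combination v * h1 + w * h2
  have k10 : k 1 0 = 0 := by
    rw [hk, SL2.mul_apply', SL2.mul_apply', SL2.mul_apply', SL2.inv_one_zero, SL2.inv_one_one]
    simp only [D, mkSL_zero_zero, mkSL_one_zero]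
    linear_combination v * h2 - w * h1
  have hkdet := SL2.det_eq k
  rw [k00, k10, mul_zero, sub_zero] at hkdet
  have hl1 : l ^ 2 ≠ 1 := by
    intro hl1
    have k01 := hΓ.zero_one_eq_zero_of_sq_eq_one hkΓ k10 (by rw [k00, hl1])
    have k11 : k 1 1 = l := mul_left_cancel₀ hl0 (by rw [hkdet, ← sq, hl1])
    refine hne fun z => ?_
    have hkfix : ∀ u : ℍ, k • u = u := by
      intro u
      rw [SL2.smul_eq_iff, k00, k01, k10, k11]
      simp [mul_comm]
    have : g = D * k * D⁻¹ := by rw [hDk]; group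
    rw [this, mul_smul, mul_smul, hkfix, smul_inv_smul]
  -- a further conjugation makes it diagonal
  set b : ℝ := k 0 1 with hb
  have hl2 : l⁻¹ - l ≠ 0 := by
    intro h0
    apply hl1
    field_simp at h0
    linarith
  let U : SL(2, ℝ) := mkSL 1 (b / (l⁻¹ - l)) 0 1 (by ring)
  have k11 : k 1 1 = l⁻¹ := eq_inv_of_mul_eq_one_right hkdet
  have hkU : k * U = U * mkSL l 0 0 l⁻¹ (by field_simp; simp) := by
    apply SL2.ext' <;> simp only [SL2.mul_apply', U, mkSL_zero_zero, mkSL_zero_one, mkSL_one_zero,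
      mkSL_one_one, k00, k10, k11, ← hb]
    · ring
    · field_simp; ring
    · ring
    · ring
  have hsq : ∀ s : ℝ, Real.exp s = l ^ 2 → ∀ hh, mkSL (l ^ 2) 0 0 ((l⁻¹) ^ 2) hh = SL2.diag (2 * s) := by
    intro s hs hh
    apply SL2.ext' <;> simp [SL2.diag, Real.exp_neg, hs]
  have hlpos : 0 < l ^ 2 := by positivity
  have hDU : D * U * mkSL (l ^ 2) 0 0 ((l⁻¹) ^ 2) (by field_simp; simp) * (D * U)⁻¹ = g ^ 2 := by
    have e1 : mkSL (l ^ 2) 0 0 ((l⁻¹) ^ 2) (by field_simp; simp) =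
        mkSL l 0 0 l⁻¹ (by field_simp; simp) * mkSL l 0 0 l⁻¹ (by field_simp; simp) := by
      apply SL2.ext' <;> simp [SL2.mul_apply', sq]
    have e2 : mkSL l 0 0 l⁻¹ (by field_simp; simp) = U⁻¹ * k * U := by
      rw [mul_assoc, hkU]; group
    rw [e1, e2, hk]; group
    exact (sq g).symm
  rw [hsq (Real.log (l ^ 2)) (Real.exp_log hlpos)] at hDU
  have hlog : Real.log (l ^ 2) ≠ 0 := by
    intro h0
    apply hl1
    rw [← Real.exp_log hlpos, h0, Real.exp_zero]
  rcases lt_or_gt_of_ne hlog with hneg | hpos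
  · refine ⟨D * U, -(2 * Real.log (l ^ 2)), by linarith, ?_⟩
    have : SL2.diag (-(2 * Real.log (l ^ 2))) = (SL2.diag (2 * Real.log (l ^ 2)))⁻¹ := by
      rw [eq_inv_iff_mul_eq_one, ← SL2.diag_add, neg_add_cancel, SL2.diag_zero]
    rw [this, ← MulAut.conj_apply, map_inv, MulAut.conj_apply, hDU]
    exact inv_mem (pow_mem hg 2)
  · exact ⟨D * U, 2 * Real.log (l ^ 2), by positivity, by rw [hDU]; exact pow_mem hg 2⟩

/-- If the group contains a hyperbolic diagonal matrix, some element of the group maps neither `∞`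
to `∞` nor `∞` to `0`. -/
theorem exists_zero_zero_ne_zero (h : IsFreeCocompact Γ) {t : ℝ} (ht : 0 < t)
    (hd : SL2.diag t ∈ Γ) : ∃ k ∈ Γ, k 0 0 ≠ 0 ∧ k 1 0 ≠ 0 := by
  by_contra! hall
  -- an element that fixes `∞` fixes `0`, because its commutator with the diagonal matrix
  -- is not parabolic
  have h1 : ∀ k ∈ Γ, k 1 0 = 0 → k 0 1 = 0 := by
    intro k hk hk0
    have hdet := SL2.det_eq k
    rw [hk0, mul_zero, sub_zero] at hdet
    set c := k * SL2.diag t * k⁻¹ * (SL2.diag t)⁻¹ with hc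
    have hcΓ : c ∈ Γ := mul_mem (mul_mem (mul_mem hk hd) (inv_mem hk)) (inv_mem hd)
    have hee : Real.exp (t / 2) * Real.exp (-(t / 2)) = 1 := by rw [← Real.exp_add]; simp
    set e := Real.exp (t / 2) with he
    set e' := Real.exp (-(t / 2)) with he'
    have c00 : c 0 0 = 1 := by
      simp only [hc, SL2.mul_apply', SL2.inv_zero_zero, SL2.inv_zero_one, SL2.inv_one_zero,
        SL2.inv_one_one, SL2.diag, mkSL_zero_zero, mkSL_zero_one, mkSL_one_zero, mkSL_one_one, hk0,
        ← he, ← he']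
      linear_combination e * e' * hdet + hee
    have c10 : c 1 0 = 0 := by
      simp only [hc, SL2.mul_apply', SL2.inv_zero_zero, SL2.inv_zero_one, SL2.inv_one_zero,
        SL2.inv_one_one, SL2.diag, mkSL_zero_zero, mkSL_zero_one, mkSL_one_zero, mkSL_one_one, hk0]
      ring
    have c01 := h.zero_one_eq_zero_of_sq_eq_one hcΓ c10 (by rw [c00, one_pow])
    simp only [hc, SL2.mul_apply', SL2.inv_zero_zero, SL2.inv_zero_one, SL2.inv_one_zero,
        SL2.inv_one_one, SL2.diag, mkSL_zero_zero, mkSL_zero_one, mkSL_one_zero, mkSL_one_one, hk0,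
        ← he, ← he'] at c01
    have hk00 : k 0 0 ≠ 0 := by rintro h0; rw [h0] at hdet; simp at hdet
    have he1 : 1 < e := by rw [he, Real.one_lt_exp_iff]; linarith
    have hprod : k 0 0 * (k 0 1 * (e * e' - e ^ 2)) = 0 := by linear_combination c01
    have hne : e * e' - e ^ 2 ≠ 0 := by rw [hee]; nlinarith
    simpa [hk00, hne] using hprod
  -- no element maps `∞` to `0`: its square would be elliptic
  have h2 : ∀ k ∈ Γ, k 0 0 ≠ 0 := by
    intro k hk hk0
    have hdet := SL2.det_eq k
    rw [hk0, zero_mul, zero_sub] at hdet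
    have h3 : (k * k) 0 0 ≠ 0 := by
      rw [SL2.mul_apply', hk0]
      intro h0
      linarith
    have h4 : (k * k) 1 0 = 0 := hall _ (mul_mem hk hk) h3
    rw [SL2.mul_apply', hk0, mul_zero, zero_add] at h4
    have hk10 : k 1 0 ≠ 0 := by intro h0; rw [h0] at hdet; simp at hdet
    have hk11 : k 1 1 = 0 := by simpa [hk10] using h4
    have := h.four_le_sq_trace hk ?_
    · rw [hk0, hk11] at this; norm_num at this
    · intro hfix
      exact hk10 (SL2.eq_of_forall_smul_eq hfix).2.1
  -- thus the group preserves the imaginary axis and it is not cocompact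
  obtain ⟨R, hR⟩ := h.cocompact
  set ε : ℝ := 1 / (Real.cosh R + 1) with hε
  have hε0 : 0 < ε := by positivity
  let w : ℍ := ⟨1 + ε * Complex.I, by simpa using hε0⟩
  obtain ⟨k, hk, hkw⟩ := hR w
  have hk10 : k 1 0 = 0 := hall k hk (h2 k hk)
  have hk01 := h1 k hk hk10
  have hdet := SL2.det_eq k
  rw [hk10, mul_zero, sub_zero] at hdet
  have hk11 : k 1 1 ≠ 0 := by intro h0; rw [h0] at hdet; simp at hdet
  set p := k 0 0 with hp
  have hp0 : 0 < p ^ 2 := by have := h2 k hk; positivity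
  have hcoe : ((k • w : ℍ) : ℂ) = p ^ 2 + (p ^ 2 * ε : ℝ) * Complex.I := by
    rw [SL2.coe_smul', hk10, hk01, div_eq_iff (by simpa using hk11)]
    have h5 : (p : ℂ) * k 1 1 = 1 := by exact_mod_cast hdet
    simp only [w, Complex.ofReal_zero]
    push_cast
    linear_combination (-(p : ℂ) * (1 + ε * Complex.I)) * h5
  have him : (k • w).im = p ^ 2 * ε := by
    have := congrArg Complex.im hcoe
    rw [UpperHalfPlane.coe_im] at this
    rw [this]; simp [← Complex.ofReal_pow]
  have hre : (k • w).re = p ^ 2 := by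
    have := congrArg Complex.re hcoe
    rw [UpperHalfPlane.coe_re] at this
    rw [this]; simp [← Complex.ofReal_pow]
  have hch := UpperHalfPlane.cosh_dist' (k • w) UpperHalfPlane.I
  rw [him, hre, UpperHalfPlane.I_im, UpperHalfPlane.I_re] at hch
  have hle : Real.cosh (dist (k • w) UpperHalfPlane.I) ≤ Real.cosh R := by
    rw [Real.cosh_le_cosh, abs_of_nonneg dist_nonneg]
    exact hkw.trans (le_abs_self R)
  rw [hch, div_le_iff₀ (by positivity)] at hle
  have hεR : ε * (Real.cosh R + 1) = 1 := by rw [hε]; field_simp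
  nlinarith [sq_nonneg (p ^ 2 - 1), sq_nonneg (p ^ 2 * ε)]

end IsFreeCocompact

/-- A matrix that maps the set of directions of slope at most `1` into the set of directions of slope
at most `3 / 4`, expands the vectors of these directions, and whose inverse does the same with the
two axes exchanged. -/
structure IsExpanding (M : SL(2, ℝ)) : Prop where
  two_le : 2 ≤ M 0 0 - |M 0 1|
  two_le' : 2 ≤ M 0 0 - |M 1 0|
  slope_le : |M 1 0| + |M 1 1| ≤ 3 / 4 * (M 0 0 - |M 0 1|)
  slope_le' : |M 0 1| + |M 1 1| ≤ 3 / 4 * (M 0 0 - |M 1 0|)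

/-- A quantitative form of the fact that a small neighborhood of `0` and a small neighborhood of
`r / p` are disjoint. -/
theorem slopes_ne {p q r u L m m' : ℝ} (hp1 : 0 < p) (hL4 : 4 ≤ L)
    (hpL : 4 + 4 * |q| + 4 * |u| ≤ p * L) (hr0 : |r| = p / 2) (hm : |m| ≤ 1) (hm' : |m'| ≤ 1) :
    L⁻¹ * m * (p * L + q * L⁻¹ * m') ≠ (r * L + u * L⁻¹ * m') * L := by
  intro heq
  have hL0 : 0 < L := by linarith
  have hLi : L⁻¹ ≤ 1 / 4 := by
    rw [← one_div]; exact one_div_le_one_div_of_le (by norm_num) hL4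
  have hLi0 : 0 < L⁻¹ := by positivity
  have hLL : L * L⁻¹ = 1 := mul_inv_cancel₀ hL0.ne'
  have hq0 := abs_nonneg q
  have hu0 := abs_nonneg u
  have e1 : L⁻¹ * m * (p * L + q * L⁻¹ * m') = p * m + q * (L⁻¹ * L⁻¹) * (m * m') := by
    linear_combination p * m * hLL
  have e2 : (r * L + u * L⁻¹ * m') * L = r * L * L + u * m' := by
    linear_combination u * m' * hLL
  have e3 : r * L * L = p * m + q * (L⁻¹ * L⁻¹) * (m * m') - u * m' := by
    linear_combination e1 - heq - e2
  have e4 : |r * L * L| = p / 2 * L * L := by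
    rw [abs_mul, abs_mul, hr0, abs_of_pos hL0]
  have e5 : |p * m| ≤ p := by
    rw [abs_mul, abs_of_pos hp1]; exact mul_le_of_le_one_right hp1.le hm
  have e6 : |u * m'| ≤ |u| := by
    rw [abs_mul]; exact mul_le_of_le_one_right hu0 hm'
  have e7 : |q * (L⁻¹ * L⁻¹) * (m * m')| ≤ |q| := by
    rw [abs_mul, abs_mul, mul_assoc]
    refine mul_le_of_le_one_right hq0 ?_
    rw [abs_of_pos (mul_pos hLi0 hLi0), abs_mul]
    exact mul_le_one₀ (by nlinarith) (by positivity) (mul_le_one₀ hm (abs_nonneg _) hm')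
  have e8 : |r * L * L| ≤ p + |q| + |u| := by
    rw [e3]
    exact (abs_sub _ _).trans (add_le_add ((abs_add_le _ _).trans (add_le_add e5 e7)) e6)
  rw [e4] at e8
  have e9 : 0 < p * L := mul_pos hp1 hL0
  have e10 : p * 4 ≤ p * L := mul_le_mul_of_nonneg_left hL4 hp1.le
  have e11 : p * L * 4 ≤ p * L * L := mul_le_mul_of_nonneg_left hL4 e9.le
  linarith

/-- Up to conjugation, the group contains two expanding matrices which map the set of directions of
slope at most `1` to disjoint sets. -/
theorem IsFreeCocompact.exists_expanding {Γ : Subgroup SL(2, ℝ)} (h : IsFreeCocompact Γ) :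
    ∃ (C : SL(2, ℝ)) (M : Bool → SL(2, ℝ)), (∀ b, C * M b * C⁻¹ ∈ Γ) ∧
      (∀ b, IsExpanding (M b)) ∧ ∀ m m' : ℝ, |m| ≤ 1 → |m'| ≤ 1 →
        (M false 1 0 + M false 1 1 * m) * (M true 0 0 + M true 0 1 * m') ≠
          (M true 1 0 + M true 1 1 * m') * (M false 0 0 + M false 0 1 * m) := by
  obtain ⟨C, t, ht, hC⟩ := h.exists_conj_diag
  have h' := h.conj C
  obtain ⟨k, hk, hk00, hk10⟩ := h'.exists_zero_zero_ne_zero ht hC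
  -- choose the sign of `k`
  obtain ⟨k, hk, hk00, hk10⟩ : ∃ k : SL(2, ℝ), C * k * C⁻¹ ∈ Γ ∧ 0 < k 0 0 ∧ k 1 0 ≠ 0 := by
    rcases lt_or_gt_of_ne hk00 with hneg | hpos
    · refine ⟨-k, h'.neg_mem k hk, ?_, ?_⟩
      · rw [Matrix.SpecialLinearGroup.coe_neg, Matrix.neg_apply]; linarith
      · rwa [Matrix.SpecialLinearGroup.coe_neg, Matrix.neg_apply, neg_ne_zero]
    · exact ⟨k, hk, hpos, hk10⟩
  -- rescale so that the image of the first axis has slope `± 1 / 2`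
  set s : ℝ := Real.log (k 0 0 / (2 * |k 1 0|)) with hs
  have hpos : 0 < k 0 0 / (2 * |k 1 0|) := by positivity
  set k' : SL(2, ℝ) := SL2.diag (-s) * k * SL2.diag s with hk'
  set p := k' 0 0 with hp
  set q := k' 0 1 with hq
  set r := k' 1 0 with hr
  set u := k' 1 1 with hu
  have hp0 : p = k 0 0 := by
    simp only [hp, hk', SL2.mul_apply', SL2.diag, mkSL_zero_zero, mkSL_zero_one, mkSL_one_zero]
    have : Real.exp (-s / 2) * Real.exp (s / 2) = 1 := by rw [← Real.exp_add]; ring_nf; simp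
    linear_combination k 0 0 * this
  have hr0 : |r| = p / 2 := by
    have h1 : r = k 1 0 * Real.exp s := by
      simp only [hr, hk', SL2.mul_apply', SL2.diag, mkSL_zero_zero, mkSL_one_zero, mkSL_one_one]
      have : Real.exp (-(-s / 2)) * Real.exp (s / 2) = Real.exp s := by
        rw [← Real.exp_add]; ring_nf
      linear_combination k 1 0 * this
    rw [h1, hs, Real.exp_log hpos, abs_mul, abs_of_pos hpos, hp0]
    field_simp
  have hp1 : 0 < p := hp0 ▸ hk00
  -- a large power of the diagonal matrix
  obtain ⟨n, hn⟩ : ∃ n : ℕ, 4 + (4 + 4 * |q| + 4 * |u|) / p ≤ Real.exp (n * t / 2) := by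
    obtain ⟨n, hn⟩ := exists_nat_ge ((4 + (4 + 4 * |q| + 4 * |u|) / p) / (t / 2))
    refine ⟨n, ?_⟩
    rw [div_le_iff₀ (by positivity)] at hn
    have := Real.add_one_le_exp (n * t / 2)
    linarith
  set L := Real.exp (n * t / 2) with hL
  have hL4 : 4 ≤ L := by
    have : 0 ≤ (4 + 4 * |q| + 4 * |u|) / p := by positivity
    linarith
  have hpL : 4 + 4 * |q| + 4 * |u| ≤ p * L := by
    have : (4 + 4 * |q| + 4 * |u|) / p ≤ L := by linarith
    rw [div_le_iff₀ hp1] at this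
    linarith
  have hL' : Real.exp (-(n * t / 2)) = L⁻¹ := by rw [Real.exp_neg]
  have hLi : L⁻¹ ≤ 1 / 4 := by
    rw [← one_div]; exact one_div_le_one_div_of_le (by norm_num) hL4
  have hLi0 : 0 < L⁻¹ := by positivity
  have hdn : ∀ n : ℕ, SL2.diag (n * t) = SL2.diag t ^ n := by
    intro n
    induction n with
    | zero => simp [SL2.diag_zero]
    | succ n ih => rw [Nat.cast_succ, add_mul, one_mul, SL2.diag_add, ih, pow_succ]
  have hconj : ∀ g : SL(2, ℝ), g ∈ Γ.comap (MulAut.conj C).toMonoidHom →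
      (C * SL2.diag s) * (SL2.diag (-s) * g * SL2.diag s) * (C * SL2.diag s)⁻¹ ∈ Γ := by
    intro g hg
    have hg' : C * g * C⁻¹ ∈ Γ := hg
    have hss : SL2.diag (-s) = (SL2.diag s)⁻¹ := by
      rw [eq_inv_iff_mul_eq_one, ← SL2.diag_add, neg_add_cancel, SL2.diag_zero]
    convert hg' using 1
    rw [hss]; group
  have hD : SL2.diag (n * t) ∈ Γ.comap (MulAut.conj C).toMonoidHom := by
    rw [hdn]
    exact pow_mem (show SL2.diag t ∈ Γ.comap (MulAut.conj C).toMonoidHom from hC) n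
  have hcomm : SL2.diag (-s) * SL2.diag (n * t) * SL2.diag s = SL2.diag (n * t) := by
    rw [← SL2.diag_add, ← SL2.diag_add]; congr 1; ring
  have hcomm' : SL2.diag (-s) * (k * SL2.diag (n * t)) * SL2.diag s = k' * SL2.diag (n * t) := by
    rw [hk', mul_assoc, mul_assoc, ← SL2.diag_add, mul_assoc, mul_assoc, ← SL2.diag_add, add_comm]
  set A := SL2.diag (n * t) with hA
  set B := k' * A with hB
  have A00 : A 0 0 = L := rfl
  have A01 : A 0 1 = 0 := rfl
  have A10 : A 1 0 = 0 := rfl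
  have A11 : A 1 1 = L⁻¹ := hL'
  have B00 : B 0 0 = p * L := by rw [hB, SL2.mul_apply', A00, A10, mul_zero, add_zero]
  have B01 : B 0 1 = q * L⁻¹ := by rw [hB, SL2.mul_apply', A01, A11, mul_zero, zero_add]
  have B10 : B 1 0 = r * L := by rw [hB, SL2.mul_apply', A00, A10, mul_zero, add_zero]
  have B11 : B 1 1 = u * L⁻¹ := by rw [hB, SL2.mul_apply', A01, A11, mul_zero, zero_add]
  have hqL : |q * L⁻¹| ≤ |q| / 4 := by
    rw [abs_mul, abs_of_pos hLi0]
    nlinarith [abs_nonneg q]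
  have huL : |u * L⁻¹| ≤ |u| / 4 := by
    rw [abs_mul, abs_of_pos hLi0]
    nlinarith [abs_nonneg u]
  have hrL : |r * L| = p * L / 2 := by
    rw [abs_mul, hr0, abs_of_pos (by positivity : 0 < L)]; ring
  have hq0 := abs_nonneg q
  have hu0 := abs_nonneg u
  refine ⟨C * SL2.diag s, fun b => bif b then B else A, ?_, ?_, ?_⟩
  · rintro (_ | _)
    · have := hconj _ hD
      rwa [hcomm] at this
    · have := hconj _ (mul_mem (show k ∈ Γ.comap (MulAut.conj C).toMonoidHom from hk) hD)
      rwa [hcomm'] at this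
  · rintro (_ | _)
    · constructor <;> simp only [cond_false, A00, A01, A10, A11, abs_zero, abs_of_pos hLi0] <;>
        linarith
    · constructor <;> simp only [cond_true, B00, B01, B10, B11, hrL] <;> linarith
  · intro m m' hm hm' heq
    simp only [cond_false, cond_true, A00, A01, A10, A11, B00, B01, B10, B11] at heq
    rw [zero_add, zero_mul, add_zero] at heq
    exact slopes_ne hp1 hL4 hpL hr0 hm hm' heq

end

/-! ### Frames along sequences of two matrices -/

noncomputable section

/-- The shift of bi-infinite sequences of two symbols. -/
def shift : (ℤ → Bool) ≃ₜ (ℤ → Bool) where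
  toFun x n := x (n + 1)
  invFun x n := x (n - 1)
  left_inv x := by ext n; simp
  right_inv x := by ext n; simp
  continuous_toFun := by fun_prop
  continuous_invFun := by fun_prop

@[simp] theorem shift_apply (x : ℤ → Bool) (n : ℤ) : shift x n = x (n + 1) := rfl
@[simp] theorem shift_symm_apply (x : ℤ → Bool) (n : ℤ) : shift.symm x n = x (n - 1) := rfl

theorem shift_iterate_apply (x : ℤ → Bool) (n : ℕ) (k : ℤ) : shift^[n] x k = x (k + n) := by
  induction n generalizing x with
  | zero => simp
  | succ n ih => rw [Function.iterate_succ_apply, ih, shift_apply]; congr 1; push_cast; ring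

theorem shift_symm_iterate_apply (x : ℤ → Bool) (n : ℕ) (k : ℤ) :
    shift.symm^[n] x k = x (k - n) := by
  induction n generalizing x with
  | zero => simp
  | succ n ih => rw [Function.iterate_succ_apply, ih, shift_symm_apply]; congr 1; push_cast; ring

/-- A fiberwise contraction of the trivial bundle with fiber `[-1, 1]` over a compact dynamical
system has a continuous invariant section. -/
theorem exists_invariant_section {Y : Type*} [TopologicalSpace Y] [CompactSpace Y] {θ : Y → Y}
    (hθ : Continuous θ) (φ : Y → ℝ → ℝ)
    (hφ : Continuous fun p : Y × Set.Icc (-1 : ℝ) 1 => φ p.1 p.2)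
    (hmaps : ∀ y m, |m| ≤ 1 → |φ y m| ≤ 3 / 4)
    (hlip : ∀ y m m', |m| ≤ 1 → |m'| ≤ 1 → |φ y m - φ y m'| ≤ 1 / 4 * |m - m'|) :
    ∃ u : Y → ℝ, Continuous u ∧ (∀ y, |u y| ≤ 3 / 4) ∧ ∀ y, u y = φ y (u (θ y)) := by
  have hmem : ∀ m : Set.Icc (-1 : ℝ) 1, |(m : ℝ)| ≤ 1 := fun m => abs_le.mpr m.2
  let T : C(Y, Set.Icc (-1 : ℝ) 1) → C(Y, Set.Icc (-1 : ℝ) 1) := fun u =>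
    ⟨fun y => ⟨φ y (u (θ y)), abs_le.mp ((hmaps y _ (hmem _)).trans (by norm_num))⟩,
      Continuous.subtype_mk (hφ.comp (continuous_id.prodMk (u.continuous.comp hθ))) _⟩
  have hT : ContractingWith (1 / 4) T := by
    refine ⟨by rw [← NNReal.coe_lt_coe]; norm_num, LipschitzWith.of_dist_le_mul fun u v => ?_⟩
    rw [ContinuousMap.dist_le (by positivity)]
    intro y
    have h1 := hlip y _ _ (hmem (u (θ y))) (hmem (v (θ y)))
    have h2 : dist (u (θ y)) (v (θ y)) ≤ dist u v := ContinuousMap.dist_apply_le_dist _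
    rw [Subtype.dist_eq, Real.dist_eq] at h2 ⊢
    refine h1.trans ?_
    push_cast
    gcongr
  have : Nonempty C(Y, Set.Icc (-1 : ℝ) 1) := ⟨⟨fun _ => ⟨0, by norm_num⟩, continuous_const⟩⟩
  set u := hT.fixedPoint T with hu
  have hfix : ∀ y, (u y : ℝ) = φ y (u (θ y)) := by
    intro y
    have : T u = u := hT.fixedPoint_isFixedPt
    exact congrArg (fun v : C(Y, Set.Icc (-1 : ℝ) 1) => (v y : ℝ)) this.symm
  exact ⟨fun y => u y, continuous_subtype_val.comp u.continuous,
    fun y => (congrArg abs (hfix y)).trans_le (hmaps _ _ (hmem _)), hfix⟩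

namespace IsExpanding

/-- The bounds for the fractional linear map `m ↦ (c + d m) / (a + b m)`. -/
theorem fractional_bounds {a b c d : ℝ} (hdet : |a * d - b * c| = 1) (h2 : 2 ≤ a - |b|)
    (h3 : |c| + |d| ≤ 3 / 4 * (a - |b|)) :
    (∀ m, |m| ≤ 1 → 2 ≤ a + b * m) ∧ (∀ m, |m| ≤ 1 → |(c + d * m) / (a + b * m)| ≤ 3 / 4) ∧
      ∀ m m', |m| ≤ 1 → |m'| ≤ 1 →
        |(c + d * m) / (a + b * m) - (c + d * m') / (a + b * m')| ≤ 1 / 4 * |m - m'| := by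
  have hb : ∀ x m : ℝ, |m| ≤ 1 → |x * m| ≤ |x| := by
    intro x m hm
    rw [abs_mul]; exact mul_le_of_le_one_right (abs_nonneg x) hm
  have hlow : ∀ m, |m| ≤ 1 → a - |b| ≤ a + b * m := by
    intro m hm
    have := neg_abs_le (b * m)
    have := hb b m hm
    linarith
  refine ⟨fun m hm => h2.trans (hlow m hm), fun m hm => ?_, fun m m' hm hm' => ?_⟩
  · have h4 := hlow m hm
    rw [abs_div, abs_of_pos (by linarith : 0 < a + b * m), div_le_iff₀ (by linarith)]
    have := abs_add_le c (d * m)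
    have := hb d m hm
    linarith
  · have h4 : 2 ≤ a + b * m := h2.trans (hlow m hm)
    have h5 : 2 ≤ a + b * m' := h2.trans (hlow m' hm')
    have h6 : (c + d * m) / (a + b * m) - (c + d * m') / (a + b * m') =
        (a * d - b * c) * (m - m') / ((a + b * m) * (a + b * m')) := by
      rw [div_sub_div _ _ (by linarith) (by linarith)]
      congr 1
      ring
    have h8 : 0 < (a + b * m) * (a + b * m') := mul_pos (by linarith) (by linarith)
    rw [h6, abs_div, abs_mul, hdet, one_mul, abs_of_pos h8, div_le_iff₀ h8]
    have h7 : 4 ≤ (a + b * m) * (a + b * m') := by nlinarith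
    have := abs_nonneg (m - m')
    nlinarith

variable {M : SL(2, ℝ)} (h : IsExpanding M)
include h

theorem forward_bounds :
    (∀ m, |m| ≤ 1 → 2 ≤ M 0 0 + M 0 1 * m) ∧
    (∀ m, |m| ≤ 1 → |(M 1 0 + M 1 1 * m) / (M 0 0 + M 0 1 * m)| ≤ 3 / 4) ∧
      ∀ m m', |m| ≤ 1 → |m'| ≤ 1 →
        |(M 1 0 + M 1 1 * m) / (M 0 0 + M 0 1 * m) - (M 1 0 + M 1 1 * m') / (M 0 0 + M 0 1 * m')| ≤
          1 / 4 * |m - m'| :=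
  fractional_bounds (by rw [SL2.det_eq, abs_one]) h.two_le h.slope_le

theorem backward_bounds :
    (∀ m, |m| ≤ 1 → 2 ≤ M 0 0 + -M 1 0 * m) ∧
    (∀ m, |m| ≤ 1 → |(-M 0 1 + M 1 1 * m) / (M 0 0 + -M 1 0 * m)| ≤ 3 / 4) ∧
      ∀ m m', |m| ≤ 1 → |m'| ≤ 1 →
        |(-M 0 1 + M 1 1 * m) / (M 0 0 + -M 1 0 * m) -
          (-M 0 1 + M 1 1 * m') / (M 0 0 + -M 1 0 * m')| ≤ 1 / 4 * |m - m'| :=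
  fractional_bounds (by rw [neg_mul_neg, mul_comm (M 1 0), SL2.det_eq, abs_one])
    (by rw [abs_neg]; exact h.two_le') (by rw [abs_neg, abs_neg]; exact h.slope_le')

end IsExpanding

/-- If the matrix `N` maps the directions of `(1, m')` and `(w', 1)` to those of `(1, m)` and
`(w, 1)`, it is diagonal with respect to the corresponding frames of determinant one. -/
theorem frame_mul {N : SL(2, ℝ)} {m m' w w' : ℝ}
    (e1 : m * (N 0 0 + N 0 1 * m') = N 1 0 + N 1 1 * m')
    (e2 : w' * (N 0 0 - N 1 0 * w) = -N 0 1 + N 1 1 * w) (hE : 0 < N 0 0 + N 0 1 * m')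
    (hw : 1 - m * w ≠ 0) (hw' : 1 - m' * w' ≠ 0) (h h') :
    N * mkSL 1 (w' / (1 - m' * w')) m' (1 / (1 - m' * w')) h =
      mkSL 1 (w / (1 - m * w)) m (1 / (1 - m * w)) h' *
        SL2.diag (2 * Real.log (N 0 0 + N 0 1 * m')) := by
  have hdet := SL2.det_eq N
  set a := N 0 0
  set b := N 0 1
  set c := N 1 0
  set d := N 1 1
  have e6 : Real.exp (2 * Real.log (a + b * m') / 2) = a + b * m' := by
    rw [mul_div_cancel_left₀ _ two_ne_zero, Real.exp_log hE]
  have e7 : Real.exp (-(2 * Real.log (a + b * m') / 2)) = (a + b * m')⁻¹ := by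
    rw [Real.exp_neg, e6]
  have e8 : (1 - m * w) * (a + b * m') = (1 - m' * w') * (a - c * w) := by
    linear_combination w * e1 * (-1) + m' * e2
  have e9 : (1 - m * w) * (a + b * m') ≠ 0 := mul_ne_zero hw hE.ne'
  have e10 : (a * w' + b) * ((1 - m * w) * (a + b * m')) = w * (1 - m' * w') := by
    rw [e8]
    linear_combination (1 - m' * w') * (a * e2 + w * hdet)
  have e11 : (c * w' + d) * ((1 - m * w) * (a + b * m')) = 1 - m' * w' := by
    rw [e8]
    linear_combination (1 - m' * w') * (c * e2 + hdet)
  apply SL2.ext' <;> simp only [SL2.mul_apply', SL2.diag, mkSL_zero_zero, mkSL_zero_one,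
    mkSL_one_zero, mkSL_one_one] <;> simp only [e6, e7]
  · ring
  · have : a * (w' / (1 - m' * w')) + b * (1 / (1 - m' * w')) =
        (a * w' + b) / (1 - m' * w') := by ring
    rw [mul_zero, zero_add, ← div_eq_mul_inv, div_div, this, div_eq_div_iff hw' e9, e10]
  · linarith
  · have : c * (w' / (1 - m' * w')) + d * (1 / (1 - m' * w')) =
        (c * w' + d) / (1 - m' * w') := by ring
    rw [mul_zero, zero_add, ← div_eq_mul_inv, div_div, this, div_eq_div_iff hw' e9, e11, one_mul]

/-- A product of expanding matrices along a bi-infinite sequence is diagonalized by frames `G x`. The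
first vector `(1, m x)` of the frame depends on the forward part of the sequence, and the direction
of the second vector on the backward part. -/
theorem exists_frames {M : Bool → SL(2, ℝ)} (hM : ∀ b, IsExpanding (M b)) :
    ∃ (m τ : (ℤ → Bool) → ℝ) (G : (ℤ → Bool) → SL(2, ℝ)), Continuous m ∧ Continuous τ ∧
      Continuous G ∧ (∀ x, |m x| ≤ 3 / 4) ∧ (∀ x, Real.log 2 ≤ τ x) ∧
      (∀ x, m x * (M (x 0) 0 0 + M (x 0) 0 1 * m (shift x)) =
        M (x 0) 1 0 + M (x 0) 1 1 * m (shift x)) ∧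
      (∀ x, G x 0 0 = 1 ∧ G x 1 0 = m x) ∧
      ∀ x, M (x 0) * G (shift x) = G x * SL2.diag (τ x) := by
  obtain ⟨m, hmc, hm, hmeq⟩ := exists_invariant_section shift.continuous
    (fun x m => (M (x 0) 1 0 + M (x 0) 1 1 * m) / (M (x 0) 0 0 + M (x 0) 0 1 * m))
    (by
      have : Continuous fun p : Bool × Set.Icc (-1 : ℝ) 1 =>
          (M p.1 1 0 + M p.1 1 1 * p.2) / (M p.1 0 0 + M p.1 0 1 * (p.2 : ℝ)) := by
        rw [continuous_prod_of_discrete_left]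
        intro b
        refine Continuous.div (by fun_prop) (by fun_prop) fun m => ?_
        have := (hM b).forward_bounds.1 m (abs_le.mpr m.2)
        dsimp only
        linarith
      exact this.comp (g := fun p : Bool × Set.Icc (-1 : ℝ) 1 => _)
        (f := fun p : (ℤ → Bool) × Set.Icc (-1 : ℝ) 1 => (p.1 0, p.2)) (by fun_prop))
    (fun x => (hM (x 0)).forward_bounds.2.1) (fun x => (hM (x 0)).forward_bounds.2.2)
  obtain ⟨w, hwc, hw, hweq⟩ := exists_invariant_section shift.symm.continuous
    (fun x m => (-M (x (-1)) 0 1 + M (x (-1)) 1 1 * m) / (M (x (-1)) 0 0 + -M (x (-1)) 1 0 * m))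
    (by
      have : Continuous fun p : Bool × Set.Icc (-1 : ℝ) 1 =>
          (-M p.1 0 1 + M p.1 1 1 * p.2) / (M p.1 0 0 + -M p.1 1 0 * (p.2 : ℝ)) := by
        rw [continuous_prod_of_discrete_left]
        intro b
        refine Continuous.div (by fun_prop) (by fun_prop) fun m => ?_
        have := (hM b).backward_bounds.1 m (abs_le.mpr m.2)
        dsimp only
        linarith
      exact this.comp (g := fun p : Bool × Set.Icc (-1 : ℝ) 1 => _)
        (f := fun p : (ℤ → Bool) × Set.Icc (-1 : ℝ) 1 => (p.1 (-1), p.2)) (by fun_prop))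
    (fun x => (hM (x (-1))).backward_bounds.2.1) (fun x => (hM (x (-1))).backward_bounds.2.2)
  have hm1 : ∀ x, |m x| ≤ 1 := fun x => (hm x).trans (by norm_num)
  have hw1 : ∀ x, |w x| ≤ 1 := fun x => (hw x).trans (by norm_num)
  have hmw : ∀ x, 0 < 1 - m x * w x := by
    intro x
    have h1 : |m x * w x| ≤ 3 / 4 * (3 / 4) := by
      rw [abs_mul]; exact mul_le_mul (hm x) (hw x) (abs_nonneg _) (by norm_num)
    have := le_abs_self (m x * w x)
    linarith
  have hmeq' : ∀ x, m x * (M (x 0) 0 0 + M (x 0) 0 1 * m (shift x)) =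
      M (x 0) 1 0 + M (x 0) 1 1 * m (shift x) := by
    intro x
    have := (hM (x 0)).forward_bounds.1 _ (hm1 (shift x))
    rw [hmeq x, div_mul_cancel₀ _ (by linarith)]
  have hweq' : ∀ x, w (shift x) * (M (x 0) 0 0 - M (x 0) 1 0 * w x) =
      -M (x 0) 0 1 + M (x 0) 1 1 * w x := by
    intro x
    have h1 := (hM (x 0)).backward_bounds.1 _ (hw1 x)
    have h2 := hweq (shift x)
    rw [Homeomorph.symm_apply_apply, shift_apply, neg_add_cancel] at h2
    rw [h2, sub_eq_add_neg, ← neg_mul, div_mul_cancel₀ _ (by linarith)]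
  have hpos : ∀ x, 2 ≤ M (x 0) 0 0 + M (x 0) 0 1 * m (shift x) := fun x =>
    (hM (x 0)).forward_bounds.1 _ (hm1 (shift x))
  have hMc : ∀ i j, Continuous fun x : ℤ → Bool => M (x 0) i j := fun i j =>
    (continuous_of_discreteTopology (f := fun b => M b i j)).comp (continuous_apply 0)
  let G : (ℤ → Bool) → SL(2, ℝ) := fun x =>
    mkSL 1 (w x / (1 - m x * w x)) (m x) (1 / (1 - m x * w x)) (by
      have := (hmw x).ne'
      field_simp)
  refine ⟨m, fun x => 2 * Real.log (M (x 0) 0 0 + M (x 0) 0 1 * m (shift x)), G, hmc, ?_, ?_, hm,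
    fun x => ?_, hmeq', fun x => ⟨rfl, rfl⟩, fun x => ?_⟩
  · refine continuous_const.mul (Continuous.log ?_ fun x => by linarith [hpos x])
    exact (hMc 0 0).add ((hMc 0 1).mul (hmc.comp shift.continuous))
  · refine continuous_induced_rng.mpr (continuous_pi fun i => continuous_pi fun j => ?_)
    have h1 : Continuous fun x => w x / (1 - m x * w x) :=
      hwc.div (by fun_prop) fun x => (hmw x).ne'
    have h2 : Continuous fun x => 1 / (1 - m x * w x) :=
      continuous_const.div (by fun_prop) fun x => (hmw x).ne'
    fin_cases i <;> fin_cases j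
    exacts [continuous_const, h1, hmc, h2]
  · have h1 : Real.log 2 ≤ Real.log (M (x 0) 0 0 + M (x 0) 0 1 * m (shift x)) :=
      Real.log_le_log (by norm_num) (hpos x)
    have h2 : 0 < Real.log 2 := Real.log_pos (by norm_num)
    linarith
  · exact frame_mul (hmeq' x) (hweq' x) (by linarith [hpos x]) (hmw x).ne' (hmw (shift x)).ne' _ _

/-- The slope of the first vector of the frame determines the forward part of the sequence. -/
theorem forward_eq_of_slope_eq {M : Bool → SL(2, ℝ)} (hM : ∀ b, IsExpanding (M b))
    (hdis : ∀ m m' : ℝ, |m| ≤ 1 → |m'| ≤ 1 →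
      (M false 1 0 + M false 1 1 * m) * (M true 0 0 + M true 0 1 * m') ≠
        (M true 1 0 + M true 1 1 * m') * (M false 0 0 + M false 0 1 * m))
    {m : (ℤ → Bool) → ℝ} (hm : ∀ x, |m x| ≤ 3 / 4)
    (hmeq : ∀ x, m x * (M (x 0) 0 0 + M (x 0) 0 1 * m (shift x)) =
        M (x 0) 1 0 + M (x 0) 1 1 * m (shift x)) {x y : ℤ → Bool} (hxy : m x = m y) (n : ℕ) :
    x n = y n := by
  have hm1 : ∀ x, |m x| ≤ 1 := fun x => (hm x).trans (by norm_num)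
  have key : ∀ x y, m x = m y → x 0 = y 0 ∧ m (shift x) = m (shift y) := by
    intro x y hxy
    have e1 := hmeq x
    have e2 := hmeq y
    have h0 : x 0 = y 0 := by
      by_contra hne
      rcases hx : x 0 with _ | _ <;> rcases hy : y 0 with _ | _ <;> rw [hx] at e1 <;> rw [hy] at e2
      · exact hne (hx.trans hy.symm)
      · exact hdis _ _ (hm1 (shift x)) (hm1 (shift y)) (by rw [← e1, ← e2, hxy]; ring)
      · exact hdis _ _ (hm1 (shift y)) (hm1 (shift x)) (by rw [← e1, ← e2, hxy]; ring)
      · exact hne (hx.trans hy.symm)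
    refine ⟨h0, ?_⟩
    rw [← h0, ← hxy] at e2
    have hdet := SL2.det_eq (M (x 0))
    have hx := (hM (x 0)).forward_bounds.1 _ (hm1 (shift x))
    have hy := (hM (x 0)).forward_bounds.1 _ (hm1 (shift y))
    have h3 : (m (shift x) - m (shift y)) * (M (x 0) 0 0 * M (x 0) 1 1 - M (x 0) 0 1 * M (x 0) 1 0) =
        0 := by
      linear_combination (M (x 0) 0 0 + M (x 0) 0 1 * m (shift x)) * e2 -
        (M (x 0) 0 0 + M (x 0) 0 1 * m (shift y)) * e1
    rw [hdet, mul_one] at h3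
    linarith
  have h : ∀ n : ℕ, m (shift^[n] x) = m (shift^[n] y) := by
    intro n
    induction n with
    | zero => exact hxy
    | succ n ih =>
      rw [Function.iterate_succ_apply', Function.iterate_succ_apply']
      exact (key _ _ ih).2
  have := (key _ _ (h n)).1
  rwa [shift_iterate_apply, shift_iterate_apply, zero_add] at this

end

/-! ### Birkhoff's theorem and coin tossing -/

noncomputable section

section Birkhoff

variable {α : Type*} {T : α → α} {f : α → ℝ}

/-- The maximum of the Birkhoff sums of order at most `n`, including the empty sum. -/
def maxBirkhoffSum (T : α → α) (f : α → ℝ) : ℕ → α → ℝ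
  | 0, _ => 0
  | n + 1, x => max 0 (f x + maxBirkhoffSum T f n (T x))

theorem maxBirkhoffSum_nonneg (n : ℕ) (x : α) : 0 ≤ maxBirkhoffSum T f n x := by
  cases n
  · exact le_rfl
  · exact le_max_left _ _

theorem maxBirkhoffSum_le_succ (n : ℕ) (x : α) :
    maxBirkhoffSum T f n x ≤ maxBirkhoffSum T f (n + 1) x := by
  induction n generalizing x with
  | zero => exact maxBirkhoffSum_nonneg 1 x
  | succ n ih => exact max_le_max le_rfl (by linarith [ih (T x)])

theorem birkhoffSum_le_maxBirkhoffSum (n : ℕ) (x : α) :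
    birkhoffSum T f n x ≤ maxBirkhoffSum T f n x := by
  induction n generalizing x with
  | zero => rw [birkhoffSum_zero]; exact le_rfl
  | succ n ih =>
    rw [birkhoffSum_succ']
    exact (add_le_add le_rfl (ih (T x))).trans (le_max_right _ _)

theorem birkhoffSum_sub_const (f : α → ℝ) (c : ℝ) (n : ℕ) (x : α) :
    birkhoffSum T (fun x => f x - c) n x = birkhoffSum T f n x - n * c := by
  simp [birkhoffSum, Finset.sum_sub_distrib]

variable [MeasurableSpace α] {μ : Measure α}

theorem measurable_maxBirkhoffSum (hT : Measurable T) (hf : Measurable f) (n : ℕ) :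
    Measurable (maxBirkhoffSum T f n) := by
  induction n with
  | zero => exact measurable_const
  | succ n ih => exact measurable_const.max (hf.add (ih.comp hT))

theorem measurable_birkhoffSum' (hT : Measurable T) (hf : Measurable f) (n : ℕ) :
    Measurable (birkhoffSum T f n) :=
  Finset.measurable_sum _ fun k _ => hf.comp (hT.iterate k)

theorem integrable_maxBirkhoffSum (hT : MeasurePreserving T μ μ) (hf : Integrable f μ) (n : ℕ) :
    Integrable (maxBirkhoffSum T f n) μ := by
  induction n with
  | zero => exact integrable_zero _ _ _
  | succ n ih => exact (integrable_zero _ _ _).sup (hf.add (hT.integrable_comp_of_integrable ih))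

/-- The maximal ergodic inequality. -/
theorem setIntegral_maxBirkhoffSum_pos_nonneg (hT : MeasurePreserving T μ μ) (hfm : Measurable f)
    (hf : Integrable f μ) (n : ℕ) : 0 ≤ ∫ x in {x | 0 < maxBirkhoffSum T f (n + 1) x}, f x ∂μ := by
  have hms : MeasurableSet {x | 0 < maxBirkhoffSum T f (n + 1) x} :=
    measurableSet_lt measurable_const (measurable_maxBirkhoffSum hT.measurable hfm _)
  have hint := integrable_maxBirkhoffSum hT hf n
  have hintT : Integrable (fun x => maxBirkhoffSum T f n (T x)) μ :=
    hT.integrable_comp_of_integrable hint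
  have h0 : ∫ x, (maxBirkhoffSum T f n x - maxBirkhoffSum T f n (T x)) ∂μ = 0 := by
    rw [integral_sub hint hintT, sub_eq_zero]
    have := integral_map (μ := μ) hT.measurable.aemeasurable (f := maxBirkhoffSum T f n)
      (by rw [hT.map_eq]; exact hint.aestronglyMeasurable)
    rwa [hT.map_eq] at this
  rw [← integral_indicator hms]
  refine h0.symm.le.trans ?_
  refine integral_mono (hint.sub hintT) (hf.indicator hms) fun x => ?_
  by_cases hx : 0 < maxBirkhoffSum T f (n + 1) x
  · rw [Set.indicator_of_mem (show x ∈ {x | 0 < maxBirkhoffSum T f (n + 1) x} from hx)]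
    have h1 := maxBirkhoffSum_le_succ (T := T) (f := f) n x
    have h2 : maxBirkhoffSum T f (n + 1) x = f x + maxBirkhoffSum T f n (T x) := by
      have h3 : maxBirkhoffSum T f (n + 1) x = max 0 (f x + maxBirkhoffSum T f n (T x)) := rfl
      rw [h3] at hx ⊢
      exact max_eq_right (by
        by_contra! h4
        rw [max_eq_left h4.le] at hx
        exact lt_irrefl _ hx)
    dsimp only
    linarith
  · rw [Set.indicator_of_notMem (show x ∉ {x | 0 < maxBirkhoffSum T f (n + 1) x} from hx)]
    have h1 := maxBirkhoffSum_le_succ (T := T) (f := f) n x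
    have h2 := maxBirkhoffSum_nonneg (T := T) (f := f) n (T x)
    dsimp only
    linarith

/-- If `f` has negative mean then its Birkhoff sums are almost surely bounded above. -/
theorem Ergodic.ae_bddAbove_birkhoffSum [IsProbabilityMeasure μ] (hT : Ergodic T μ)
    (hfm : Measurable f) (hf : Integrable f μ) (hneg : ∫ x, f x ∂μ < 0) :
    ∀ᵐ x ∂μ, BddAbove (Set.range fun n => birkhoffSum T f n x) := by
  set B : Set α := {x | BddAbove (Set.range fun n => birkhoffSum T f n x)} with hB
  have hBm : MeasurableSet B := by
    have : B = ⋃ k : ℕ, ⋂ n : ℕ, {x | birkhoffSum T f n x ≤ k} := by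
      ext x
      simp only [hB, Set.mem_ofPred_eq, Set.mem_iUnion, Set.mem_iInter]
      constructor
      · rintro ⟨K, hK⟩
        obtain ⟨k, hk⟩ := exists_nat_ge K
        exact ⟨k, fun n => (hK ⟨n, rfl⟩).trans hk⟩
      · rintro ⟨k, hk⟩
        exact ⟨k, by rintro _ ⟨n, rfl⟩; exact hk n⟩
    rw [this]
    exact MeasurableSet.iUnion fun k => MeasurableSet.iInter fun n =>
      measurableSet_le (measurable_birkhoffSum' hT.measurable hfm n) measurable_const
  have hBinv : T ⁻¹' B = B := by
    ext x
    simp only [hB, Set.mem_preimage, Set.mem_ofPred_eq]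
    constructor
    · rintro ⟨K, hK⟩
      refine ⟨max 0 (f x + K), ?_⟩
      rintro _ ⟨n, rfl⟩
      cases n with
      | zero => dsimp only; rw [birkhoffSum_zero]; exact le_max_left _ _
      | succ n =>
        dsimp only
        rw [birkhoffSum_succ']
        exact (add_le_add le_rfl (hK ⟨n, rfl⟩)).trans (le_max_right _ _)
    · rintro ⟨K, hK⟩
      refine ⟨K - f x, ?_⟩
      rintro _ ⟨n, rfl⟩
      have := hK ⟨n + 1, rfl⟩
      dsimp only at this ⊢
      rw [birkhoffSum_succ'] at this
      linarith
  refine (hT.toPreErgodic.ae_mem_or_ae_notMem hBm hBinv).resolve_right fun hnot => ?_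
  -- otherwise the maximal inequality gives a nonnegative mean in the limit
  refine hneg.not_ge ?_
  have hlim : Tendsto (fun n => ∫ x, {x | 0 < maxBirkhoffSum T f (n + 1) x}.indicator f x ∂μ) atTop
      (𝓝 (∫ x, f x ∂μ)) := by
    refine tendsto_integral_of_dominated_convergence (fun x => |f x|) (fun n => ?_) hf.abs
      (fun n => ?_) ?_
    · exact (hf.indicator (measurableSet_lt measurable_const
        (measurable_maxBirkhoffSum hT.measurable hfm _))).aestronglyMeasurable
    · exact Eventually.of_forall fun x => norm_indicator_le_norm_self _ _
    · filter_upwards [hnot] with x hx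
      have hx' : ∃ n, 0 < birkhoffSum T f n x := by
        by_contra! hall
        exact hx ⟨0, by rintro _ ⟨n, rfl⟩; exact hall n⟩
      obtain ⟨N, hN⟩ := hx'
      refine tendsto_const_nhds.congr' ?_
      filter_upwards [eventually_ge_atTop N] with n hn
      rw [Set.indicator_of_mem]
      have hmono : Monotone fun n => maxBirkhoffSum T f n x :=
        monotone_nat_of_le_succ fun n => maxBirkhoffSum_le_succ n x
      exact hN.trans_le ((birkhoffSum_le_maxBirkhoffSum N x).trans (hmono (by omega)))
  refine ge_of_tendsto' hlim fun n => ?_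
  rw [integral_indicator (measurableSet_lt measurable_const
        (measurable_maxBirkhoffSum hT.measurable hfm _))]
  exact setIntegral_maxBirkhoffSum_pos_nonneg hT.toMeasurePreserving hfm hf n

theorem Ergodic.ae_eventually_birkhoffSum_div_le [IsProbabilityMeasure μ] (hT : Ergodic T μ)
    (hfm : Measurable f) (hf : Integrable f μ) :
    ∀ᵐ x ∂μ, ∀ ε > 0, ∀ᶠ n : ℕ in atTop, birkhoffSum T f n x / n < ∫ x, f x ∂μ + ε := by
  have h1 : ∀ᵐ x ∂μ, ∀ k : ℕ, BddAbove (Set.range fun n =>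
      birkhoffSum T (fun x => f x - (∫ x, f x ∂μ + 1 / (k + 1 : ℝ))) n x) := by
    rw [ae_all_iff]
    intro k
    refine hT.ae_bddAbove_birkhoffSum (hfm.sub_const _) (hf.sub (integrable_const _)) ?_
    rw [integral_sub hf (integrable_const _), integral_const, probReal_univ, one_smul]
    have : (0 : ℝ) < 1 / (k + 1 : ℝ) := by positivity
    linarith
  filter_upwards [h1] with x hx ε hε
  obtain ⟨k, hk⟩ := exists_nat_one_div_lt (half_pos hε)
  obtain ⟨K, hK⟩ := hx k
  obtain ⟨N, hN⟩ := exists_nat_gt (K / (ε / 2))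
  filter_upwards [eventually_ge_atTop N, eventually_gt_atTop 0] with n hn hn0
  have hn0' : (0 : ℝ) < n := by exact_mod_cast hn0
  have h2 := hK ⟨n, rfl⟩
  dsimp only at h2
  rw [birkhoffSum_sub_const] at h2
  rw [div_lt_iff₀ hn0']
  rw [div_lt_iff₀ (by positivity)] at hN
  have h3 : (N : ℝ) ≤ n := by exact_mod_cast hn
  have h4 : (n : ℝ) * (1 / (k + 1 : ℝ)) ≤ n * (ε / 2) := by gcongr
  nlinarith

/-- Birkhoff's pointwise ergodic theorem for ergodic transformations. -/
theorem Ergodic.ae_tendsto_birkhoffSum_div [IsProbabilityMeasure μ] (hT : Ergodic T μ)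
    (hfm : Measurable f) (hf : Integrable f μ) :
    ∀ᵐ x ∂μ, Tendsto (fun n : ℕ => birkhoffSum T f n x / n) atTop (𝓝 (∫ x, f x ∂μ)) := by
  filter_upwards [hT.ae_eventually_birkhoffSum_div_le hfm hf,
    hT.ae_eventually_birkhoffSum_div_le hfm.neg hf.neg] with x h1 h2
  refine tendsto_order.mpr ⟨fun a ha => ?_, fun a ha => ?_⟩
  · filter_upwards [h2 (∫ x, f x ∂μ - a) (by linarith)] with n hn
    rw [birkhoffSum_neg, neg_div] at hn
    simp only [Pi.neg_apply, integral_neg] at hn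
    linarith
  · filter_upwards [h1 (a - ∫ x, f x ∂μ) (by linarith)] with n hn
    linarith

end Birkhoff

section Bernoulli

open ProbabilityTheory

/-- The law of a fair coin. -/
def coin : Measure Bool := (PMF.uniformOfFintype Bool).toMeasure

instance : IsProbabilityMeasure coin := by unfold coin; infer_instance

theorem coin_singleton (b : Bool) : coin {b} = 2⁻¹ := by
  simp [coin]

/-- The Bernoulli measure: the law of a bi-infinite sequence of independent fair coin tosses. -/
def coinTosses : Measure (ℤ → Bool) := Measure.infinitePi fun _ => coin

instance : IsProbabilityMeasure coinTosses := by unfold coinTosses; infer_instance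

theorem measurePreserving_shift : MeasurePreserving shift coinTosses coinTosses :=
  ⟨shift.continuous.measurable,
    Measure.map_infinitePi_infinitePi_of_inj (P := fun _ : ℤ => coin) (add_left_injective (1 : ℤ))⟩

/-- Cylinders are independent of their images by large powers of the shift. -/
theorem exists_bernoulli_inter_shift {A : Set (ℤ → Bool)}
    (hA : A ∈ measurableCylinders fun _ : ℤ => Bool) :
    ∃ n : ℕ, coinTosses (A ∩ shift^[n] ⁻¹' A) = coinTosses A * coinTosses A := by
  obtain ⟨I, S, hS, rfl⟩ := (mem_measurableCylinders A).mp hA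
  obtain ⟨n, hn⟩ : ∃ n : ℕ, ∀ i ∈ I, ∀ j ∈ I, i ≠ j + n := by
    refine ⟨(∑ i ∈ I, |i|).toNat * 2 + 1, fun i hi j hj h => ?_⟩
    have h1 := Finset.single_le_sum (f := fun i : ℤ => |i|) (fun i _ => abs_nonneg i) hi
    have h2 := Finset.single_le_sum (f := fun i : ℤ => |i|) (fun i _ => abs_nonneg i) hj
    have h3 := Int.self_le_toNat (∑ i ∈ I, |i|)
    have h4 := le_abs_self i
    have h5 := neg_abs_le j
    push_cast at h
    omega
  refine ⟨n, ?_⟩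
  set J : Finset ℤ := I.map (addRightEmbedding (n : ℤ)) with hJ
  have hdisj : Disjoint I J := by
    rw [Finset.disjoint_left]
    intro i hi hiJ
    obtain ⟨j, hj, hji⟩ := Finset.mem_map.mp hiJ
    exact hn i hi j hj hji.symm
  have hind : iIndepFun (fun (i : ℤ) (x : ℤ → Bool) => x i) coinTosses :=
    iIndepFun_infinitePi (P := fun _ : ℤ => coin) (X := fun _ x => x) (fun _ => measurable_id)
  have h1 := hind.indepFun_finset I J hdisj (fun i => measurable_pi_apply i)
  have h2 := h1.comp (φ := id) (ψ := fun y (i : I) => y ⟨i + n, Finset.mem_map.mpr ⟨i, i.2, rfl⟩⟩)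
    measurable_id (measurable_pi_lambda _ fun i => measurable_pi_apply _)
  have h3 := h2.measure_inter_preimage_eq_mul S S hS hS
  have h4 : shift^[n] ⁻¹' cylinder I S = ((fun y (i : I) => y ⟨i + n, Finset.mem_map.mpr
      ⟨i, i.2, rfl⟩⟩) ∘ fun (a : ℤ → Bool) (i : J) => a i) ⁻¹' S := by
    ext x
    simp only [Set.mem_preimage, mem_cylinder, Function.comp_apply]
    refine iff_of_eq (congrArg (· ∈ S) (funext fun i => ?_))
    exact shift_iterate_apply x n i
  have h5 : coinTosses (shift^[n] ⁻¹' cylinder I S) = coinTosses (cylinder I S) :=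
    (measurePreserving_shift.iterate n).measure_preimage
      (MeasurableSet.cylinder I hS).nullMeasurableSet
  rw [← h4, h5] at h3
  exact h3

theorem ergodic_shift : Ergodic shift coinTosses := by
  refine ⟨measurePreserving_shift, ⟨fun A hA hinv => ?_⟩⟩
  have hdense : Measure.MeasureDense coinTosses (measurableCylinders fun _ : ℤ => Bool) :=
    Measure.MeasureDense.of_generateFrom_isSetAlgebra_finite _
      isSetAlgebra_measurableCylinders generateFrom_measurableCylinders.symm
  have hinv' : ∀ n : ℕ, shift^[n] ⁻¹' A = A := by
    intro n
    induction n with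
    | zero => rfl
    | succ n ih => rw [Function.iterate_succ', Set.preimage_comp, hinv, ih]
  have key : ∀ ε > 0, |coinTosses.real A - coinTosses.real A * coinTosses.real A| ≤ 4 * ε := by
    intro ε hε
    obtain ⟨B, hB, hAB⟩ := hdense.approx A hA (measure_ne_top _ _) ε hε
    obtain ⟨n, hn⟩ := exists_bernoulli_inter_shift hB
    have hBm := hdense.measurable B hB
    have hn' : coinTosses.real (B ∩ shift^[n] ⁻¹' B) = coinTosses.real B * coinTosses.real B := by
      rw [Measure.real, hn, ENNReal.toReal_mul]; rfl
    have hAB' : coinTosses.real (symmDiff A B) ≤ ε :=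
      ENNReal.toReal_le_of_le_ofReal hε.le hAB.le
    have hsh : coinTosses.real (symmDiff A (shift^[n] ⁻¹' B)) ≤ ε := by
      have : symmDiff A (shift^[n] ⁻¹' B) = shift^[n] ⁻¹' (symmDiff A B) := by
        conv_lhs => rw [← hinv' n]
        rfl
      rw [this, Measure.real, (measurePreserving_shift.iterate n).measure_preimage
        (hA.symmDiff hBm).nullMeasurableSet]
      exact hAB'
    have h1 : |coinTosses.real A - coinTosses.real B| ≤ ε :=
      (abs_measureReal_sub_le_measureReal_symmDiff hA.nullMeasurableSet hBm.nullMeasurableSet).trans hAB'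
    have h2 : |coinTosses.real A - coinTosses.real (B ∩ shift^[n] ⁻¹' B)| ≤ 2 * ε := by
      refine (abs_measureReal_sub_le_measureReal_symmDiff hA.nullMeasurableSet
        (hBm.inter ((measurePreserving_shift.iterate n).measurable hBm)).nullMeasurableSet).trans ?_
      refine (measureReal_mono (s₂ := symmDiff A B ∪ symmDiff A (shift^[n] ⁻¹' B)) ?_).trans
        ((measureReal_union_le _ _).trans (by linarith))
      intro x hx
      simp only [Set.mem_symmDiff, Set.mem_inter_iff, Set.mem_union] at hx ⊢
      tauto
    rw [hn'] at h2
    have h3 : coinTosses.real A ≤ 1 := measureReal_le_one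
    have h4 : coinTosses.real B ≤ 1 := measureReal_le_one
    have h5 : 0 ≤ coinTosses.real A := measureReal_nonneg
    have h6 : 0 ≤ coinTosses.real B := measureReal_nonneg
    rw [abs_le] at h1 h2 ⊢
    constructor <;> nlinarith
  have h0 : coinTosses.real A - coinTosses.real A * coinTosses.real A = 0 := by
    by_contra hne
    have hpos := abs_pos.mpr hne
    have := key _ (show 0 < |coinTosses.real A - coinTosses.real A * coinTosses.real A| / 8 by positivity)
    linarith
  have h1 : coinTosses.real A * (1 - coinTosses.real A) = 0 := by linarith
  rw [Filter.eventuallyConst_set']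
  rcases mul_eq_zero.mp h1 with h | h
  · left
    rw [ae_eq_empty]
    exact (measureReal_eq_zero_iff).mp h
  · right
    rw [ae_eq_univ, prob_compl_eq_zero_iff hA]
    have : coinTosses.real A = 1 := by linarith
    rwa [Measure.real, ENNReal.toReal_eq_one_iff] at this

/-- Almost no sequence has a prescribed forward part. -/
theorem coinTosses_forward_eq_zero (y : ℤ → Bool) :
    coinTosses {x | ∀ n : ℕ, x n = y n} = 0 := by
  refine le_antisymm (ge_of_tendsto' (ENNReal.tendsto_pow_atTop_nhds_zero_of_lt_one
    (r := 2⁻¹) (by simp)) fun n => ?_) zero_le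
  set s : Finset ℤ := (Finset.range n).map Nat.castEmbedding with hs
  have h1 : {x : ℤ → Bool | ∀ n : ℕ, x n = y n} ⊆ Set.pi (s : Set ℤ) fun i => {y i} := by
    intro x hx i hi
    obtain ⟨k, -, rfl⟩ := Finset.mem_map.mp (Finset.mem_coe.mp hi)
    exact hx k
  refine (measure_mono h1).trans ?_
  rw [coinTosses, Measure.infinitePi_pi _ (fun i _ => MeasurableSet.singleton _),
    Finset.prod_congr rfl fun i _ => coin_singleton (y i), Finset.prod_const, hs,
    Finset.card_map, Finset.card_range]

end Bernoulli

end

/-! ### Equivariant isotopies -/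

noncomputable section

/-- An isotopy of `ℍ`, starting at the identity, through maps that commute with the group `Γ`. -/
structure IsEquivariantIsotopy (Γ : Subgroup SL(2, ℝ)) (H : unitInterval → ℍ → ℍ) : Prop where
  continuous : Continuous fun p : unitInterval × ℍ => H p.1 p.2
  bijective : ∀ t, Function.Bijective (H t)
  comm : ∀ t, ∀ g ∈ Γ, ∀ z, H t (g • z) = g • H t z
  zero : ∀ z, H 0 z = z

/-- The map `F` is the end of an equivariant isotopy that starts at the identity. -/
def EquivariantlyIsotopicToId (Γ : Subgroup SL(2, ℝ)) (F : ℍ → ℍ) : Prop :=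
  ∃ H, IsEquivariantIsotopy Γ H ∧ H 1 = F

namespace EquivariantlyIsotopicToId

variable {Γ : Subgroup SL(2, ℝ)} {F G : ℍ → ℍ}

theorem comp (hF : EquivariantlyIsotopicToId Γ F) (hG : EquivariantlyIsotopicToId Γ G) :
    EquivariantlyIsotopicToId Γ (fun z => F (G z)) := by
  obtain ⟨H, hH, rfl⟩ := hF
  obtain ⟨K, hK, rfl⟩ := hG
  refine ⟨fun t z => H t (K t z), ⟨?_, fun t => (hH.bijective t).comp (hK.bijective t),
    fun t g hg z => by rw [hK.comm t g hg, hH.comm t g hg], fun z => by rw [hK.zero, hH.zero]⟩, rfl⟩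
  exact hH.continuous.comp (continuous_fst.prodMk hK.continuous)

theorem comm (hF : EquivariantlyIsotopicToId Γ F) {g : SL(2, ℝ)} (hg : g ∈ Γ) (z : ℍ) :
    F (g • z) = g • F z := by
  obtain ⟨H, hH, rfl⟩ := hF
  exact hH.comm 1 g hg z

end EquivariantlyIsotopicToId

namespace HyperbolicSurface

variable {S : Type*} [MetricSpace S] (X : HyperbolicSurface S)

/-- The end of an equivariant isotopy is the preferred lift of a homeomorphism of the surface that is
isotopic to the identity. -/
theorem exists_isPreferredLift [CompactSpace S] {F : ℍ → ℍ}
    (hF : EquivariantlyIsotopicToId X.matrixGroup F) :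
    ∃ (f : S ≃ₜ S) (F' : ℍ ≃ₜ ℍ), IsIsotopicToId f ∧ X.IsPreferredLift f F' ∧ ⇑F' = F := by
  obtain ⟨H, hH, rfl⟩ := hF
  have hsurj := X.isQuotientCoveringMap.surjective
  let h : unitInterval → S → S := fun t s => X.proj (H t (Function.surjInv hsurj s))
  have hproj : ∀ t z, h t (X.proj z) = X.proj (H t z) := by
    intro t z
    obtain ⟨g, hg, hgz⟩ := X.proj_eq_iff.mp (Function.surjInv_eq hsurj (X.proj z)).symm
    simp only [h]
    rw [← hgz, hH.comm t g hg, X.proj_smul hg]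
  have hcont : Continuous fun p : unitInterval × S => h p.1 p.2 := by
    have hq : IsOpenQuotientMap (Prod.map id X.proj : unitInterval × ℍ → unitInterval × S) :=
      IsOpenQuotientMap.id.prodMap X.isQuotientCoveringMap.isOpenQuotientMap
    rw [hq.isQuotientMap.continuous_iff]
    have : ((fun p : unitInterval × S => h p.1 p.2) ∘ Prod.map id X.proj) =
        fun p : unitInterval × ℍ => X.proj (H p.1 p.2) := funext fun p => hproj p.1 p.2
    rw [this]
    exact X.continuous_proj.comp hH.continuous
  have hbij : ∀ t, Function.Bijective (h t) := by
    intro t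
    constructor
    · intro a b hab
      obtain ⟨z, rfl⟩ := hsurj a
      obtain ⟨w, rfl⟩ := hsurj b
      rw [hproj, hproj] at hab
      obtain ⟨g, hg, hgz⟩ := X.proj_eq_iff.mp hab
      rw [← hH.comm t g hg] at hgz
      rw [← (hH.bijective t).1 hgz, X.proj_smul hg]
    · intro s
      obtain ⟨z, rfl⟩ := hsurj s
      obtain ⟨w, rfl⟩ := (hH.bijective t).2 z
      exact ⟨X.proj w, hproj t w⟩
  let f : unitInterval → S ≃ₜ S := fun t =>
    Continuous.homeoOfEquivCompactToT2 (f := Equiv.ofBijective (h t) (hbij t))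
      (hcont.comp (Continuous.prodMk_right t))
  have hf : ∀ t s, f t s = h t s := fun t s => rfl
  have hHc : Continuous (H 1) := hH.continuous.comp (Continuous.prodMk_right 1)
  -- `H 1` is a local homeomorphism, because its composition with the covering map is one
  have hloc : IsLocalHomeomorph (H 1) := by
    have h1 : X.proj ∘ H 1 = f 1 ∘ X.proj := funext fun z => (hproj 1 z).symm
    have h2 : IsLocalHomeomorph (X.proj ∘ H 1) := by
      rw [h1]
      exact (f 1).isLocalHomeomorph.comp X.isQuotientCoveringMap.isCoveringMap.isLocalHomeomorph
    exact h2.of_comp X.isQuotientCoveringMap.isCoveringMap.isLocalHomeomorph hHc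
  let F' : ℍ ≃ₜ ℍ := (Equiv.ofBijective (H 1) (hH.bijective 1)).toHomeomorphOfContinuousOpen hHc
    hloc.isOpenMap
  refine ⟨f 1, F', ⟨f, hcont, fun s => ?_, fun s => rfl⟩, ⟨fun z => (hproj 1 z).symm, ?_⟩, rfl⟩
  · obtain ⟨z, rfl⟩ := hsurj s
    rw [hf, hproj, hH.zero]
  · intro φ hφ z
    obtain ⟨g, rfl⟩ := X.deck_le hφ
    exact hH.comm 1 g hφ z

/-- An isotopy of `ℍ` supported in a small ball extends to an equivariant isotopy that is supported
in the translates of the ball. -/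
theorem exists_equivariant_extension {r : ℝ}
    (hr : ∀ g ∈ X.matrixGroup, ∀ z : ℍ, dist z (g • z) < r → ∀ w : ℍ, g • w = w)
    {z₀ : ℍ} {ρ : ℝ} (hρ : ρ < r / 2) {h : unitInterval → ℍ → ℍ}
    (hc : Continuous fun p : unitInterval × ℍ => h p.1 p.2) (hb : ∀ t, Function.Bijective (h t))
    (hsupp : ∀ t z, ρ < dist z z₀ → h t z = z) (h0 : ∀ z, h 0 z = z) :
    ∃ F, EquivariantlyIsotopicToId X.matrixGroup F ∧ (∀ z, dist z z₀ < r / 2 → F z = h 1 z) ∧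
      ∀ z, (∀ g ∈ X.matrixGroup, ρ < dist (g • z) z₀) → F z = z := by
  classical
  set Γ := X.matrixGroup with hΓ
  let H : unitInterval → ℍ → ℍ := fun t z =>
    if hz : ∃ g ∈ Γ, dist (g • z) z₀ < r / 2 then hz.choose⁻¹ • h t (hz.choose • z) else z
  -- two elements of the group that map some point into the ball act in the same way
  have hsame : ∀ g ∈ Γ, ∀ k ∈ Γ, ∀ z : ℍ, dist (g • z) z₀ < r / 2 → dist (k • z) z₀ < r / 2 →
      ∀ w : ℍ, g • w = k • w := by
    intro g hg k hk z hgz hkz w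
    have h1 := hr (g * k⁻¹) (mul_mem hg (inv_mem hk)) (k • z) (by
      rw [mul_smul, inv_smul_smul]
      have := dist_triangle_right (k • z) (g • z) z₀
      linarith) (k • w)
    rwa [mul_smul, inv_smul_smul] at h1
  have hH : ∀ t z, ∀ g ∈ Γ, dist (g • z) z₀ < r / 2 → H t z = g⁻¹ • h t (g • z) := by
    intro t z g hg hgz
    have hz : ∃ g ∈ Γ, dist (g • z) z₀ < r / 2 := ⟨g, hg, hgz⟩
    simp only [H, dif_pos hz]
    have h1 := hsame _ hz.choose_spec.1 g hg z hz.choose_spec.2 hgz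
    rw [h1 z, inv_smul_eq_iff, h1, smul_inv_smul]
  have hH' : ∀ t z, (∀ g ∈ Γ, ρ < dist (g • z) z₀) → H t z = z := by
    intro t z hz
    by_cases hz' : ∃ g ∈ Γ, dist (g • z) z₀ < r / 2
    · obtain ⟨g, hg, hgz⟩ := hz'
      rw [hH t z g hg hgz, hsupp t _ (hz g hg), inv_smul_smul]
    · simp only [H, dif_neg hz']
  -- the isotopy preserves the ball
  have hball : ∀ t z, dist z z₀ < r / 2 → dist (h t z) z₀ < r / 2 := by
    intro t z hz
    by_contra! hcon
    have h1 := (hb t).1 (hsupp t (h t z) (by linarith))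
    rw [h1] at hcon
    linarith
  have hball' : ∀ t z, dist (h t z) z₀ < r / 2 → dist z z₀ < r / 2 := by
    intro t z hz
    by_contra! hcon
    rw [hsupp t z (by linarith)] at hz
    linarith
  refine ⟨H 1, ⟨H, ⟨?_, fun t => ⟨?_, ?_⟩, ?_, ?_⟩, rfl⟩, fun z hz => ?_, fun z hz => hH' 1 z hz⟩
  · rw [continuous_iff_continuousAt]
    rintro ⟨t, z⟩
    by_cases hz : ∃ g ∈ Γ, dist (g • z) z₀ < r / 2
    · obtain ⟨g, hg, hgz⟩ := hz
      have h1 : ContinuousAt (fun p : unitInterval × ℍ => g⁻¹ • h p.1 (g • p.2)) (t, z) := by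
        refine Continuous.continuousAt ?_
        exact (hc.comp (continuous_fst.prodMk (continuous_snd.const_smul g))).const_smul g⁻¹
      refine h1.congr ?_
      have hopen : IsOpen {p : unitInterval × ℍ | dist (g • p.2) z₀ < r / 2} :=
        isOpen_lt ((continuous_snd.const_smul g).dist continuous_const) continuous_const
      filter_upwards [hopen.mem_nhds hgz] with p hp
      exact (hH p.1 p.2 g hg hp).symm
    · push Not at hz
      have hopen : IsOpen {p : unitInterval × ℍ | ∀ g ∈ Γ, ρ < dist (g • p.2) z₀} := by
        have h2 : {p : unitInterval × ℍ | ∀ g ∈ Γ, ρ < dist (g • p.2) z₀} =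
            (fun p => X.proj p.2) ⁻¹' (X.proj '' Metric.closedBall z₀ ρ)ᶜ := by
          ext p
          simp only [Set.mem_ofPred_eq, Set.mem_preimage, Set.mem_compl_iff, Set.mem_image,
            not_exists, not_and, Metric.mem_closedBall]
          constructor
          · intro hp w hw hwp
            obtain ⟨g, hg, rfl⟩ := X.proj_eq_iff.mp hwp.symm
            exact absurd (hp g hg) (not_lt.mpr hw)
          · intro hp g hg
            by_contra! hcon
            exact hp _ hcon (X.proj_smul hg _)
        rw [h2]
        refine IsOpen.preimage (X.continuous_proj.comp continuous_snd) ?_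
        exact ((isCompact_closedBall z₀ ρ).image X.continuous_proj).isClosed.isOpen_compl
      refine ContinuousAt.congr (f := fun p : unitInterval × ℍ => p.2) continuous_snd.continuousAt ?_
      filter_upwards [hopen.mem_nhds (show ∀ g ∈ Γ, ρ < dist (g • z) z₀ from
        fun g hg => hρ.trans_le (hz g hg))] with p hp
      exact (hH' p.1 p.2 hp).symm
  · -- the image of a point determines whether the point lies in a translate of the ball
    have key : ∀ z w, H t z = H t w → (∃ g ∈ Γ, dist (g • z) z₀ < r / 2) → z = w := by
      rintro z w hzw ⟨g, hg, hgz⟩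
      rw [hH t z g hg hgz] at hzw
      have h1 : dist (g • H t w) z₀ < r / 2 := by
        rw [← hzw, smul_inv_smul]; exact hball t _ hgz
      by_cases hw : ∃ k ∈ Γ, dist (k • w) z₀ < r / 2
      · obtain ⟨k, hk, hkw⟩ := hw
        have h2 : dist (k • H t w) z₀ < r / 2 := by
          rw [hH t w k hk hkw, smul_inv_smul]; exact hball t _ hkw
        have h3 := hsame g hg k hk _ h1 h2
        have hgw : dist (g • w) z₀ < r / 2 := by rw [h3]; exact hkw
        rw [hH t w g hg hgw] at hzw
        exact smul_left_cancel g ((hb t).1 (smul_left_cancel g⁻¹ hzw))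
      · have h4 : H t w = w := hH' t w fun k hk => hρ.trans_le (not_lt.mp fun h => hw ⟨k, hk, h⟩)
        rw [h4] at h1
        exact absurd ⟨g, hg, h1⟩ hw
    intro z w hzw
    by_cases hz : ∃ g ∈ Γ, dist (g • z) z₀ < r / 2
    · exact key z w hzw hz
    by_cases hw : ∃ g ∈ Γ, dist (g • w) z₀ < r / 2
    · exact (key w z hzw.symm hw).symm
    · rwa [hH' t z fun k hk => hρ.trans_le (not_lt.mp fun h => hz ⟨k, hk, h⟩),
        hH' t w fun k hk => hρ.trans_le (not_lt.mp fun h => hw ⟨k, hk, h⟩)] at hzw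
  · intro u
    by_cases hu : ∃ g ∈ Γ, dist (g • u) z₀ < r / 2
    · obtain ⟨g, hg, hgu⟩ := hu
      obtain ⟨v, hv⟩ := (hb t).2 (g • u)
      refine ⟨g⁻¹ • v, ?_⟩
      rw [hH t _ g hg (by rw [smul_inv_smul]; exact hball' t v (by rw [hv]; exact hgu)),
        smul_inv_smul, hv, inv_smul_smul]
    · exact ⟨u, hH' t u fun k hk => hρ.trans_le (not_lt.mp fun h => hu ⟨k, hk, h⟩)⟩
  · intro t k hk z
    by_cases hz : ∃ g ∈ Γ, dist (g • z) z₀ < r / 2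
    · obtain ⟨g, hg, hgz⟩ := hz
      rw [hH t z g hg hgz, hH t (k • z) (g * k⁻¹) (mul_mem hg (inv_mem hk))
        (by rw [mul_smul, inv_smul_smul]; exact hgz), mul_smul, inv_smul_smul, mul_inv_rev, inv_inv,
        mul_smul]
    · have hz' : ∀ g ∈ Γ, ρ < dist (g • z) z₀ :=
        fun g hg => hρ.trans_le (not_lt.mp fun h => hz ⟨g, hg, h⟩)
      rw [hH' t z hz', hH' t (k • z) fun g hg => by
        rw [← mul_smul]; exact hz' _ (mul_mem hg hk)]
  · intro z
    by_cases hz : ∃ g ∈ Γ, dist (g • z) z₀ < r / 2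
    · obtain ⟨g, hg, hgz⟩ := hz
      rw [hH 0 z g hg hgz, h0, inv_smul_smul]
    · exact hH' 0 z fun k hk => hρ.trans_le (not_lt.mp fun h => hz ⟨k, hk, h⟩)
  · rw [hH 1 z 1 (one_mem _) (by rwa [one_smul]), inv_one, one_smul, one_smul]

end HyperbolicSurface

end

/-! ### Horseshoes -/

noncomputable section

/-- The square `[-1, 2] × [-1, 2]`, which supports the planar isotopies used below. -/
def supportSquare : Set (ℝ × ℝ) := Set.Icc (-1) 2 ×ˢ Set.Icc (-1) 2

/-- An isotopy of the plane that starts at the identity and is supported in a square. -/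
structure IsPlanarIsotopy (s : unitInterval → ℝ × ℝ → ℝ × ℝ) : Prop where
  continuous : Continuous fun p : unitInterval × (ℝ × ℝ) => s p.1 p.2
  bijective : ∀ t, Function.Bijective (s t)
  support : ∀ t, ∀ v ∉ supportSquare, s t v = v
  zero : ∀ v, s 0 v = v

theorem IsPlanarIsotopy.swap {s : unitInterval → ℝ × ℝ → ℝ × ℝ} (hs : IsPlanarIsotopy s) :
    IsPlanarIsotopy fun t v => (s t v.swap).swap := by
  refine ⟨?_, fun t => ?_, fun t v hv => ?_, fun v => by rw [hs.zero, Prod.swap_swap]⟩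
  · exact continuous_swap.comp (hs.continuous.comp
      (continuous_fst.prodMk (continuous_swap.comp continuous_snd)))
  · exact Prod.swap_bijective.comp ((hs.bijective t).comp Prod.swap_bijective)
  · rw [hs.support, Prod.swap_swap]
    intro h
    exact hv ⟨h.2, h.1⟩

/-- An increasing homeomorphism of the line supported in `[-1, 2]`. -/
structure IsSupportedProfile (l : ℝ → ℝ) : Prop where
  continuous : Continuous l
  strictMono : StrictMono l
  support : ∀ y ∉ Set.Icc (-1 : ℝ) 2, l y = y

/-- Truncation of a real number to the unit interval. -/
def clamp (x : ℝ) : ℝ := max 0 (min 1 x)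

theorem clamp_nonneg (x : ℝ) : 0 ≤ clamp x := le_max_left _ _
theorem clamp_le_one (x : ℝ) : clamp x ≤ 1 := max_le zero_le_one (min_le_left _ _)
theorem clamp_of_nonpos {x : ℝ} (h : x ≤ 0) : clamp x = 0 :=
  max_eq_left ((min_le_right _ _).trans h)
theorem clamp_of_one_le {x : ℝ} (h : 1 ≤ x) : clamp x = 1 := by
  rw [clamp, min_eq_left h, max_eq_right zero_le_one]
theorem continuous_clamp : Continuous clamp := by unfold clamp; fun_prop

/-- An isotopy that moves every point along its vertical line, and whose end acts
by given profiles on the vertical lines over `[0, ε]` and over `[1 - ε, 1]`. -/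
theorem exists_shear {l u : ℝ → ℝ} (hl : IsSupportedProfile l) (hu : IsSupportedProfile u) {ε : ℝ}
    (hε : ε < 1 / 2) : ∃ s, IsPlanarIsotopy s ∧
      (∀ x ∈ Set.Icc 0 ε, ∀ y, s 1 (x, y) = (x, l y)) ∧
      ∀ x ∈ Set.Icc (1 - ε) 1, ∀ y, s 1 (x, y) = (x, u y) := by
  let c : ℝ → ℝ := fun x => clamp (min (x + 1) (2 - x))
  let b : ℝ → ℝ := fun x => clamp ((x - ε) / (1 - 2 * ε))
  have hc : Continuous c := continuous_clamp.comp (by fun_prop)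
  have hb : Continuous b := continuous_clamp.comp (by fun_prop)
  let φ : unitInterval → ℝ → ℝ → ℝ := fun t x y =>
    y + t * (c x * ((1 - b x) * (l y - y) + b x * (u y - y)))
  have hφc : Continuous fun p : unitInterval × (ℝ × ℝ) => φ p.1 p.2.1 p.2.2 := by
    have := hl.continuous
    have := hu.continuous
    simp only [φ]
    fun_prop
  have hφmono : ∀ t x, StrictMono (φ t x) := by
    intro t x y y' hy
    have h1 := sub_pos.mpr (hl.strictMono hy)
    have h2 := sub_pos.mpr (hu.strictMono hy)
    have h3 := sub_pos.mpr hy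
    have hc0 : 0 ≤ (t : ℝ) * c x := mul_nonneg t.2.1 (clamp_nonneg _)
    have hc1 : (t : ℝ) * c x ≤ 1 := mul_le_one₀ t.2.2 (clamp_nonneg _) (clamp_le_one _)
    have hb0 : 0 ≤ b x := clamp_nonneg _
    have hb1 : b x ≤ 1 := clamp_le_one _
    -- a convex combination of positive numbers is positive
    set d := min (y' - y) (min (l y' - l y) (u y' - u y)) with hd
    have hd0 : 0 < d := lt_min h3 (lt_min h1 h2)
    have hd1 : d ≤ y' - y := min_le_left _ _
    have hd2 : d ≤ l y' - l y := (min_le_right _ _).trans (min_le_left _ _)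
    have hd3 : d ≤ u y' - u y := (min_le_right _ _).trans (min_le_right _ _)
    have key : φ t x y' - φ t x y = (1 - t * c x) * (y' - y) +
        t * c x * ((1 - b x) * (l y' - l y) + b x * (u y' - u y)) := by
      simp only [φ]; ring
    have e1 : (1 - b x) * d ≤ (1 - b x) * (l y' - l y) :=
      mul_le_mul_of_nonneg_left hd2 (by linarith)
    have e2 : b x * d ≤ b x * (u y' - u y) := mul_le_mul_of_nonneg_left hd3 hb0
    have e3 : t * c x * d ≤ t * c x * ((1 - b x) * (l y' - l y) + b x * (u y' - u y)) :=
      mul_le_mul_of_nonneg_left (by linarith) hc0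
    have e4 : (1 - t * c x) * d ≤ (1 - t * c x) * (y' - y) :=
      mul_le_mul_of_nonneg_left hd1 (by linarith)
    linarith
  have hφsupp : ∀ t x y, y ∉ Set.Icc (-1 : ℝ) 2 → φ t x y = y := by
    intro t x y hy
    simp only [φ, hl.support y hy, hu.support y hy, sub_self, mul_zero, add_zero]
  have hcsupp : ∀ x ∉ Set.Icc (-1 : ℝ) 2, c x = 0 := by
    intro x hx
    refine clamp_of_nonpos ?_
    rw [Set.mem_Icc, not_and_or, not_le, not_le] at hx
    rcases hx with hx | hx
    · exact (min_le_left _ _).trans (by linarith)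
    · exact (min_le_right _ _).trans (by linarith)
  have hc1 : ∀ x ∈ Set.Icc (0 : ℝ) 1, c x = 1 := fun x hx =>
    clamp_of_one_le (le_min (by linarith [hx.1]) (by linarith [hx.2]))
  refine ⟨fun t v => (v.1, φ t v.1 v.2), ⟨?_, fun t => ⟨?_, ?_⟩, ?_, ?_⟩, ?_, ?_⟩
  · exact (continuous_fst.comp continuous_snd).prodMk hφc
  · rintro ⟨x, y⟩ ⟨x', y'⟩ h
    simp only [Prod.mk.injEq] at h
    obtain ⟨rfl, h⟩ := h
    rw [(hφmono t x).injective h]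
  · rintro ⟨x, y⟩
    have hcont : Continuous (φ t x) :=
      hφc.comp (continuous_const.prodMk (continuous_const.prodMk continuous_id))
    have htop : Tendsto (φ t x) atTop atTop := by
      refine tendsto_id.congr' ?_
      filter_upwards [eventually_gt_atTop 2] with y hy
      exact (hφsupp t x y fun h => absurd h.2 (not_le.mpr hy)).symm
    have hbot : Tendsto (φ t x) atBot atBot := by
      refine tendsto_id.congr' ?_
      filter_upwards [eventually_lt_atBot (-1)] with y hy
      exact (hφsupp t x y fun h => absurd h.1 (not_le.mpr hy)).symm
    obtain ⟨y', hy'⟩ := hcont.surjective htop hbot y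
    exact ⟨(x, y'), by rw [← hy']⟩
  · rintro t ⟨x, y⟩ hv
    by_cases hx : x ∈ Set.Icc (-1 : ℝ) 2
    · rw [hφsupp t x y fun hy => hv ⟨hx, hy⟩]
    · simp only [φ, hcsupp x hx, zero_mul, mul_zero, add_zero]
  · rintro ⟨x, y⟩
    simp only [φ, Set.Icc.coe_zero, zero_mul, add_zero]
  · intro x hx y
    have h1 : b x = 0 := clamp_of_nonpos
      (div_nonpos_of_nonpos_of_nonneg (by linarith [hx.2]) (by linarith))
    simp only [φ, h1, hc1 x ⟨hx.1, by linarith [hx.2]⟩, Set.Icc.coe_one, one_mul]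
    congr 1; ring
  · intro x hx y
    have h1 : b x = 1 := clamp_of_one_le (by
      rw [le_div_iff₀ (by linarith)]; linarith [hx.1])
    simp only [φ, h1, hc1 x ⟨by linarith [hx.1], hx.2⟩, Set.Icc.coe_one, one_mul]
    congr 1; ring

/-- A piecewise affine profile that maps `[0, 1]` affinely onto `[0, ε]`. -/
def contraction (ε y : ℝ) : ℝ := min y (max (ε * y) (ε + (2 - ε) * (y - 1)))

/-- A piecewise affine profile that maps `[0, ε]` affinely onto `[0, 1]`. -/
def expansion (ε y : ℝ) : ℝ := max y (min (y / ε) (1 + (y - ε) / (2 - ε)))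

theorem isSupportedProfile_contraction {ε : ℝ} (h0 : 0 < ε) (h1 : ε < 1 / 2) :
    IsSupportedProfile (contraction ε) := by
  refine ⟨by unfold contraction; fun_prop, ?_, ?_⟩
  · intro a b hab
    have h2 : ε * a < ε * b := mul_lt_mul_of_pos_left hab h0
    have h3 : (2 - ε) * (a - 1) < (2 - ε) * (b - 1) :=
      mul_lt_mul_of_pos_left (by linarith) (by linarith)
    exact min_lt_min hab (max_lt_max h2 (by linarith))
  · intro y hy
    rw [Set.mem_Icc, not_and_or, not_le, not_le] at hy
    refine min_eq_left ?_
    rcases hy with hy | hy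
    · exact le_max_of_le_left (by nlinarith)
    · exact le_max_of_le_right (by nlinarith)

theorem isSupportedProfile_expansion {ε : ℝ} (h0 : 0 < ε) (h1 : ε < 1 / 2) :
    IsSupportedProfile (expansion ε) := by
  refine ⟨by unfold expansion; fun_prop, ?_, ?_⟩
  · intro a b hab
    have h2 : a / ε < b / ε := div_lt_div_of_pos_right hab h0
    have h3 : (a - ε) / (2 - ε) < (b - ε) / (2 - ε) :=
      div_lt_div_of_pos_right (by linarith) (by linarith)
    exact max_lt_max hab (min_lt_min h2 (by linarith))
  · intro y hy
    rw [Set.mem_Icc, not_and_or, not_le, not_le] at hy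
    refine max_eq_left ?_
    rcases hy with hy | hy
    · refine min_le_of_left_le ?_
      rw [div_le_iff₀ h0]; nlinarith
    · refine min_le_of_right_le ?_
      have : (y - ε) / (2 - ε) ≤ y - 1 := by
        rw [div_le_iff₀ (by linarith)]; nlinarith
      linarith

theorem contraction_of_mem {ε y : ℝ} (h1 : ε < 1 / 2) (hy : y ∈ Set.Icc (0 : ℝ) 1) :
    contraction ε y = ε * y := by
  obtain ⟨hy0, hy1⟩ := hy
  rw [contraction, max_eq_left (by nlinarith), min_eq_right (by nlinarith)]

theorem expansion_of_mem {ε y : ℝ} (h0 : 0 < ε) (h1 : ε < 1 / 2) (hy : y ∈ Set.Icc (0 : ℝ) ε) :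
    expansion ε y = y / ε := by
  obtain ⟨hy0, hy1⟩ := hy
  have e1 : y ≤ y / ε := by rw [le_div_iff₀ h0]; nlinarith
  have e2 : y / ε ≤ 1 + (y - ε) / (2 - ε) := by
    have e3 : 1 + (y - ε) / (2 - ε) - y / ε = (ε - y) * (2 - 2 * ε) / (ε * (2 - ε)) := by
      have : 2 - ε ≠ 0 := by linarith
      field_simp
      ring
    have e4 : 0 ≤ (ε - y) * (2 - 2 * ε) / (ε * (2 - ε)) :=
      div_nonneg (mul_nonneg (by linarith) (by linarith)) (mul_nonneg h0.le (by linarith))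
    linarith
  rw [expansion, min_eq_left e2, max_eq_right e1]

/-- The symmetric profile with respect to the midpoint of the unit interval. -/
theorem IsSupportedProfile.reflect {l : ℝ → ℝ} (hl : IsSupportedProfile l) :
    IsSupportedProfile fun y => 1 - l (1 - y) := by
  refine ⟨?_, ?_, ?_⟩
  · have := hl.continuous
    fun_prop
  · intro a b hab
    have := hl.strictMono (show 1 - b < 1 - a by linarith)
    dsimp only
    linarith
  · intro y hy
    rw [hl.support]
    · ring
    · intro h
      exact hy ⟨by linarith [h.2], by linarith [h.1]⟩

/-- The global chart `(x, y) ↦ η x + i exp (η y)` of `ℍ`, which maps `0` to `i` and bounded sets close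
to `i` if `η` is small. -/
def halfPlaneChart (η : ℝ) (hη : 0 < η) : ℝ × ℝ ≃ₜ ℍ where
  toFun v := ⟨⟨η * v.1, Real.exp (η * v.2)⟩, Real.exp_pos _⟩
  invFun z := (z.re / η, Real.log z.im / η)
  left_inv v := by
    ext
    · simp [UpperHalfPlane.re, hη.ne']
    · simp [UpperHalfPlane.im, hη.ne']
  right_inv z := by
    apply UpperHalfPlane.ext
    apply Complex.ext
    · simp [mul_div_cancel₀ _ hη.ne']
    · simp [mul_div_cancel₀ _ hη.ne', Real.exp_log z.im_pos]
  continuous_toFun := by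
    refine UpperHalfPlane.isEmbedding_coe.continuous_iff.mpr ?_
    have : Continuous fun v : ℝ × ℝ => (⟨η * v.1, Real.exp (η * v.2)⟩ : ℂ) := by
      have h : (fun v : ℝ × ℝ => (⟨η * v.1, Real.exp (η * v.2)⟩ : ℂ)) =
          Complex.equivRealProdCLM.symm ∘ fun v => (η * v.1, Real.exp (η * v.2)) := rfl
      rw [h]
      exact Complex.equivRealProdCLM.symm.continuous.comp (by fun_prop)
    exact this
  continuous_invFun := by
    refine (UpperHalfPlane.continuous_re.div_const η).prodMk (Continuous.div_const ?_ η)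
    exact UpperHalfPlane.continuous_im.log fun z => z.im_pos.ne'

theorem halfPlaneChart_eq (η : ℝ) (hη : 0 < η) (v : ℝ × ℝ) :
    halfPlaneChart η hη v = halfPlaneChart 1 one_pos (η • v) := by
  apply UpperHalfPlane.ext
  simp [halfPlaneChart]

/-- If the scale is small, the chart maps the support square into a small ball around `i`. -/
theorem exists_chart_small {ρ : ℝ} (hρ : 0 < ρ) : ∃ (η : ℝ) (hη : 0 < η),
    ∀ v ∈ supportSquare, dist (halfPlaneChart η hη v) UpperHalfPlane.I ≤ ρ := by
  have h0 : halfPlaneChart 1 one_pos 0 = UpperHalfPlane.I := by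
    apply UpperHalfPlane.ext
    apply Complex.ext <;> simp [halfPlaneChart]
  have hc := (halfPlaneChart 1 one_pos).continuous.continuousAt (x := 0)
  obtain ⟨δ, hδ, h⟩ := Metric.continuousAt_iff.mp hc ρ hρ
  refine ⟨δ / 3, by positivity, fun v hv => ?_⟩
  rw [halfPlaneChart_eq, ← h0]
  refine (h ?_).le
  rw [dist_zero_right, norm_smul, Real.norm_of_nonneg (by positivity)]
  have h2 : ‖v‖ ≤ 2 := by
    rw [Prod.norm_def]
    refine max_le ?_ ?_ <;> rw [Real.norm_eq_abs, abs_le]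
    · exact ⟨by linarith [hv.1.1], hv.1.2⟩
    · exact ⟨by linarith [hv.2.1], hv.2.2⟩
  nlinarith [norm_nonneg v]

namespace HyperbolicSurface

variable {S : Type*} [MetricSpace S] (X : HyperbolicSurface S)

/-- A planar isotopy transported by a small chart extends to an equivariant isotopy. -/
theorem exists_extension_of_planar {r : ℝ}
    (hr : ∀ g ∈ X.matrixGroup, ∀ z : ℍ, dist z (g • z) < r → ∀ w : ℍ, g • w = w) (hr0 : 0 < r)
    {η : ℝ} (hη : 0 < η)
    (hsq : ∀ v ∈ supportSquare, dist (halfPlaneChart η hη v) UpperHalfPlane.I ≤ r / 4)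
    {s : unitInterval → ℝ × ℝ → ℝ × ℝ} (hs : IsPlanarIsotopy s) :
    ∃ F, EquivariantlyIsotopicToId X.matrixGroup F ∧
      ∀ v ∈ supportSquare, F (halfPlaneChart η hη v) = halfPlaneChart η hη (s 1 v) := by
  set κ := halfPlaneChart η hη
  obtain ⟨F, hF, hFs, -⟩ := X.exists_equivariant_extension hr (z₀ := UpperHalfPlane.I)
    (ρ := r / 4) (by linarith) (h := fun t z => κ (s t (κ.symm z)))
    (κ.continuous.comp (hs.continuous.comp
      (continuous_fst.prodMk (κ.symm.continuous.comp continuous_snd))))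
    (fun t => κ.bijective.comp ((hs.bijective t).comp κ.symm.bijective))
    (fun t z hz => by
      rw [hs.support, κ.apply_symm_apply]
      intro hv
      have := hsq _ hv
      rw [κ.apply_symm_apply] at this
      linarith)
    (fun z => by rw [hs.zero, κ.apply_symm_apply])
  refine ⟨F, hF, fun v hv => ?_⟩
  rw [hFs _ ((hsq v hv).trans_lt (by linarith)), κ.symm_apply_apply]

/-- The two halves of a horseshoe map: a vertical contraction and a horizontal expansion, which act
in different ways near the left and the right sides of the unit square. -/
theorem exists_horseshoe {r : ℝ}
    (hr : ∀ g ∈ X.matrixGroup, ∀ z : ℍ, dist z (g • z) < r → ∀ w : ℍ, g • w = w) (hr0 : 0 < r)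
    {η : ℝ} (hη : 0 < η)
    (hsq : ∀ v ∈ supportSquare, dist (halfPlaneChart η hη v) UpperHalfPlane.I ≤ r / 4)
    {ε : ℝ} (h0 : 0 < ε) (h1 : ε < 1 / 2) :
    ∃ F G, EquivariantlyIsotopicToId X.matrixGroup F ∧ EquivariantlyIsotopicToId X.matrixGroup G ∧
      (∀ x ∈ Set.Icc 0 ε, ∀ y ∈ Set.Icc (0 : ℝ) 1,
        F (halfPlaneChart η hη (x, y)) = halfPlaneChart η hη (x, ε * y)) ∧
      (∀ x ∈ Set.Icc (1 - ε) 1, ∀ y ∈ Set.Icc (0 : ℝ) 1,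
        F (halfPlaneChart η hη (x, y)) = halfPlaneChart η hη (x, 1 - ε + ε * y)) ∧
      (∀ y ∈ Set.Icc 0 ε, ∀ x ∈ Set.Icc (0 : ℝ) 1,
        G (halfPlaneChart η hη (ε * x, y)) = halfPlaneChart η hη (x, y)) ∧
      ∀ y ∈ Set.Icc (1 - ε) 1, ∀ x ∈ Set.Icc (0 : ℝ) 1,
        G (halfPlaneChart η hη (1 - ε + ε * x, y)) = halfPlaneChart η hη (x, y) := by
  obtain ⟨s, hs, hs1, hs2⟩ := exists_shear (isSupportedProfile_contraction h0 h1)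
    (isSupportedProfile_contraction h0 h1).reflect h1
  obtain ⟨s', hs', hs1', hs2'⟩ := exists_shear (isSupportedProfile_expansion h0 h1)
    (isSupportedProfile_expansion h0 h1).reflect h1
  obtain ⟨F, hF, hFs⟩ := X.exists_extension_of_planar hr hr0 hη hsq hs
  obtain ⟨G, hG, hGs⟩ := X.exists_extension_of_planar hr hr0 hη hsq hs'.swap
  have hsub : ∀ x y : ℝ, x ∈ Set.Icc (0 : ℝ) 1 → y ∈ Set.Icc (0 : ℝ) 1 → (x, y) ∈ supportSquare :=
    fun x y hx hy => ⟨⟨by linarith [hx.1], by linarith [hx.2]⟩,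
      ⟨by linarith [hy.1], by linarith [hy.2]⟩⟩
  refine ⟨F, G, hF, hG, fun x hx y hy => ?_, fun x hx y hy => ?_, fun y hy x hx => ?_,
    fun y hy x hx => ?_⟩
  · rw [hFs _ (hsub x y ⟨hx.1, by linarith [hx.2]⟩ hy), hs1 x hx, contraction_of_mem h1 hy]
  · rw [hFs _ (hsub x y ⟨by linarith [hx.1], hx.2⟩ hy), hs2 x hx,
      contraction_of_mem h1 ⟨by linarith [hy.2], by linarith [hy.1]⟩]
    congr 2; ring
  · have hx' : ε * x ∈ Set.Icc 0 ε := ⟨by nlinarith [hx.1], by nlinarith [hx.2]⟩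
    rw [hGs _ (hsub _ y ⟨hx'.1, by linarith [hx'.2]⟩ ⟨hy.1, by linarith [hy.2]⟩)]
    change halfPlaneChart η hη (s' 1 (y, ε * x)).swap = _
    rw [hs1' y hy, expansion_of_mem h0 h1 hx', mul_div_cancel_left₀ _ h0.ne', Prod.swap_prod_mk]
  · have hx' : 1 - (1 - ε + ε * x) ∈ Set.Icc 0 ε := ⟨by nlinarith [hx.2], by nlinarith [hx.1]⟩
    rw [hGs _ (hsub _ y ⟨by linarith [hx'.2], by linarith [hx'.1]⟩ ⟨by linarith [hy.1], hy.2⟩)]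
    change halfPlaneChart η hη (s' 1 (y, 1 - ε + ε * x)).swap = _
    rw [hs2' y hy, expansion_of_mem h0 h1 hx', Prod.swap_prod_mk]
    congr 2
    field_simp
    ring

end HyperbolicSurface

end

/-! ### Point pushing -/

noncomputable section

namespace SL2

/-- The rotation matrix, which acts on `ℍ` as a rotation around `i`. -/
def rotation (θ : ℝ) : SL(2, ℝ) :=
  mkSL (Real.cos θ) (Real.sin θ) (-Real.sin θ) (Real.cos θ)
    (by linarith [Real.cos_sq_add_sin_sq θ])

theorem rotation_add (θ φ : ℝ) : rotation (θ + φ) = rotation θ * rotation φ := by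
  apply ext' <;> simp [rotation, mul_apply', Real.cos_add, Real.sin_add] <;> ring

theorem rotation_zero : rotation 0 = 1 := by
  apply ext' <;> simp [rotation]

theorem rotation_smul_I (θ : ℝ) : rotation θ • UpperHalfPlane.I = UpperHalfPlane.I := by
  rw [smul_eq_iff]
  simp only [rotation, mkSL_zero_zero, mkSL_zero_one, mkSL_one_zero, mkSL_one_one,
    UpperHalfPlane.coe_I, Complex.ofReal_neg]
  linear_combination (Real.sin θ : ℂ) * Complex.I_sq

theorem continuous_rotation : Continuous rotation := by
  refine continuous_induced_rng.mpr (continuous_pi fun i => continuous_pi fun j => ?_)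
  fin_cases i <;> fin_cases j
  exacts [Real.continuous_cos, Real.continuous_sin, Real.continuous_sin.neg, Real.continuous_cos]

theorem exists_eq_rotation {k : SL(2, ℝ)} (hk : k • UpperHalfPlane.I = UpperHalfPlane.I) :
    ∃ θ, k = rotation θ := by
  have h := (smul_eq_iff k _ _).mp hk
  simp only [UpperHalfPlane.coe_I, Complex.ext_iff] at h
  simp at h
  obtain ⟨h1, h2⟩ := h
  have hdet := det_eq k
  have hn : ‖(⟨k 0 0, k 0 1⟩ : ℂ)‖ = 1 := by
    rw [← sq_eq_sq₀ (norm_nonneg _) zero_le_one, Complex.sq_norm, Complex.normSq_mk, one_pow]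
    linear_combination hdet + k 0 0 * h2 + k 0 1 * h1
  have hne : (⟨k 0 0, k 0 1⟩ : ℂ) ≠ 0 := by
    intro h; rw [h, norm_zero] at hn; exact zero_ne_one hn
  have hc : Real.cos (Complex.arg ⟨k 0 0, k 0 1⟩) = k 0 0 := by rw [Complex.cos_arg hne, hn, div_one]
  have hs : Real.sin (Complex.arg ⟨k 0 0, k 0 1⟩) = k 0 1 := by rw [Complex.sin_arg, hn, div_one]
  refine ⟨Complex.arg ⟨k 0 0, k 0 1⟩, ?_⟩
  apply ext' <;> simp only [rotation, mkSL_zero_zero, mkSL_zero_one, mkSL_one_zero, mkSL_one_one,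
    hc, hs]
  · linarith
  · exact h2.symm

/-- A half turn around `i` exchanges the two halves of the imaginary axis. -/
theorem rotation_smul_diag (t : ℝ) : rotation (Real.pi / 2) • diag t • UpperHalfPlane.I =
    diag (-t) • UpperHalfPlane.I := by
  have h : rotation (Real.pi / 2) * diag t = diag (-t) * rotation (Real.pi / 2) := by
    apply ext' <;> simp [rotation, diag, mul_apply']
    all_goals ring_nf
  rw [← mul_smul, h, mul_smul, rotation_smul_I]

/-- Every point is rotated around `i` to a point of the upper part of the imaginary axis. -/
theorem exists_rotation_smul_eq_diag (w : ℍ) :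
    ∃ θ t, 0 ≤ t ∧ rotation θ • w = diag t • UpperHalfPlane.I := by
  obtain ⟨θ, hθ⟩ : ∃ θ : ℝ, Real.cos (2 * θ) * w.re +
      Real.sin (2 * θ) * ((1 - w.re ^ 2 - w.im ^ 2) / 2) = 0 := by
    have hc : Continuous fun θ : ℝ => Real.cos (2 * θ) * w.re +
      Real.sin (2 * θ) * ((1 - w.re ^ 2 - w.im ^ 2) / 2) := by fun_prop
    refine mem_range_of_exists_le_of_exists_ge hc ?_ ?_ <;> rcases le_total 0 w.re with h | h
    · exact ⟨Real.pi / 2, by simp [mul_div_cancel₀, h]⟩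
    · exact ⟨0, by simp [h]⟩
    · exact ⟨0, by simp [h]⟩
    · exact ⟨Real.pi / 2, by simp [mul_div_cancel₀, h]⟩
  set w' := rotation θ • w with hw'
  have hre : w'.re = 0 := by
    have h := (smul_eq_iff (rotation θ) w w').mp hw'.symm
    have hD := denom_ne (rotation θ) w
    simp only [rotation, mkSL_zero_zero, mkSL_zero_one, mkSL_one_zero, mkSL_one_one,
      Complex.ofReal_neg] at h hD
    simp only [Complex.ext_iff] at h
    simp [-Complex.ofReal_cos, -Complex.ofReal_sin] at h
    obtain ⟨h1, h2⟩ := h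
    have key : w'.re * ((Real.cos θ - Real.sin θ * w.re) ^ 2 + (Real.sin θ * w.im) ^ 2) = 0 := by
      rw [Real.cos_two_mul, Real.sin_two_mul] at hθ
      linear_combination hθ - (Real.cos θ - Real.sin θ * w.re) * h1 + Real.sin θ * w.im * h2 -
        w.re * Real.sin_sq_add_cos_sq θ
    rcases mul_eq_zero.mp key with h | h
    · exact h
    · exfalso
      have e1 : Real.cos θ - Real.sin θ * w.re = 0 := by nlinarith [sq_nonneg (Real.sin θ * w.im)]
      have e2 : Real.sin θ * w.im = 0 := by
        nlinarith [sq_nonneg (Real.cos θ - Real.sin θ * w.re)]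
      refine hD (Complex.ext ?_ ?_)
      · simp [-Complex.ofReal_cos, -Complex.ofReal_sin]; linarith
      · simp [-Complex.ofReal_cos, -Complex.ofReal_sin]
        rcases mul_eq_zero.mp e2 with h | h
        · exact Or.inl h
        · exact absurd h w.im_pos.ne'
  have hw2 : w' = diag (Real.log w'.im) • UpperHalfPlane.I := by
    apply UpperHalfPlane.ext
    rw [coe_diag_smul, Real.exp_log w'.im_pos]
    apply Complex.ext <;> simp [hre]
  rcases le_total 0 (Real.log w'.im) with h | h
  · exact ⟨θ, _, h, hw2⟩
  · refine ⟨Real.pi / 2 + θ, -Real.log w'.im, by linarith, ?_⟩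
    rw [rotation_add, mul_smul, ← hw', ← rotation_smul_diag, ← hw2]

/-- Two points at the same distance from `c` differ by a rotation around `c`. -/
theorem exists_fixing_smul_eq {c z w : ℍ} (h : dist z c = dist w c) :
    ∃ k : SL(2, ℝ), k • c = c ∧ k • z = w := by
  obtain ⟨g, rfl⟩ := MulAction.exists_smul_eq SL(2, ℝ) UpperHalfPlane.I c
  obtain ⟨θ, t, ht, h1⟩ := exists_rotation_smul_eq_diag (g⁻¹ • z)
  obtain ⟨φ, s, hs, h2⟩ := exists_rotation_smul_eq_diag (g⁻¹ • w)
  have hd : ∀ (θ t : ℝ) (z : ℍ), 0 ≤ t → rotation θ • g⁻¹ • z = diag t • UpperHalfPlane.I →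
      dist z (g • UpperHalfPlane.I) = t := by
    intro θ t z ht h
    have := dist_diag_smul_I t 0
    rw [← h, diag_zero, one_smul, sub_zero, abs_of_nonneg ht] at this
    rw [← this, ← dist_smul (rotation θ * g⁻¹) z, mul_smul, mul_smul, inv_smul_smul,
      rotation_smul_I]
  have hst : t = s := by rw [← hd θ t z ht h1, ← hd φ s w hs h2, h]
  refine ⟨g * (rotation φ)⁻¹ * rotation θ * g⁻¹, ?_, ?_⟩
  · simp only [mul_smul, inv_smul_smul, rotation_smul_I]
    rw [inv_smul_eq_iff.mpr (rotation_smul_I φ).symm]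
  · simp only [mul_smul]
    rw [h1, hst, ← h2, inv_smul_smul, smul_inv_smul]

/-- The rotations around a point form a one-parameter group, which contains every matrix that fixes
the point. -/
theorem exists_rotations_around {c : ℍ} {k : SL(2, ℝ)} (hk : k • c = c) :
    ∃ R : ℝ → SL(2, ℝ), Continuous R ∧ R 0 = 1 ∧ (∀ s t, R (s + t) = R s * R t) ∧
      (∀ t, R t • c = c) ∧ ∃ θ, R θ = k := by
  obtain ⟨g, rfl⟩ := MulAction.exists_smul_eq SL(2, ℝ) UpperHalfPlane.I c
  obtain ⟨θ, hθ⟩ := exists_eq_rotation (k := g⁻¹ * k * g) (by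
    rw [mul_smul, mul_smul, hk, inv_smul_smul])
  refine ⟨fun t => g * rotation t * g⁻¹,
    (continuous_const.mul continuous_rotation).mul continuous_const, ?_, fun s t => ?_, fun t => ?_,
    θ, ?_⟩
  · simp only [rotation_zero, mul_one, mul_inv_cancel]
  · simp only [rotation_add]; group
  · rw [mul_smul, mul_smul, inv_smul_smul, rotation_smul_I]
  · simp only [← hθ]; group

end SL2

/-- A ball of the hyperbolic plane is connected. -/
theorem isPreconnected_ball (z : ℍ) (r : ℝ) : IsPreconnected (Metric.ball z r) := by
  rw [← UpperHalfPlane.isEmbedding_coe.isInducing.isPreconnected_image,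
    UpperHalfPlane.image_coe_ball]
  exact (convex_ball _ _).isPreconnected

theorem exists_equidistant {z w : ℍ} {ρ : ℝ} (h : dist w z < ρ) :
    ∃ c, dist c z < ρ ∧ dist z c = dist w c := by
  have hz : z ∈ Metric.ball z ρ := Metric.mem_ball_self (dist_nonneg.trans_lt h)
  obtain ⟨c, hc, hcz⟩ := (isPreconnected_ball z ρ).intermediate_value hz
    (show w ∈ Metric.ball z ρ from h) (f := fun c => dist z c - dist w c)
    (Continuous.continuousOn (by fun_prop))
    (show (0 : ℝ) ∈ _ from ⟨by simp, by simp⟩)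
  exact ⟨c, hc, by simpa [sub_eq_zero] using hcz⟩

/-- The complement of a countable subset of the hyperbolic plane is connected. -/
theorem isPreconnected_compl_of_countable {A : Set ℍ} (hA : A.Countable) : IsPreconnected Aᶜ := by
  have κ := halfPlaneChart 1 one_pos
  have h := ((hA.preimage κ.injective).isConnected_compl_of_one_lt_rank (by
    simp; norm_num)).isPreconnected
  rw [← Set.preimage_compl] at h
  have h2 := h.image κ κ.continuous.continuousOn
  rwa [Set.image_preimage_eq _ κ.surjective] at h2

namespace HyperbolicSurface

variable {S : Type*} [MetricSpace S] (X : HyperbolicSurface S)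

/-- A twist: an equivariant map, isotopic to the identity, that rotates a small ball around `c` and
is the identity away from the translates of a slightly larger ball. -/
theorem exists_twist {r : ℝ}
    (hr : ∀ g ∈ X.matrixGroup, ∀ z : ℍ, dist z (g • z) < r → ∀ w : ℍ, g • w = w)
    {ρ : ℝ} (hρ0 : 0 < ρ) (hρ : 3 * ρ < r / 2) {c : ℍ} {k : SL(2, ℝ)} (hk : k • c = c) :
    ∃ F, EquivariantlyIsotopicToId X.matrixGroup F ∧ (∀ z, dist z c < 2 * ρ → F z = k • z) ∧
      ∀ z, (∀ g ∈ X.matrixGroup, 3 * ρ < dist (g • z) c) → F z = z := by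
  obtain ⟨R, hR, hR0, hRadd, hRc, θ, rfl⟩ := SL2.exists_rotations_around hk
  obtain ⟨χ, hχ⟩ : ∃ χ : ℍ → ℝ, χ = fun z => clamp ((3 * ρ - dist z c) / ρ) := ⟨_, rfl⟩
  have hχc : Continuous χ := by rw [hχ]; exact continuous_clamp.comp (by fun_prop)
  have hdist : ∀ (φ : ℝ) (z : ℍ), dist (R φ • z) c = dist z c := fun φ z => by
    rw [← dist_smul (R φ) z c, hRc]
  have hTT : ∀ (s : ℝ) (z : ℍ), R (-s * χ (R (s * χ z) • z)) • R (s * χ z) • z = z := by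
    intro s z
    have hχe : χ (R (s * χ z) • z) = χ z := by simp only [hχ, hdist]
    rw [hχe, ← mul_smul, ← hRadd, neg_mul, neg_add_cancel, hR0, one_smul]
  have hTc : Continuous fun p : ℝ × ℍ => R (p.1 * χ p.2) • p.2 :=
    Continuous.smul (f := fun p : ℝ × ℍ => R (p.1 * χ p.2)) (g := Prod.snd)
      (hR.comp (continuous_fst.mul (hχc.comp continuous_snd))) continuous_snd
  have hT1 : ∀ (s : ℝ) (z : ℍ), 3 * ρ < dist z c → R (s * χ z) • z = z := by
    intro s z hz
    have : χ z = 0 := by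
      rw [hχ]
      exact clamp_of_nonpos (div_nonpos_of_nonpos_of_nonneg (by linarith) hρ0.le)
    rw [this, mul_zero, hR0, one_smul]
  obtain ⟨F, hF, hF1, hF2⟩ := X.exists_equivariant_extension hr hρ (z₀ := c)
    (h := fun t z => R (t * θ * χ z) • z)
    (hTc.comp (g := fun p : ℝ × ℍ => R (p.1 * χ p.2) • p.2)
      (f := fun p : unitInterval × ℍ => ((p.1 : ℝ) * θ, p.2))
      (((continuous_subtype_val.comp continuous_fst).mul_const θ).prodMk continuous_snd))
    (fun t => Function.bijective_iff_has_inverse.mpr ⟨fun z => R (-(t * θ) * χ z) • z, hTT _,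
      fun z => by
        have := hTT (-(t * θ)) z
        rwa [neg_neg] at this⟩)
    (fun t z hz => hT1 _ z hz) (fun z => by
      rw [Set.Icc.coe_zero, zero_mul, zero_mul, hR0, one_smul])
  refine ⟨F, hF, fun z hz => ?_, hF2⟩
  have : χ z = 1 := by
    rw [hχ]
    exact clamp_of_one_le (by rw [le_div_iff₀ hρ0]; linarith)
  rw [hF1 z (by linarith), this, Set.Icc.coe_one, one_mul, mul_one]

/-- A twist around a point `c` can be done away from the orbit of a point `q`, if the centre stays at
a definite distance from the orbit. -/
theorem exists_twist_away {r : ℝ}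
    (hr : ∀ g ∈ X.matrixGroup, ∀ z : ℍ, dist z (g • z) < r → ∀ w : ℍ, g • w = w)
    {ρ : ℝ} (hρ0 : 0 < ρ) (hρ : 3 * ρ < r / 2) {c q : ℍ} {k : SL(2, ℝ)} (hk : k • c = c)
    (hq : ∀ g ∈ X.matrixGroup, 4 * ρ ≤ dist (g • q) c) :
    ∃ F, EquivariantlyIsotopicToId X.matrixGroup F ∧ (∀ z, dist z c < 2 * ρ → F z = k • z) ∧
      ∀ᶠ z in 𝓝 q, F z = z := by
  obtain ⟨F, hF, h1, h2⟩ := X.exists_twist hr hρ0 hρ hk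
  refine ⟨F, hF, h1, ?_⟩
  filter_upwards [Metric.ball_mem_nhds q hρ0] with z hz
  refine h2 z fun g hg => ?_
  have h3 := dist_triangle (g • q) (g • z) c
  have h4 : dist (g • q) (g • z) < ρ := by rw [dist_smul, dist_comm]; exact hz
  linarith [hq g hg]

/-- Point pushing: if `p` and `q` have different images in the surface, some equivariant map isotopic
to the identity acts near `p` as a given covering transformation, and near `q` as the identity. -/
theorem exists_push [CompactSpace S] {p q : ℍ} (hpq : X.proj p ≠ X.proj q) {a : SL(2, ℝ)}
    (ha : a ∈ X.matrixGroup) :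
    ∃ F, EquivariantlyIsotopicToId X.matrixGroup F ∧ (∀ᶠ z in 𝓝 p, F z = a • z) ∧
      ∀ᶠ z in 𝓝 q, F z = z := by
  obtain ⟨r, hr0, hr⟩ := X.exists_pos_displacement
  have := X.countable_deck
  set U : Set ℍ := {z | X.proj z = X.proj q}ᶜ with hU
  have hUo : IsOpen U := (isClosed_eq X.continuous_proj continuous_const).isOpen_compl
  have hUp : IsPreconnected U := by
    refine isPreconnected_compl_of_countable ?_
    refine (Set.countable_range fun φ : X.deck => φ • q).mono fun z hz => ?_
    exact X.isQuotientCoveringMap.apply_eq_iff_mem_orbit.mp hz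
  -- a radius for twists near a point of `U`
  have hrad : ∀ z ∈ U, ∃ ρ > 0, 3 * ρ < r / 2 ∧
      ∀ c, dist c z < ρ → ∀ g ∈ X.matrixGroup, 4 * ρ ≤ dist (g • q) c := by
    intro z hz
    obtain ⟨δ, hδ, hball⟩ := Metric.isOpen_iff.mp hUo z hz
    refine ⟨min (δ / 5) (r / 7), by positivity, ?_, fun c hc g hg => ?_⟩
    · linarith [min_le_right (δ / 5) (r / 7)]
    · by_contra! hcon
      have h1 : dist (g • q) z < δ := by
        have := dist_triangle (g • q) c z
        linarith [min_le_left (δ / 5) (r / 7)]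
      exact hball h1 (X.proj_smul hg q)
  let P : ℍ → ℍ → Prop := fun z w => ∃ F, EquivariantlyIsotopicToId X.matrixGroup F ∧
    (∃ k : SL(2, ℝ), k • z = w ∧ ∀ᶠ z' in 𝓝 z, F z' = k • z') ∧ ∀ᶠ z in 𝓝 q, F z = z
  have hstep : ∀ z ∈ U, ∀ᶠ w in 𝓝[U] z, P z w ∧ P w z := by
    intro z hz
    obtain ⟨ρ, hρ0, hρ, haway⟩ := hrad z hz
    refine mem_nhdsWithin_of_mem_nhds ?_
    filter_upwards [Metric.ball_mem_nhds z hρ0] with w hw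
    obtain ⟨c, hcz, hc⟩ := exists_equidistant hw
    have key : ∀ z w, dist z c = dist w c → dist z c < ρ → P z w := by
      intro z w hzw hzc
      obtain ⟨k, hkc, hkz⟩ := SL2.exists_fixing_smul_eq hzw
      obtain ⟨F, hF, hF1, hF2⟩ := X.exists_twist_away hr hρ0 hρ hkc (haway c hcz)
      refine ⟨F, hF, ⟨k, hkz, ?_⟩, hF2⟩
      filter_upwards [Metric.ball_mem_nhds z hρ0] with z' hz'
      refine hF1 z' ?_
      have := dist_triangle z' z c
      rw [Metric.mem_ball] at hz'
      linarith
    rw [dist_comm] at hcz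
    exact ⟨key z w hc hcz, key w z hc.symm (hc ▸ hcz)⟩
  have htrans : ∀ x y z, x ∈ U → y ∈ U → z ∈ U → P x y → P y z → P x z := by
    rintro x y z - - - ⟨F, hF, ⟨k, hk, hFk⟩, hFq⟩ ⟨G, hG, ⟨l, hl, hGl⟩, hGq⟩
    refine ⟨_, hG.comp hF, ⟨l * k, by rw [mul_smul, hk, hl], ?_⟩, ?_⟩
    · have h1 : Tendsto (fun z' : ℍ => k • z') (𝓝 x) (𝓝 y) := by
        rw [← hk]; exact (continuous_const_smul k).tendsto x
      filter_upwards [hFk, h1.eventually hGl] with z' h2 h3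
      rw [h2, h3, mul_smul]
    · filter_upwards [hFq, hGq] with z' h2 h3
      rw [h2, h3]
  have hpU : p ∈ U := hpq
  have hapU : a • p ∈ U := by
    change ¬ X.proj (a • p) = X.proj q
    rwa [X.proj_smul ha]
  obtain ⟨F, hF, ⟨k, hk, hFk⟩, hFq⟩ := hUp.induction₂' P hstep htrans hpU hapU
  -- a last twist corrects the rotational part
  obtain ⟨ρ, hρ0, hρ, haway⟩ := hrad _ hapU
  obtain ⟨G, hG, hG1, hG2⟩ := X.exists_twist_away hr hρ0 hρ (k := a * k⁻¹) (c := a • p) (q := q)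
    (by rw [mul_smul, ← hk, inv_smul_smul, hk]) (haway _ (by rwa [dist_self]))
  refine ⟨_, hG.comp hF, ?_, ?_⟩
  · have h1 : Tendsto (fun z' : ℍ => k • z') (𝓝 p) (𝓝 (a • p)) := by
      rw [← hk]; exact (continuous_const_smul k).tendsto p
    filter_upwards [hFk, h1.eventually (Metric.ball_mem_nhds _ (by linarith : 0 < 2 * ρ))]
      with z' h2 h3
    rw [h2, hG1 _ h3, mul_smul, inv_smul_smul]
  · filter_upwards [hFq, hG2] with z' h2 h3
    rw [h2, h3]

/-- An equivariant map isotopic to the identity that acts near two given points as two given covering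
transformations. -/
theorem exists_double_push [CompactSpace S] {p q : ℍ} (hpq : X.proj p ≠ X.proj q) {a b : SL(2, ℝ)}
    (ha : a ∈ X.matrixGroup) (hb : b ∈ X.matrixGroup) :
    ∃ F, EquivariantlyIsotopicToId X.matrixGroup F ∧ (∀ᶠ z in 𝓝 p, F z = a • z) ∧
      ∀ᶠ z in 𝓝 q, F z = b • z := by
  obtain ⟨F, hF, hFp, hFq⟩ := X.exists_push hpq ha
  obtain ⟨G, hG, hGq, hGp⟩ := X.exists_push hpq.symm hb
  refine ⟨_, hF.comp hG, ?_, ?_⟩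
  · filter_upwards [hFp, hGp] with z h1 h2
    rw [h2, h1]
  · filter_upwards [hFq, hGq] with z h1 h2
    rw [h2, hF.comm hb, h1]

end HyperbolicSurface

end

/-! ### Coding by the shift -/

noncomputable section

/-- The point of a symmetric Cantor set in `[0, 1]`, of ratio `ε`, with a given address. -/
def cantorPoint (ε : ℝ) (u : ℕ → Bool) : ℝ := ∑' n, if u n then (1 - ε) * ε ^ n else 0

section CantorPoint

variable {ε : ℝ}

theorem cantorPoint_bound (h0 : 0 < ε) (h1 : ε < 1 / 2) (u : ℕ → Bool) (n : ℕ) :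
    0 ≤ (if u n then (1 - ε) * ε ^ n else 0) ∧
      (if u n then (1 - ε) * ε ^ n else 0) ≤ (1 - ε) * ε ^ n := by
  have : 0 ≤ (1 - ε) * ε ^ n := mul_nonneg (by linarith) (by positivity)
  split_ifs
  · exact ⟨this, le_rfl⟩
  · exact ⟨le_rfl, this⟩

theorem hasSum_cantorBound (h0 : 0 < ε) (h1 : ε < 1 / 2) :
    HasSum (fun n : ℕ => (1 - ε) * ε ^ n) 1 := by
  have := (hasSum_geometric_of_lt_one h0.le (by linarith : ε < 1)).mul_left (1 - ε)
  rwa [mul_inv_cancel₀ (by linarith)] at this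

theorem summable_cantorPoint (h0 : 0 < ε) (h1 : ε < 1 / 2) (u : ℕ → Bool) :
    Summable fun n : ℕ => if u n then (1 - ε) * ε ^ n else 0 :=
  (hasSum_cantorBound h0 h1).summable.of_nonneg_of_le (fun n => (cantorPoint_bound h0 h1 u n).1)
    fun n => (cantorPoint_bound h0 h1 u n).2

theorem cantorPoint_mem (h0 : 0 < ε) (h1 : ε < 1 / 2) (u : ℕ → Bool) :
    cantorPoint ε u ∈ Set.Icc (0 : ℝ) 1 := by
  refine ⟨tsum_nonneg fun n => (cantorPoint_bound h0 h1 u n).1, ?_⟩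
  rw [← (hasSum_cantorBound h0 h1).tsum_eq]
  exact (summable_cantorPoint h0 h1 u).tsum_le_tsum (fun n => (cantorPoint_bound h0 h1 u n).2)
    (hasSum_cantorBound h0 h1).summable

theorem continuous_cantorPoint (h0 : 0 < ε) (h1 : ε < 1 / 2) : Continuous (cantorPoint ε) := by
  refine continuous_tsum (fun n => ?_) (hasSum_cantorBound h0 h1).summable fun n u => ?_
  · exact (continuous_of_discreteTopology
      (f := fun b : Bool => if b then (1 - ε) * ε ^ n else 0)).comp (continuous_apply n)
  · rw [Real.norm_of_nonneg (cantorPoint_bound h0 h1 u n).1]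
    exact (cantorPoint_bound h0 h1 u n).2

theorem cantorPoint_succ (h0 : 0 < ε) (h1 : ε < 1 / 2) (u : ℕ → Bool) :
    cantorPoint ε u = (if u 0 then 1 - ε else 0) + ε * cantorPoint ε fun n => u (n + 1) := by
  unfold cantorPoint
  rw [(summable_cantorPoint h0 h1 u).tsum_eq_zero_add, ← tsum_mul_left, pow_zero, mul_one]
  congr 1
  refine tsum_congr fun n => ?_
  split_ifs <;> ring

theorem cantorPoint_injective (h0 : 0 < ε) (h1 : ε < 1 / 2) :
    Function.Injective (cantorPoint ε) := by
  intro u v h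
  have key : ∀ u v : ℕ → Bool, cantorPoint ε u = cantorPoint ε v → u 0 = v 0 ∧
      cantorPoint ε (fun n => u (n + 1)) = cantorPoint ε fun n => v (n + 1) := by
    intro u v h
    rw [cantorPoint_succ h0 h1 u, cantorPoint_succ h0 h1 v] at h
    obtain ⟨hu0, hu1⟩ := cantorPoint_mem h0 h1 fun n => u (n + 1)
    obtain ⟨hv0, hv1⟩ := cantorPoint_mem h0 h1 fun n => v (n + 1)
    rcases hu : u 0 with _ | _ <;> rcases hv : v 0 with _ | _ <;>
      simp only [hu, hv, if_true, Bool.false_eq_true, if_false] at h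
    · exact ⟨rfl, mul_left_cancel₀ h0.ne' (by linarith)⟩
    · nlinarith
    · nlinarith
    · exact ⟨rfl, mul_left_cancel₀ h0.ne' (by linarith)⟩
  funext n
  induction n generalizing u v with
  | zero => exact (key u v h).1
  | succ n ih => exact ih (key u v h).2

end CantorPoint

/-- The plane coordinates of the point of the invariant Cantor set of a horseshoe with a given
itinerary. -/
def horseshoePoint (ε : ℝ) (x : ℤ → Bool) : ℝ × ℝ :=
  (cantorPoint ε fun n => x n, cantorPoint ε fun n => x (-1 - n))

section HorseshoePoint

variable {ε : ℝ}

theorem continuous_horseshoePoint (h0 : 0 < ε) (h1 : ε < 1 / 2) :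
    Continuous (horseshoePoint ε) := by
  refine Continuous.prodMk ((continuous_cantorPoint h0 h1).comp ?_)
    ((continuous_cantorPoint h0 h1).comp ?_) <;> fun_prop

theorem horseshoePoint_injective (h0 : 0 < ε) (h1 : ε < 1 / 2) :
    Function.Injective (horseshoePoint ε) := by
  intro x y h
  obtain ⟨h2, h3⟩ := Prod.mk.inj h
  have h2 := cantorPoint_injective h0 h1 h2
  have h3 := cantorPoint_injective h0 h1 h3
  funext k
  rcases le_or_gt 0 k with hk | hk
  · have := congrFun h2 k.toNat
    simpa only [Int.toNat_of_nonneg hk] using this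
  · have := congrFun h3 (-1 - k).toNat
    simpa only [Int.toNat_of_nonneg (by omega : 0 ≤ -1 - k), sub_sub_cancel] using this

theorem horseshoePoint_fst (h0 : 0 < ε) (h1 : ε < 1 / 2) (x : ℤ → Bool) :
    (horseshoePoint ε x).1 = (if x 0 then 1 - ε else 0) + ε * (horseshoePoint ε (shift x)).1 := by
  simp only [horseshoePoint, shift_apply]
  rw [cantorPoint_succ h0 h1]
  simp only [Nat.cast_zero, Nat.cast_add, Nat.cast_one]

theorem horseshoePoint_shift_snd (h0 : 0 < ε) (h1 : ε < 1 / 2) (x : ℤ → Bool) :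
    (horseshoePoint ε (shift x)).2 = (if x 0 then 1 - ε else 0) + ε * (horseshoePoint ε x).2 := by
  simp only [horseshoePoint, shift_apply]
  rw [cantorPoint_succ h0 h1]
  simp only [Nat.cast_zero, Nat.cast_add, Nat.cast_one]
  congr 3
  funext n
  congr 1
  ring

end HorseshoePoint

namespace HyperbolicSurface

variable {S : Type*} [MetricSpace S] (X : HyperbolicSurface S)

/-- A horseshoe whose two legs travel along given covering transformations: the map `F` has an
invariant Cantor set in the surface, on which it is conjugate to the shift, and `F` maps the lift
with itinerary `x` to the lift with itinerary `shift x`, moved by the covering transformation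
`A (x 0)`. -/
theorem exists_coding [CompactSpace S] {A : Bool → SL(2, ℝ)} (hA : ∀ b, A b ∈ X.matrixGroup) :
    ∃ (F : ℍ → ℍ) (Θ : (ℤ → Bool) → ℍ), EquivariantlyIsotopicToId X.matrixGroup F ∧ Continuous Θ ∧
      Function.Injective (fun x => X.proj (Θ x)) ∧ ∀ x, F (Θ x) = A (x 0) • Θ (shift x) := by
  obtain ⟨r, hr0, hr⟩ := X.exists_pos_displacement
  obtain ⟨η, hη, hsq⟩ := exists_chart_small (show 0 < r / 4 by linarith)
  set κ := halfPlaneChart η hη with hκ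
  have hinj : ∀ v ∈ supportSquare, ∀ w ∈ supportSquare, X.proj (κ v) = X.proj (κ w) → v = w := by
    intro v hv w hw h
    obtain ⟨g, hg, hgv⟩ := X.proj_eq_iff.mp h
    have h1 := hr g hg (κ v) (by
      rw [hgv]
      have := dist_triangle_right (κ v) (κ w) UpperHalfPlane.I
      linarith [hsq v hv, hsq w hw]) (κ v)
    exact κ.injective (h1.symm.trans hgv)
  have h00 : ((0 : ℝ), (0 : ℝ)) ∈ supportSquare :=
    ⟨⟨by norm_num, by norm_num⟩, by norm_num, by norm_num⟩
  have h11 : ((1 : ℝ), (1 : ℝ)) ∈ supportSquare :=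
    ⟨⟨by norm_num, by norm_num⟩, by norm_num, by norm_num⟩
  obtain ⟨P, hP, hPp, hPq⟩ := X.exists_double_push (p := κ (0, 0)) (q := κ (1, 1))
    (fun h => zero_ne_one (congrArg Prod.fst (hinj _ h00 _ h11 h))) (hA false) (hA true)
  -- small squares at two opposite corners are pushed rigidly
  obtain ⟨ε, hε0, hε1, hεp, hεq⟩ : ∃ ε : ℝ, 0 < ε ∧ ε < 1 / 2 ∧
      (∀ x ∈ Set.Icc 0 ε, ∀ y ∈ Set.Icc 0 ε, P (κ (x, y)) = A false • κ (x, y)) ∧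
      ∀ x ∈ Set.Icc (1 - ε) 1, ∀ y ∈ Set.Icc (1 - ε) 1, P (κ (x, y)) = A true • κ (x, y) := by
    obtain ⟨δ, hδ, h1⟩ := Metric.eventually_nhds_iff_ball.mp
      ((κ.continuous.tendsto (0, 0)).eventually hPp)
    obtain ⟨δ', hδ', h2⟩ := Metric.eventually_nhds_iff_ball.mp
      ((κ.continuous.tendsto (1, 1)).eventually hPq)
    have e1 := min_le_left (1 / 3) (min (δ / 2) (δ' / 2))
    have e2 := (min_le_right (1 / 3) (min (δ / 2) (δ' / 2))).trans (min_le_left _ _)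
    have e3 := (min_le_right (1 / 3) (min (δ / 2) (δ' / 2))).trans (min_le_right _ _)
    refine ⟨min (1 / 3) (min (δ / 2) (δ' / 2)), by positivity, by linarith,
      fun x hx y hy => h1 _ ?_, fun x hx y hy => h2 _ ?_⟩
    · rw [Metric.mem_ball, Prod.dist_eq, max_lt_iff, Real.dist_eq, Real.dist_eq, abs_lt, abs_lt]
      exact ⟨⟨by linarith [hx.1], by linarith [hx.2]⟩, by linarith [hy.1], by linarith [hy.2]⟩
    · rw [Metric.mem_ball, Prod.dist_eq, max_lt_iff, Real.dist_eq, Real.dist_eq, abs_lt, abs_lt]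
      exact ⟨⟨by linarith [hx.1], by linarith [hx.2]⟩, by linarith [hy.1], by linarith [hy.2]⟩
  obtain ⟨F, G, hF, hG, hF0, hF1, hG0, hG1⟩ := X.exists_horseshoe hr hr0 hη hsq hε0 hε1
  have hmem : ∀ x, horseshoePoint ε x ∈ supportSquare := by
    intro x
    have h1 : (horseshoePoint ε x).1 ∈ Set.Icc (0 : ℝ) 1 := cantorPoint_mem hε0 hε1 _
    have h2 : (horseshoePoint ε x).2 ∈ Set.Icc (0 : ℝ) 1 := cantorPoint_mem hε0 hε1 _
    exact ⟨⟨by linarith [h1.1], by linarith [h1.2]⟩, by linarith [h2.1], by linarith [h2.2]⟩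
  refine ⟨fun z => G (P (F z)), fun x => κ (horseshoePoint ε x), hG.comp (hP.comp hF),
    κ.continuous.comp (continuous_horseshoePoint hε0 hε1),
    fun x y h => horseshoePoint_injective hε0 hε1 (hinj _ (hmem x) _ (hmem y) h), fun x => ?_⟩
  have e1 := horseshoePoint_fst hε0 hε1 x
  have e2 := horseshoePoint_shift_snd hε0 hε1 x
  obtain ⟨hv1, hv2⟩ : (horseshoePoint ε x).1 ∈ Set.Icc (0 : ℝ) 1 ∧
      (horseshoePoint ε x).2 ∈ Set.Icc (0 : ℝ) 1 :=
    ⟨cantorPoint_mem hε0 hε1 _, cantorPoint_mem hε0 hε1 _⟩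
  obtain ⟨hw1, hw2⟩ : (horseshoePoint ε (shift x)).1 ∈ Set.Icc (0 : ℝ) 1 ∧
      (horseshoePoint ε (shift x)).2 ∈ Set.Icc (0 : ℝ) 1 :=
    ⟨cantorPoint_mem hε0 hε1 _, cantorPoint_mem hε0 hε1 _⟩
  dsimp only
  generalize horseshoePoint ε x = v at e1 e2 hv1 hv2 ⊢
  generalize horseshoePoint ε (shift x) = w at e1 e2 hw1 hw2 ⊢
  obtain ⟨v1, v2⟩ := v
  obtain ⟨w1, w2⟩ := w
  dsimp only at e1 e2 hv1 hv2 hw1 hw2 ⊢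
  rcases hx : x 0 with _ | _
  · simp only [hx, Bool.false_eq_true, if_false, zero_add] at e1 e2
    have m1 : v1 ∈ Set.Icc 0 ε := ⟨hv1.1, by rw [e1]; nlinarith [hw1.2]⟩
    have m2 : w2 ∈ Set.Icc 0 ε := ⟨hw2.1, by rw [e2]; nlinarith [hv2.2]⟩
    rw [hF0 v1 m1 v2 hv2, ← e2, hεp v1 m1 w2 m2, hG.comm (hA false), e1, hG0 w2 m2 w1 hw1]
  · simp only [hx, if_true] at e1 e2
    have m1 : v1 ∈ Set.Icc (1 - ε) 1 := ⟨by rw [e1]; nlinarith [hw1.1], hv1.2⟩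
    have m2 : w2 ∈ Set.Icc (1 - ε) 1 := ⟨by rw [e2]; nlinarith [hv2.1], hw2.2⟩
    rw [hF1 v1 m1 v2 hv2, ← e2, hεq v1 m1 w2 m2, hG.comm (hA true), e1, hG1 w2 m2 w1 hw1]

end HyperbolicSurface

end

/-! ### Framed horseshoes and tracking -/

noncomputable section

/-- The geodesic of `ℍ` determined by a frame, parametrized by arc length: the image of the imaginary
axis under the matrix `A`. -/
def geodesicLine (A : SL(2, ℝ)) (t : ℝ) : ℍ := (A * SL2.diag t) • UpperHalfPlane.I

theorem dist_geodesicLine (A : SL(2, ℝ)) (s t : ℝ) :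
    dist (geodesicLine A s) (geodesicLine A t) = |s - t| := by
  rw [geodesicLine, geodesicLine, mul_smul, mul_smul, dist_smul, SL2.dist_diag_smul_I]

theorem isometry_geodesicLine (A : SL(2, ℝ)) : Isometry (geodesicLine A) :=
  Isometry.of_dist_eq fun s t => by rw [dist_geodesicLine, Real.dist_eq]

theorem smul_geodesicLine (g A : SL(2, ℝ)) (t : ℝ) :
    g • geodesicLine A t = geodesicLine (g * A) t := by
  rw [geodesicLine, geodesicLine, ← mul_smul, mul_assoc]

theorem geodesicLine_zero (A : SL(2, ℝ)) : geodesicLine A 0 = A • UpperHalfPlane.I := by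
  rw [geodesicLine, SL2.diag_zero, mul_one]

namespace HyperbolicSurface

variable {S : Type*} [MetricSpace S] {X : HyperbolicSurface S} {f : S ≃ₜ S} {F : ℍ ≃ₜ ℍ}

theorem isGeodesic_proj_geodesicLine (X : HyperbolicSurface S) (A : SL(2, ℝ)) :
    IsGeodesic fun t => X.proj (geodesicLine A t) := by
  intro t
  obtain ⟨r, hr, h⟩ := X.locally_isometric (geodesicLine A t)
  have hball : ∀ s ∈ Metric.ball t r, geodesicLine A s ∈ Metric.ball (geodesicLine A t) r := by
    intro s hs
    rwa [Metric.mem_ball, (isometry_geodesicLine A).dist_eq]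
  exact ⟨r, hr, fun s hs s' hs' => by
    rw [h _ (hball s hs) _ (hball s' hs'), (isometry_geodesicLine A).dist_eq]⟩

theorem IsPreferredLift.iterate_smul (hF : X.IsPreferredLift f F) {g : SL(2, ℝ)}
    (hg : g ∈ X.matrixGroup) (n : ℕ) (z : ℍ) : F^[n] (g • z) = g • F^[n] z :=
  hF.iterate_comm (φ := MulAction.toPermHom SL(2, ℝ) ℍ g) hg n z

theorem IsPreferredLift.symm_iterate_smul (hF : X.IsPreferredLift f F) {g : SL(2, ℝ)}
    (hg : g ∈ X.matrixGroup) (n : ℕ) (z : ℍ) : F.symm^[n] (g • z) = g • F.symm^[n] z := by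
  have h : Function.LeftInverse F^[n] F.symm^[n] := Function.LeftInverse.iterate F.apply_symm_apply n
  refine (F.injective.iterate n) ?_
  rw [hF.iterate_smul hg, h, h]

theorem IsPreferredLift.proj_symm_iterate (hF : X.IsPreferredLift f F) (n : ℕ) (z : ℍ) :
    X.proj (F.symm^[n] z) = f.symm^[n] (X.proj z) := by
  have h : Function.Semiconj X.proj F.symm f.symm := fun z => by
    rw [← f.injective.eq_iff, ← hF.lift, F.apply_symm_apply, f.apply_symm_apply]
  exact h.iterate_right n z

theorem Tracks.smul (hF : X.IsPreferredLift f F) {g : SL(2, ℝ)} (hg : g ∈ X.matrixGroup)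
    {z : ℍ} {γ : ℝ → ℍ} {v : ℝ} (h : Tracks F z γ v) : Tracks F (g • z) (fun t => g • γ t) v := by
  refine ⟨?_, ?_⟩
  · simpa only [hF.iterate_smul hg, dist_smul] using h.1
  · simpa only [hF.symm_iterate_smul hg, dist_smul] using h.2

end HyperbolicSurface

theorem tendsto_of_abs_sub_le {a b : ℕ → ℝ} {K v : ℝ} (hab : ∀ n, |a n - b n| ≤ K)
    (hb : Tendsto (fun n : ℕ => b n / n) atTop (𝓝 v)) :
    Tendsto (fun n : ℕ => 1 / (n : ℝ) * a n) atTop (𝓝 v) := by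
  have h0 : Tendsto (fun n : ℕ => (a n - b n) / n) atTop (𝓝 0) := by
    refine squeeze_zero_norm (a := fun n : ℕ => K / n) (fun n => ?_)
      (tendsto_const_div_atTop_nhds_zero_nat K)
    rw [norm_div, Real.norm_eq_abs, Real.norm_of_nonneg (Nat.cast_nonneg n)]
    exact div_le_div_of_nonneg_right (hab n) (Nat.cast_nonneg n)
  have := h0.add hb
  rw [zero_add] at this
  refine this.congr fun n => ?_
  ring

theorem tendsto_abs_sub_mul_div {b : ℕ → ℝ} {v : ℝ}
    (hb : Tendsto (fun n : ℕ => b n / n) atTop (𝓝 v)) :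
    Tendsto (fun n : ℕ => |b n - n * v| / n) atTop (𝓝 0) := by
  have h := (hb.sub_const v).abs
  rw [sub_self, abs_zero] at h
  refine h.congr' ?_
  filter_upwards [eventually_gt_atTop 0] with n hn
  have hn' : (0 : ℝ) < n := Nat.cast_pos.mpr hn
  rw [← abs_of_pos hn', ← abs_div, abs_of_pos hn', sub_div, mul_div_cancel_left₀ _ hn'.ne']

theorem birkhoffSum_shift_symm_iterate (τ : (ℤ → Bool) → ℝ) (n : ℕ) (x : ℤ → Bool) :
    birkhoffSum shift τ n (shift.symm^[n] x) =
      birkhoffSum shift.symm (fun y => τ (shift.symm y)) n x := by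
  unfold birkhoffSum
  rw [← Finset.sum_range_reflect]
  refine Finset.sum_congr rfl fun k hk => ?_
  rw [Finset.mem_range] at hk
  congr 1
  funext j
  rw [shift_iterate_apply, shift_symm_iterate_apply, shift_symm_apply, shift_symm_iterate_apply]
  congr 1
  omega

/-- A two-sided Cantor set of points whose images under the preferred lift `F` follow geodesics. The
points are indexed by sequences of two symbols. To each sequence there corresponds a frame, that is,
a geodesic with an origin; `F` maps the point of a sequence to the point of the shifted sequence, up
to a covering transformation, which moves the frame forward along its geodesic. -/
structure FramedHorseshoe {S : Type*} [MetricSpace S] (X : HyperbolicSurface S) (f : S ≃ₜ S)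
    (F : ℍ ≃ₜ ℍ) where
  /-- the points of the Cantor set -/
  point : (ℤ → Bool) → ℍ
  /-- the frames -/
  frame : (ℤ → Bool) → SL(2, ℝ)
  /-- the distance by which the frames move in one step -/
  time : (ℤ → Bool) → ℝ
  /-- the coordinates in which the forward end points of the geodesics are compared -/
  base : SL(2, ℝ)
  isPreferredLift : X.IsPreferredLift f F
  continuous_point : Continuous point
  continuous_frame : Continuous frame
  continuous_time : Continuous time
  proj_injective : Function.Injective fun x => X.proj (point x)
  log_two_le_time : ∀ x, Real.log 2 ≤ time x
  transition_mem : ∀ x, frame x * SL2.diag (time x) * (frame (shift x))⁻¹ ∈ X.matrixGroup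
  map_point : ∀ x,
    F (point x) = (frame x * SL2.diag (time x) * (frame (shift x))⁻¹) • point (shift x)
  frame_zero_zero : ∀ x, (base⁻¹ * frame x) 0 0 = 1
  forward_eq : ∀ x y, (base⁻¹ * frame x) 1 0 = (base⁻¹ * frame y) 1 0 → ∀ n : ℕ, x n = y n

namespace FramedHorseshoe

variable {S : Type*} [MetricSpace S] {X : HyperbolicSurface S} {f : S ≃ₜ S} {F : ℍ ≃ₜ ℍ}

/-- Every closed hyperbolic surface has a homeomorphism, isotopic to the identity, with a framed
horseshoe. -/
theorem exists_framedHorseshoe [CompactSpace S] (X : HyperbolicSurface S) :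
    ∃ (f : S ≃ₜ S) (F : ℍ ≃ₜ ℍ), IsIsotopicToId f ∧ Nonempty (FramedHorseshoe X f F) := by
  obtain ⟨r, hr0, hr⟩ := X.exists_pos_displacement
  have hΓ : IsFreeCocompact X.matrixGroup :=
    ⟨fun g hg => X.neg_mem_matrixGroup hg, ⟨r, hr0, hr⟩, X.exists_dist_le⟩
  obtain ⟨C, M, hCM, hM, hdis⟩ := hΓ.exists_expanding
  obtain ⟨m, τ, G, -, hτc, hGc, hm, hτ, hmeq, hG, hMG⟩ := exists_frames hM
  obtain ⟨F₀, Θ, hF₀, hΘ, hinj, hmap⟩ := X.exists_coding hCM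
  obtain ⟨f, F, hf, hF, rfl⟩ := X.exists_isPreferredLift hF₀
  have htrans : ∀ x, C * G x * SL2.diag (τ x) * (C * G (shift x))⁻¹ = C * M (x 0) * C⁻¹ := by
    intro x
    rw [mul_assoc C, ← hMG]
    group
  have hbase : ∀ x, C⁻¹ * (C * G x) = G x := fun x => inv_mul_cancel_left _ _
  refine ⟨f, F, hf, ⟨⟨Θ, fun x => C * G x, τ, C, hF, hΘ, continuous_const.mul hGc, hτc, hinj, hτ,
    fun x => ?_, fun x => ?_, fun x => ?_, fun x y h => ?_⟩⟩⟩
  · rw [htrans]; exact hCM _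
  · rw [htrans]; exact hmap x
  · rw [hbase]; exact (hG x).1
  · rw [hbase, hbase, (hG x).2, (hG y).2] at h
    exact forward_eq_of_slope_eq hM hdis hm hmeq h

variable (h : FramedHorseshoe X f F)

/-- The displacement of the frame of `x` in `n` steps. -/
def timeSum (n : ℕ) (x : ℤ → Bool) : ℝ := birkhoffSum shift h.time n x

theorem timeSum_nonneg (n : ℕ) (x : ℤ → Bool) : 0 ≤ h.timeSum n x := by
  unfold timeSum birkhoffSum
  exact Finset.sum_nonneg fun k _ =>
    (Real.log_nonneg one_le_two).trans (h.log_two_le_time (shift^[k] x))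

/-- The covering transformation that relates the frames of a sequence and of its `n`-th shift. -/
def transition (n : ℕ) (x : ℤ → Bool) : SL(2, ℝ) :=
  h.frame x * SL2.diag (h.timeSum n x) * (h.frame (shift^[n] x))⁻¹

theorem transition_succ (n : ℕ) (x : ℤ → Bool) :
    h.transition (n + 1) x = h.transition n x * (h.frame (shift^[n] x) *
      SL2.diag (h.time (shift^[n] x)) * (h.frame (shift (shift^[n] x)))⁻¹) := by
  rw [transition, transition, timeSum, birkhoffSum_succ, SL2.diag_add,
    Function.iterate_succ_apply', timeSum]
  group

theorem transition_zero (x : ℤ → Bool) : h.transition 0 x = 1 := by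
  rw [transition, timeSum, birkhoffSum_zero, SL2.diag_zero, mul_one, Function.iterate_zero, id,
    mul_inv_cancel]

theorem iterated_transition_mem (n : ℕ) (x : ℤ → Bool) : h.transition n x ∈ X.matrixGroup := by
  induction n with
  | zero => rw [transition_zero]; exact one_mem _
  | succ n ih => rw [transition_succ]; exact mul_mem ih (h.transition_mem _)

theorem iterate_point (n : ℕ) (x : ℤ → Bool) :
    F^[n] (h.point x) = h.transition n x • h.point (shift^[n] x) := by
  induction n with
  | zero => rw [transition_zero, one_smul, Function.iterate_zero, Function.iterate_zero, id, id]
  | succ n ih =>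
    have h1 := h.isPreferredLift.iterate_smul (h.iterated_transition_mem n x) 1
      (h.point (shift^[n] x))
    rw [Function.iterate_one] at h1
    rw [Function.iterate_succ_apply', ih, h1, h.map_point, transition_succ,
      mul_smul (h.transition n x), Function.iterate_succ_apply']

theorem transition_smul_geodesicLine (n : ℕ) (x : ℤ → Bool) (t : ℝ) :
    h.transition n x • geodesicLine (h.frame (shift^[n] x)) t =
      geodesicLine (h.frame x) (h.timeSum n x + t) := by
  rw [smul_geodesicLine, transition, geodesicLine, geodesicLine, SL2.diag_add, inv_mul_cancel_right,
    mul_assoc]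

theorem dist_iterate (n : ℕ) (x : ℤ → Bool) :
    dist (F^[n] (h.point x)) (geodesicLine (h.frame x) (h.timeSum n x)) =
      dist (h.point (shift^[n] x)) (geodesicLine (h.frame (shift^[n] x)) 0) := by
  have h1 := h.transition_smul_geodesicLine n x 0
  rw [add_zero] at h1
  rw [← h1, h.iterate_point, dist_smul]

theorem dist_symm_iterate (n : ℕ) (x : ℤ → Bool) :
    dist (F.symm^[n] (h.point x))
        (geodesicLine (h.frame x) (-h.timeSum n (shift.symm^[n] x))) =
      dist (h.point (shift.symm^[n] x)) (geodesicLine (h.frame (shift.symm^[n] x)) 0) := by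
  set y := shift.symm^[n] x with hy
  have hxy : shift^[n] y = x := Function.LeftInverse.iterate shift.apply_symm_apply n x
  have h1 := h.transition_smul_geodesicLine n y (-h.timeSum n y)
  rw [hxy, add_neg_cancel] at h1
  have h2 := h.iterate_point n y
  rw [hxy] at h2
  have h3 : F.symm^[n] (F^[n] (h.point y)) = h.point y :=
    Function.LeftInverse.iterate F.symm_apply_apply n _
  rw [h2, h.isPreferredLift.symm_iterate_smul (h.iterated_transition_mem n y)] at h3
  rw [← h3, ← h1, dist_smul]

theorem exists_dist_le : ∃ K, ∀ x, dist (h.point x) (geodesicLine (h.frame x) 0) ≤ K := by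
  have hc : Continuous fun x => dist (h.point x) (geodesicLine (h.frame x) 0) := by
    simp only [geodesicLine_zero]
    exact h.continuous_point.dist (h.continuous_frame.smul continuous_const)
  obtain ⟨K, hK⟩ := (isCompact_range hc).bddAbove
  exact ⟨K, fun x => hK ⟨x, rfl⟩⟩

/-- A sequence is regular if its frames move in both directions with the mean speed `v`. -/
def IsRegular (v : ℝ) (x : ℤ → Bool) : Prop :=
  Tendsto (fun n : ℕ => h.timeSum n x / n) atTop (𝓝 v) ∧
    Tendsto (fun n : ℕ => h.timeSum n (shift.symm^[n] x) / n) atTop (𝓝 v)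

variable {h} {v : ℝ} {x : ℤ → Bool}

theorem IsRegular.tracks (hx : h.IsRegular v x) :
    HyperbolicSurface.Tracks F (h.point x) (geodesicLine (h.frame x)) v := by
  obtain ⟨K, hK⟩ := h.exists_dist_le
  refine ⟨tendsto_of_abs_sub_le (K := K) (fun n => ?_) (tendsto_abs_sub_mul_div hx.1),
    tendsto_of_abs_sub_le (K := K) (fun n => ?_) (tendsto_abs_sub_mul_div hx.2)⟩
  · rw [← dist_geodesicLine (h.frame x) (h.timeSum n x) (n * v)]
    refine (abs_dist_sub_le _ _ _).trans ?_
    rw [h.dist_iterate]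
    exact hK _
  · have h1 : |h.timeSum n (shift.symm^[n] x) - n * v| =
        |-h.timeSum n (shift.symm^[n] x) - -(n * v)| := by rw [← abs_neg]; congr 1; ring
    rw [h1, ← dist_geodesicLine (h.frame x) _ (-(n * v))]
    refine (abs_dist_sub_le _ _ _).trans ?_
    rw [h.dist_symm_iterate]
    exact hK _

theorem IsRegular.hasRotationSpeed (hx : h.IsRegular v x) :
    X.HasRotationSpeed f F (X.proj (h.point x)) v := by
  obtain ⟨K, hK⟩ := h.exists_dist_le
  have h0 : dist (h.point x) (geodesicLine (h.frame x) 0) ≤ K := hK x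
  refine ⟨tendsto_of_abs_sub_le (K := K + K) (fun n => ?_) hx.1,
    tendsto_of_abs_sub_le (K := K + K) (fun n => ?_) hx.2⟩
  · have h1 : h.timeSum n x =
        dist (geodesicLine (h.frame x) 0) (geodesicLine (h.frame x) (h.timeSum n x)) := by
      rw [dist_geodesicLine, zero_sub, abs_neg, abs_of_nonneg (h.timeSum_nonneg n x)]
    rw [X.rotationDistance_proj h.isPreferredLift, h1, ← Real.dist_eq]
    refine (dist_dist_dist_le _ _ _ _).trans (add_le_add h0 ?_)
    rw [h.dist_iterate]
    exact hK _
  · have h1 : h.timeSum n (shift.symm^[n] x) = dist (geodesicLine (h.frame x)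
        (-h.timeSum n (shift.symm^[n] x))) (geodesicLine (h.frame x) 0) := by
      rw [dist_geodesicLine, sub_zero, abs_neg, abs_of_nonneg (h.timeSum_nonneg n _)]
    have h2 : F^[n] (F.symm^[n] (h.point x)) = h.point x :=
      Function.LeftInverse.iterate F.apply_symm_apply n _
    rw [← h.isPreferredLift.proj_symm_iterate, X.rotationDistance_proj h.isPreferredLift, h2, h1,
      ← Real.dist_eq]
    refine (dist_dist_dist_le _ _ _ _).trans (add_le_add ?_ h0)
    rw [h.dist_symm_iterate]
    exact hK _

theorem IsRegular.isTrackingGeodesic (hv : 0 < v) (hx : h.IsRegular v x) :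
    X.IsTrackingGeodesic f F (X.proj (h.point x)) fun t => X.proj (geodesicLine (h.frame x) t) := by
  refine ⟨X.isGeodesic_proj_geodesicLine _, v, hv, hx.hasRotationSpeed, fun z hz => ?_⟩
  obtain ⟨g, hg, rfl⟩ := X.proj_eq_iff.mp hz.symm
  refine ⟨fun t => g • geodesicLine (h.frame x) t, ⟨?_, fun t => X.proj_smul hg _⟩,
    hx.tracks.smul h.isPreferredLift hg⟩
  exact (isometry_geodesicLine _).continuous.const_smul g

variable (h)

/-- The mean displacement of the frames. -/
def meanTime : ℝ := ∫ x, h.time x ∂coinTosses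

theorem integrable_time : Integrable h.time coinTosses := by
  obtain ⟨K, hK⟩ := (isCompact_range h.continuous_time).isBounded.exists_norm_le
  exact Integrable.of_bound h.continuous_time.aestronglyMeasurable K
    (ae_of_all _ fun x => hK _ ⟨x, rfl⟩)

theorem meanTime_pos : 0 < h.meanTime := by
  have h1 : ∫ _ : ℤ → Bool, Real.log 2 ∂coinTosses ≤ h.meanTime :=
    integral_mono (integrable_const _) h.integrable_time h.log_two_le_time
  rw [integral_const, probReal_univ, one_smul] at h1
  exact (Real.log_pos one_lt_two).trans_le h1

theorem ae_isRegular : ∀ᵐ x ∂coinTosses, h.IsRegular h.meanTime x := by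
  have e1 := ergodic_shift.ae_tendsto_birkhoffSum_div h.continuous_time.measurable h.integrable_time
  have hsymm : Ergodic shift.symm coinTosses :=
    Ergodic.symm (e := shift.toMeasurableEquiv) ergodic_shift
  have hmp := hsymm.toMeasurePreserving
  have e2 := hsymm.ae_tendsto_birkhoffSum_div (f := fun y => h.time (shift.symm y))
    (h.continuous_time.measurable.comp shift.symm.continuous.measurable)
    (hmp.integrable_comp_of_integrable h.integrable_time)
  have h3 : ∫ y, h.time (shift.symm y) ∂coinTosses = h.meanTime :=
    hmp.integral_comp shift.symm.measurableEmbedding h.time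
  filter_upwards [e1, e2] with x h1 h2
  refine ⟨h1, ?_⟩
  rw [h3] at h2
  simpa only [timeSum, birkhoffSum_shift_symm_iterate] using h2

/-- The image in the surface of the coin tossing measure on sequences. -/
def measure [MeasurableSpace S] : Measure S := coinTosses.map fun x => X.proj (h.point x)

theorem continuous_proj_point : Continuous fun x => X.proj (h.point x) :=
  X.continuous_proj.comp h.continuous_point

theorem measurableEmbedding [MeasurableSpace S] [BorelSpace S] :
    MeasurableEmbedding fun x => X.proj (h.point x) :=
  (h.continuous_proj_point.isClosedEmbedding h.proj_injective).measurableEmbedding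

theorem ae_measure_iff [MeasurableSpace S] [BorelSpace S] {p : S → Prop} :
    (∀ᵐ s ∂h.measure, p s) ↔ ∀ᵐ x ∂coinTosses, p (X.proj (h.point x)) :=
  h.measurableEmbedding.ae_map_iff

theorem isErgodicPos [MeasurableSpace S] [BorelSpace S] : X.IsErgodicPos f F h.measure := by
  have hm : Measurable fun x => X.proj (h.point x) := h.continuous_proj_point.measurable
  refine ⟨Measure.isProbabilityMeasure_map hm.aemeasurable, ?_, h.meanTime, h.meanTime_pos, ?_⟩
  · refine MeasurePreserving.ergodic_of_ergodic_semiconj (g := fun x => X.proj (h.point x)) ⟨hm, rfl⟩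
      ergodic_shift f.continuous.measurable fun x => ?_
    rw [← h.isPreferredLift.lift, h.map_point, X.proj_smul (h.transition_mem x)]
  · rw [ae_measure_iff]
    filter_upwards [h.ae_isRegular] with x hx
    exact hx.hasRotationSpeed

end FramedHorseshoe

end

/-! ### Normalization of tracking geodesics -/

noncomputable section

/-- A path that is locally isometric is `1`-Lipschitz. -/
theorem dist_le_of_locally_isometric {Y : Type*} [PseudoMetricSpace Y] {γ : ℝ → Y}
    (hγ : ∀ t, ∃ ε > 0, ∀ s ∈ Metric.ball t ε, ∀ s' ∈ Metric.ball t ε, dist (γ s) (γ s') = dist s s')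
    (s t : ℝ) : dist (γ s) (γ t) ≤ |s - t| := by
  have hc : Continuous γ := by
    rw [Metric.continuous_iff]
    intro t e he
    obtain ⟨ε, hε, h⟩ := hγ t
    refine ⟨min ε e, lt_min hε he, fun s hs => ?_⟩
    rw [h s (hs.trans_le (min_le_left _ _)) t (Metric.mem_ball_self hε)]
    exact hs.trans_le (min_le_right _ _)
  have key : ∀ a b : ℝ, a ≤ b → dist (γ a) (γ b) ≤ b - a := by
    intro a b hab
    have hcl : IsClosed ({s | dist (γ a) (γ s) ≤ s - a} ∩ Set.Icc a b) :=
      (isClosed_le (by fun_prop) (by fun_prop)).inter isClosed_Icc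
    have hsub := hcl.Icc_subset_of_forall_mem_nhdsWithin (by simp) (fun s hs => by
      obtain ⟨ε, hε, h⟩ := hγ s
      filter_upwards [self_mem_nhdsWithin, mem_nhdsWithin_of_mem_nhds (Metric.ball_mem_nhds s hε)]
        with u hu hu'
      have h1 := h s (Metric.mem_ball_self hε) u hu'
      rw [Real.dist_eq, abs_sub_comm, abs_of_pos (sub_pos.mpr hu)] at h1
      have h2 := dist_triangle (γ a) (γ s) (γ u)
      have h3 : dist (γ a) (γ s) ≤ s - a := hs.1
      change dist (γ a) (γ u) ≤ u - a
      linarith)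
    exact hsub ⟨hab, le_rfl⟩
  rcases le_total s t with h | h
  · rw [abs_sub_comm, abs_of_nonneg (sub_nonneg.mpr h)]; exact key s t h
  · rw [dist_comm, abs_of_nonneg (sub_nonneg.mpr h)]; exact key t s h

/-- A `1`-Lipschitz path that goes to infinity at positive speed along a sequence of equidistant
times goes to infinity. -/
theorem tendsto_dist_atTop {Y : Type*} [PseudoMetricSpace Y] {γ : ℝ → Y}
    (hγ : ∀ s t, dist (γ s) (γ t) ≤ |s - t|) {z : Y} {v w : ℝ} (hv : 0 < v) (hw : 0 < w)
    (h : Tendsto (fun n : ℕ => 1 / (n : ℝ) * dist z (γ (n * v))) atTop (𝓝 w)) :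
    Tendsto (fun t => dist z (γ t)) atTop atTop := by
  have h1 : Tendsto (fun n : ℕ => dist z (γ (n * v))) atTop atTop := by
    refine (tendsto_natCast_atTop_atTop.atTop_mul_pos hw h).congr' ?_
    filter_upwards [eventually_gt_atTop 0] with n hn
    have : (n : ℝ) ≠ 0 := by positivity
    field_simp
  have h2 : Tendsto (fun t : ℝ => ⌊t / v⌋₊) atTop atTop :=
    tendsto_nat_floor_atTop.comp (tendsto_id.atTop_div_const hv)
  refine tendsto_atTop_mono' atTop ?_ (tendsto_atTop_add_const_right atTop (-v) (h1.comp h2))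
  filter_upwards [eventually_ge_atTop 0] with t ht
  have e1 := Nat.floor_le (div_nonneg ht hv.le)
  have e2 := Nat.lt_floor_add_one (t / v)
  rw [le_div_iff₀ hv] at e1
  rw [div_lt_iff₀ hv] at e2
  have e3 := hγ t (⌊t / v⌋₊ * v)
  rw [abs_of_nonneg (by linarith)] at e3
  have e4 := dist_triangle z (γ t) (γ (⌊t / v⌋₊ * v))
  simp only [Function.comp_apply]
  linarith

theorem tendsto_zero_of_le_add_const {a b : ℕ → ℝ} {K : ℝ} (hab : ∀ n, a n ≤ b n + K) (ha : ∀ n, 0 ≤ a n)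
    (hb : Tendsto (fun n : ℕ => 1 / (n : ℝ) * b n) atTop (𝓝 0)) :
    Tendsto (fun n : ℕ => 1 / (n : ℝ) * a n) atTop (𝓝 0) := by
  have h1 := hb.add (tendsto_const_div_atTop_nhds_zero_nat K)
  rw [add_zero] at h1
  refine squeeze_zero (fun n => mul_nonneg (by positivity) (ha n)) (fun n => ?_) h1
  calc 1 / (n : ℝ) * a n ≤ 1 / (n : ℝ) * (b n + K) :=
        mul_le_mul_of_nonneg_left (hab n) (by positivity)
    _ = 1 / (n : ℝ) * b n + K / n := by ring

/-- If two sequences of points are at sublinear distance, their distances to a fixed point have the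
same linear growth. -/
theorem tendsto_dist_of_sublinear {Y : Type*} [PseudoMetricSpace Y] {p q : ℕ → Y} {z : Y} {v : ℝ}
    (hp : Tendsto (fun n : ℕ => 1 / (n : ℝ) * dist z (p n)) atTop (𝓝 v))
    (hpq : Tendsto (fun n : ℕ => 1 / (n : ℝ) * dist (p n) (q n)) atTop (𝓝 0)) :
    Tendsto (fun n : ℕ => 1 / (n : ℝ) * dist z (q n)) atTop (𝓝 v) := by
  have h1 : Tendsto (fun n : ℕ => 1 / (n : ℝ) * (dist z (q n) - dist z (p n))) atTop (𝓝 0) := by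
    refine squeeze_zero_norm (fun n => ?_) hpq
    rw [norm_mul, Real.norm_of_nonneg (by positivity)]
    refine mul_le_mul_of_nonneg_left ?_ (by positivity)
    rw [dist_comm z (q n), dist_comm z (p n), dist_comm (p n) (q n)]
    exact abs_dist_sub_le _ _ _
  have h2 := hp.add h1
  rw [add_zero] at h2
  refine h2.congr fun n => ?_
  ring

namespace HyperbolicSurface

variable {S : Type*} [MetricSpace S] {X : HyperbolicSurface S} {f : S ≃ₜ S} {F : ℍ ≃ₜ ℍ}

theorem IsLift.dist_le {γ : ℝ → S} (hγ : IsGeodesic γ) {γ' : ℝ → ℍ} (h : X.IsLift γ γ') (s t : ℝ) :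
    dist (γ' s) (γ' t) ≤ |s - t| := by
  refine dist_le_of_locally_isometric (fun t => ?_) s t
  obtain ⟨ε, hε, h1⟩ := hγ t
  obtain ⟨r, hr, h2⟩ := X.locally_isometric (γ' t)
  obtain ⟨δ, hδ, h3⟩ := Metric.continuous_iff.mp h.1 t r hr
  refine ⟨min ε δ, lt_min hε hδ, fun s hs s' hs' => ?_⟩
  rw [← h2 _ (h3 s (hs.trans_le (min_le_right _ _))) _ (h3 s' (hs'.trans_le (min_le_right _ _))),
    h.2, h.2]
  exact h1 s (Metric.ball_subset_ball (min_le_left _ _) hs) s'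
    (Metric.ball_subset_ball (min_le_left _ _) hs')

theorem IsLift.comp_add {γ : ℝ → S} {γ' : ℝ → ℍ} (h : X.IsLift γ γ') (t₀ : ℝ) :
    X.IsLift (fun t => γ (t + t₀)) fun t => γ' (t + t₀) :=
  ⟨h.1.comp (continuous_add_const t₀), fun t => h.2 (t + t₀)⟩

theorem Tracks.comp_add {z : ℍ} {γ : ℝ → ℍ} {v : ℝ} (h : Tracks F z γ v)
    (hγ : ∀ s t, dist (γ s) (γ t) ≤ |s - t|) (t₀ : ℝ) : Tracks F z (fun t => γ (t + t₀)) v := by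
  have key : ∀ (w : ℍ) (s : ℝ), dist w (γ (s + t₀)) ≤ dist w (γ s) + |t₀| := by
    intro w s
    refine (dist_triangle _ (γ s) _).trans (add_le_add le_rfl ((hγ _ _).trans ?_))
    rw [sub_add_cancel_left, abs_neg]
  exact ⟨tendsto_zero_of_le_add_const (fun n => key _ _) (fun n => dist_nonneg) h.1,
    tendsto_zero_of_le_add_const (fun n => key _ _) (fun n => dist_nonneg) h.2⟩

/-- Every tracking geodesic becomes normalized by a change of its origin: the tracking equation shows
that a lift goes to infinity in both directions, hence it has a point closest to the given lift of
`x`. -/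
theorem IsTrackingGeodesic.exists_normalized (hF : X.IsPreferredLift f F) {x : S} {γ : ℝ → S}
    (h : X.IsTrackingGeodesic f F x γ) :
    ∃ t₀, X.IsNormalizedTrackingGeodesic f F x fun t => γ (t + t₀) := by
  obtain ⟨hγ, v, hv, hspeed, htr⟩ := h
  obtain ⟨z, rfl⟩ := X.isQuotientCoveringMap.surjective x
  obtain ⟨γ', hlift, htrack⟩ := htr z rfl
  have hL := hlift.dist_le hγ
  have hpos : Tendsto (fun t => dist z (γ' t)) atTop atTop := by
    refine tendsto_dist_atTop hL hv hv (tendsto_dist_of_sublinear ?_ htrack.1)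
    simpa only [X.rotationDistance_proj hF] using hspeed.1
  have hneg : Tendsto (fun t => dist z (γ' (-t))) atTop atTop := by
    refine tendsto_dist_atTop (γ := fun t => γ' (-t)) (fun s t => ?_) hv hv
      (tendsto_dist_of_sublinear ?_ htrack.2)
    · refine (hL _ _).trans (le_of_eq ?_)
      rw [neg_sub_neg, abs_sub_comm]
    · have h1 := hspeed.2
      simp only [← hF.proj_symm_iterate, X.rotationDistance_proj hF] at h1
      refine h1.congr fun n => ?_
      have h2 : F^[n] (F.symm^[n] z) = z := Function.LeftInverse.iterate F.apply_symm_apply n _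
      rw [h2, dist_comm]
  have hlim : Tendsto (fun t => dist z (γ' t)) (cocompact ℝ) atTop := by
    rw [cocompact_eq_atBot_atTop, tendsto_sup]
    refine ⟨?_, hpos⟩
    have := hneg.comp tendsto_neg_atBot_atTop
    simpa only [Function.comp_def, neg_neg] using this
  obtain ⟨t₀, ht₀⟩ := (continuous_const.dist hlift.1).exists_forall_le hlim
  refine ⟨t₀, ⟨?_, v, hv, hspeed, fun w hw => ?_⟩, v, z, fun t => γ' (t + t₀), hspeed, rfl,
    hlift.comp_add t₀, htrack.comp_add hL t₀, ?_⟩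
  · intro t
    obtain ⟨ε, hε, h1⟩ := hγ (t + t₀)
    refine ⟨ε, hε, fun s hs s' hs' => ?_⟩
    rw [h1 (s + t₀) (by simpa using hs) (s' + t₀) (by simpa using hs'), dist_add_right]
  · obtain ⟨β, hβ, hβt⟩ := htr w hw
    exact ⟨_, hβ.comp_add t₀, hβt.comp_add (hβ.dist_le hγ) t₀⟩
  · refine le_antisymm ?_ (Metric.infDist_le_dist_of_mem ⟨0, rfl⟩)
    rw [Metric.le_infDist (Set.range_nonempty _)]
    rintro _ ⟨t, rfl⟩
    simp only [zero_add]
    exact ht₀ _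

end HyperbolicSurface

end

/-! ### Velocity vectors -/

noncomputable section

theorem denom_SL_apply (g : SL(2, ℝ)) (z : ℍ) :
    UpperHalfPlane.denom g z = (g 1 0 : ℂ) * z + g 1 1 := rfl

/-- The velocity vector of a parametrized geodesic at the origin. -/
theorem hasDerivAt_geodesicLine_zero (A : SL(2, ℝ)) :
    HasDerivAt (fun s => (geodesicLine A s : ℂ))
      (Complex.I / UpperHalfPlane.denom A UpperHalfPlane.I ^ 2) 0 := by
  have h0 : ∀ s, (geodesicLine A s : ℂ) = (A 0 0 * (Real.exp s * Complex.I) + A 0 1) /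
      (A 1 0 * (Real.exp s * Complex.I) + A 1 1) := by
    intro s
    rw [geodesicLine, mul_smul, SL2.coe_smul', SL2.coe_diag_smul, UpperHalfPlane.coe_I]
  have he : HasDerivAt (fun s : ℝ => (Real.exp s : ℂ) * Complex.I) Complex.I 0 := by
    have := ((Real.hasDerivAt_exp 0).ofReal_comp).mul_const Complex.I
    simpa using this
  have hne : (A 1 0 : ℂ) * (Real.exp 0 * Complex.I) + A 1 1 ≠ 0 := by
    have := SL2.denom_ne A UpperHalfPlane.I
    simpa using this
  have hd := ((he.const_mul (A 0 0 : ℂ)).add_const (A 0 1 : ℂ)).fun_div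
    ((he.const_mul (A 1 0 : ℂ)).add_const (A 1 1 : ℂ)) hne
  simp only [h0]
  refine hd.congr_deriv ?_
  rw [denom_SL_apply, UpperHalfPlane.coe_I, Real.exp_zero, Complex.ofReal_one, one_mul]
  congr 1
  have hdet : ((A 0 0 : ℂ) * A 1 1 - A 0 1 * A 1 0) = 1 := by exact_mod_cast SL2.det_eq A
  linear_combination Complex.I * hdet

theorem geodesicLine_mul_diag (A : SL(2, ℝ)) (s t : ℝ) :
    geodesicLine (A * SL2.diag s) t = geodesicLine A (t + s) := by
  rw [geodesicLine, geodesicLine, mul_assoc, ← SL2.diag_add, add_comm]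

theorem deriv_geodesicLine (A : SL(2, ℝ)) (t₀ t : ℝ) :
    deriv (fun s => (geodesicLine A (s + t₀) : ℂ)) t =
      Complex.I / UpperHalfPlane.denom (A * SL2.diag (t + t₀) : SL(2, ℝ)) UpperHalfPlane.I ^ 2 := by
  have h1 := hasDerivAt_geodesicLine_zero (A * SL2.diag (t + t₀))
  rw [← sub_self t] at h1
  have h2 := (h1.comp_sub_const t t).deriv
  rw [← h2]
  congr 1
  funext s
  rw [geodesicLine_mul_diag, show s - t + (t + t₀) = s + t₀ by ring]

/-- A matrix is determined up to its sign by its action on a unit tangent vector. -/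
theorem SL2.eq_or_eq_neg_of_tangent {U V : SL(2, ℝ)}
    (h1 : U • UpperHalfPlane.I = V • UpperHalfPlane.I)
    (h2 : UpperHalfPlane.denom U UpperHalfPlane.I ^ 2 = UpperHalfPlane.denom V UpperHalfPlane.I ^ 2) :
    U = V ∨ U = -V := by
  have eU := (SL2.smul_eq_iff U UpperHalfPlane.I _).mp rfl
  have eV := (SL2.smul_eq_iff V UpperHalfPlane.I _).mp rfl
  rw [h1] at eU
  rw [sq_eq_sq_iff_eq_or_eq_neg, denom_SL_apply, denom_SL_apply] at h2
  rcases h2 with h2 | h2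
  · left
    rw [h2, ← eV] at eU
    simp only [UpperHalfPlane.coe_I, Complex.ext_iff] at eU h2
    simp at eU h2
    exact SL2.ext' eU.2 eU.1 h2.2 h2.1
  · right
    rw [h2, mul_neg, ← eV] at eU
    simp only [UpperHalfPlane.coe_I, Complex.ext_iff] at eU h2
    simp at eU h2
    apply SL2.ext' <;> simp only [Matrix.SpecialLinearGroup.coe_neg, Matrix.neg_apply] <;> linarith

namespace HyperbolicSurface

variable {S : Type*} [MetricSpace S] (X : HyperbolicSurface S)

theorem countable_matrixGroup : Countable X.matrixGroup := by
  have := X.countable_deck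
  let π : X.matrixGroup → X.deck := fun g => ⟨MulAction.toPermHom SL(2, ℝ) ℍ g, g.2⟩
  refine Set.countable_univ_iff.mp ?_
  have h : (Set.univ : Set X.matrixGroup) = ⋃ φ : X.deck, π ⁻¹' {φ} := by
    ext g; simp
  rw [h]
  refine Set.countable_iUnion fun φ => ?_
  rcases (π ⁻¹' {φ}).eq_empty_or_nonempty with h0 | ⟨k, hk⟩
  · rw [h0]; exact Set.countable_empty
  refine Set.Countable.mono (s₂ := {g | (g : SL(2, ℝ)) = k ∨ (g : SL(2, ℝ)) = -k}) ?_ ?_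
  · intro g hg
    have hgk : ∀ z : ℍ, (g : SL(2, ℝ)) • z = (k : SL(2, ℝ)) • z := fun z => by
      have h1 : π g = π k := by rw [hg, hk]
      exact congrArg (fun φ : X.deck => (φ : Equiv.Perm ℍ) z) h1
    obtain ⟨h01, h10, h00⟩ := SL2.eq_of_forall_smul_eq (g := (k : SL(2, ℝ))⁻¹ * g) fun z => by
      rw [mul_smul, hgk, inv_smul_smul]
    have hdet := SL2.det_eq ((k : SL(2, ℝ))⁻¹ * g)
    rw [← h00, h01, zero_mul, sub_zero, mul_self_eq_one_iff] at hdet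
    have hgk' : (g : SL(2, ℝ)) = k * ((k : SL(2, ℝ))⁻¹ * g) := (mul_inv_cancel_left _ _).symm
    rcases hdet with h1 | h1
    · left
      rw [hgk']
      have : (k : SL(2, ℝ))⁻¹ * g = 1 := by
        apply SL2.ext' <;> simp only [h01, h10, h1, ← h00] <;> simp
      rw [this, mul_one]
    · right
      rw [hgk']
      have : (k : SL(2, ℝ))⁻¹ * g = -1 := by
        apply SL2.ext' <;> simp only [h01, h10, h1, ← h00] <;> simp
      rw [this, mul_neg, mul_one]
  · refine Set.Countable.preimage_of_injOn (s := {(k : SL(2, ℝ)), -(k : SL(2, ℝ))})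
      (f := Subtype.val) ?_ Subtype.val_injective.injOn
    exact (Set.toFinite _).countable

/-- If two geodesics of the surface have a velocity vector in common, the frames of their lifts
differ by a covering transformation and a translation along the geodesic. -/
theorem exists_frame_eq {A B : SL(2, ℝ)} {t₀ t₁ : ℝ}
    (h : X.velocitySet (fun t => X.proj (geodesicLine A (t + t₀))) =
      X.velocitySet fun t => X.proj (geodesicLine B (t + t₁))) :
    ∃ g ∈ X.matrixGroup, ∃ t, A = g * B * SL2.diag t := by
  have hlift : X.IsLift (fun t => X.proj (geodesicLine A (t + t₀))) fun t => geodesicLine A (t + t₀) :=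
    ⟨(isometry_geodesicLine A).continuous.comp (continuous_add_const t₀), fun _ => rfl⟩
  have hmem : Quotient.mk X.tangentSetoid (geodesicLine A (0 + t₀),
      deriv (fun s => (geodesicLine A (s + t₀) : ℂ)) 0) ∈
        X.velocitySet fun t => X.proj (geodesicLine A (t + t₀)) := ⟨_, hlift, 0, rfl⟩
  rw [h] at hmem
  obtain ⟨β, hβ, t, ht⟩ := hmem
  -- the other lift is a translate of the given one
  obtain ⟨g, hg, hgβ⟩ := X.proj_eq_iff.mp (hβ.2 0).symm
  have hβeq : β = fun s => geodesicLine (g * B) (s + t₁) := by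
    refine X.isQuotientCoveringMap.isCoveringMap.eq_of_comp_eq hβ.1
      ((isometry_geodesicLine _).continuous.comp (continuous_add_const t₁)) ?_ 0 ?_
    · funext s
      simp only [Function.comp_apply]
      rw [hβ.2, ← smul_geodesicLine, X.proj_smul hg]
    · rw [← hgβ, smul_geodesicLine]
  subst hβeq
  obtain ⟨k, hk, hk1, hk2⟩ := Quotient.exact ht
  dsimp only at hk1 hk2
  rw [deriv_geodesicLine, deriv_geodesicLine, zero_add, div_div] at hk2
  rw [zero_add] at hk1
  have hI : (k * (A * SL2.diag t₀)) • UpperHalfPlane.I =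
      (g * B * SL2.diag (t + t₁)) • UpperHalfPlane.I := by
    rw [mul_smul]; exact hk1
  have hden : UpperHalfPlane.denom (k * (A * SL2.diag t₀) : SL(2, ℝ)) UpperHalfPlane.I ^ 2 =
      UpperHalfPlane.denom (g * B * SL2.diag (t + t₁) : SL(2, ℝ)) UpperHalfPlane.I ^ 2 := by
    rw [denom_mul_SL, mul_pow, mul_comm]
    rw [div_eq_mul_inv, div_eq_mul_inv] at hk2
    exact inv_injective (mul_left_cancel₀ Complex.I_ne_zero hk2)
  have key : ∀ W, W ∈ X.matrixGroup → k * (A * SL2.diag t₀) = W * B * SL2.diag (t + t₁) →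
      ∃ g ∈ X.matrixGroup, ∃ t, A = g * B * SL2.diag t := by
    intro W hW hkW
    refine ⟨k⁻¹ * W, mul_mem (inv_mem hk) hW, t + t₁ + -t₀, ?_⟩
    have h1 : A * SL2.diag t₀ = k⁻¹ * (W * B * SL2.diag (t + t₁)) := by
      rw [← hkW, inv_mul_cancel_left]
    have h2 : SL2.diag t₀ * SL2.diag (-t₀) = 1 := by
      rw [← SL2.diag_add, add_neg_cancel, SL2.diag_zero]
    rw [SL2.diag_add]
    calc A = A * SL2.diag t₀ * SL2.diag (-t₀) := by rw [mul_assoc, h2, mul_one]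
      _ = _ := by rw [h1]; simp only [mul_assoc]
  rcases SL2.eq_or_eq_neg_of_tangent hI hden with h3 | h3
  · exact key g hg h3
  · refine key (-g) (X.neg_mem_matrixGroup hg) ?_
    rw [h3, neg_mul, neg_mul]

end HyperbolicSurface

end

/-! ### Null fibers of the velocity map -/

noncomputable section

theorem SL2.mul_diag_apply_zero (A : SL(2, ℝ)) (t : ℝ) (i : Fin 2) :
    (A * SL2.diag t) i 0 = A i 0 * Real.exp (t / 2) := by
  rw [SL2.mul_apply']
  simp [SL2.diag]

namespace FramedHorseshoe

variable {S : Type*} [MetricSpace S] {X : HyperbolicSurface S} {f : S ≃ₜ S} {F : ℍ ≃ₜ ℍ}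
  (h : FramedHorseshoe X f F)

/-- The slope of the first vector of the frame of `x`, which is a coordinate of the forward end point
of the geodesic. -/
def slope (x : ℤ → Bool) : ℝ := (h.base⁻¹ * h.frame x) 1 0

theorem coinTosses_slope_eq_zero (c : ℝ) : coinTosses {x | h.slope x = c} = 0 := by
  rcases Set.eq_empty_or_nonempty {x | h.slope x = c} with h0 | ⟨y, hy⟩
  · rw [h0, measure_empty]
  · exact measure_mono_null (fun x hx => h.forward_eq x y (hx.trans hy.symm))
      (coinTosses_forward_eq_zero y)

/-- If the geodesics of two sequences have the same velocity vectors in the surface, the slopes are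
related by a covering transformation. -/
theorem slope_eq_of_velocitySet_eq {x y : ℤ → Bool} {t₀ t₁ : ℝ}
    (hxy : X.velocitySet (fun t => X.proj (geodesicLine (h.frame x) (t + t₀))) =
      X.velocitySet fun t => X.proj (geodesicLine (h.frame y) (t + t₁))) :
    ∃ g : X.matrixGroup, h.slope x =
      (h.base⁻¹ * g * h.frame y) 1 0 / (h.base⁻¹ * g * h.frame y) 0 0 := by
  obtain ⟨g, hg, t, hA⟩ := X.exists_frame_eq hxy
  refine ⟨⟨g, hg⟩, ?_⟩
  have h1 : h.base⁻¹ * h.frame x = h.base⁻¹ * g * h.frame y * SL2.diag t := by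
    rw [hA]; simp only [mul_assoc]
  have h2 := h.frame_zero_zero x
  rw [slope, h1]
  rw [h1] at h2
  rw [SL2.mul_diag_apply_zero] at h2 ⊢
  have h3 : (h.base⁻¹ * g * h.frame y) 0 0 ≠ 0 := by
    intro h0; rw [h0, zero_mul] at h2; exact zero_ne_one h2
  rw [eq_div_iff h3, mul_right_comm, mul_assoc, h2, mul_one]

/-- Almost no geodesic of the horseshoe has the same velocity vectors as a given one: up to covering
transformations, the forward end point takes countably many values. -/
theorem coinTosses_velocitySet_eq_zero {t₀ : (ℤ → Bool) → ℝ} (C : Set X.TangentBundle) :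
    coinTosses {x | X.velocitySet (fun t => X.proj (geodesicLine (h.frame x) (t + t₀ x))) = C} =
      0 := by
  have := X.countable_matrixGroup
  rcases Set.eq_empty_or_nonempty
    {x | X.velocitySet (fun t => X.proj (geodesicLine (h.frame x) (t + t₀ x))) = C} with h0 | ⟨y, hy⟩
  · rw [h0, measure_empty]
  · refine measure_mono_null (t := ⋃ g : X.matrixGroup, {x | h.slope x =
      (h.base⁻¹ * g * h.frame y) 1 0 / (h.base⁻¹ * g * h.frame y) 0 0}) (fun x hx => ?_)
      (measure_iUnion_null fun g => h.coinTosses_slope_eq_zero _)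
    exact Set.mem_iUnion.mpr (h.slope_eq_of_velocitySet_eq (hx.trans hy.symm))

/-- A choice of normalized tracking geodesics which are geodesics of the frames on regular points. -/
theorem exists_normalized_choice : ∃ (γ : S → ℝ → S) (t₀ : (ℤ → Bool) → ℝ),
    (∀ s ∈ X.trackedSet f F, X.IsNormalizedTrackingGeodesic f F s (γ s)) ∧
    ∀ x, h.IsRegular h.meanTime x →
      γ (X.proj (h.point x)) = fun t => X.proj (geodesicLine (h.frame x) (t + t₀ x)) := by
  have hloc : ∀ s, ∃ γ : ℝ → S,
      (s ∈ X.trackedSet f F → X.IsNormalizedTrackingGeodesic f F s γ) ∧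
      ∀ x, h.IsRegular h.meanTime x → X.proj (h.point x) = s →
        ∃ t₀, γ = fun t => X.proj (geodesicLine (h.frame x) (t + t₀)) := by
    intro s
    by_cases hs : ∃ x, h.IsRegular h.meanTime x ∧ X.proj (h.point x) = s
    · obtain ⟨x, hx, rfl⟩ := hs
      obtain ⟨t₀, ht₀⟩ := (hx.isTrackingGeodesic h.meanTime_pos).exists_normalized h.isPreferredLift
      refine ⟨_, fun _ => ht₀, fun y _ hyx => ⟨t₀, ?_⟩⟩
      rw [h.proj_injective hyx]
    · by_cases hs' : s ∈ X.trackedSet f F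
      · obtain ⟨γ, hγ⟩ := hs'
        obtain ⟨t₀, ht₀⟩ := hγ.exists_normalized h.isPreferredLift
        exact ⟨_, fun _ => ht₀, fun x hx hxs => absurd ⟨x, hx, hxs⟩ hs⟩
      · exact ⟨fun _ => s, fun h => absurd h hs', fun x hx hxs => absurd ⟨x, hx, hxs⟩ hs⟩
  choose γ hγ hγ' using hloc
  have hreg : ∀ x, ∃ t₀, h.IsRegular h.meanTime x →
      γ (X.proj (h.point x)) = fun t => X.proj (geodesicLine (h.frame x) (t + t₀)) := by
    intro x
    by_cases hx : h.IsRegular h.meanTime x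
    · obtain ⟨t₀, ht₀⟩ := hγ' _ x hx rfl
      exact ⟨t₀, fun _ => ht₀⟩
    · exact ⟨0, fun h => absurd h hx⟩
  choose t₀ ht₀ using hreg
  exact ⟨γ, t₀, hγ, ht₀⟩

end FramedHorseshoe

end

theorem proposition1p17 {S : Type*} [MetricSpace S] [CompactSpace S] [MeasurableSpace S]
    [BorelSpace S] (X : HyperbolicSurface S) :
    ∃ f : S ≃ₜ S, IsIsotopicToId f ∧
    ∃ F : ℍ ≃ₜ ℍ, X.IsPreferredLift f F ∧
    ∃ μ : Measure S, X.IsErgodicPos f F μ ∧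
    ∃ γ : S → ℝ → S,
      (∀ x ∈ X.trackedSet f F, X.IsNormalizedTrackingGeodesic f F x (γ x)) ∧
      (∀ᵐ x ∂μ, x ∈ X.trackedSet f F) ∧
      (¬ ∃ C : Set X.TangentBundle, ∀ᵐ x ∂μ, X.velocitySet (γ x) = C) ∧
      ∀ E : Set S, MeasurableSet E → 0 < μ E →
        ¬ ((fun x => X.velocitySet (γ x)) '' (E ∩ X.trackedSet f F)).Countable := by
  obtain ⟨f, F, hf, ⟨h⟩⟩ := FramedHorseshoe.exists_framedHorseshoe X
  obtain ⟨γ, t₀, hγ, hγ'⟩ := h.exists_normalized_choice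
  have htracked : ∀ᵐ s ∂h.measure, s ∈ X.trackedSet f F := by
    rw [h.ae_measure_iff]
    filter_upwards [h.ae_isRegular] with x hx
    exact ⟨_, hx.isTrackingGeodesic h.meanTime_pos⟩
  have hnull : ∀ C : Set X.TangentBundle, ∀ᵐ s ∂h.measure, X.velocitySet (γ s) ≠ C := by
    intro C
    rw [h.ae_measure_iff]
    have h1 : ∀ᵐ x ∂coinTosses,
        X.velocitySet (fun t => X.proj (geodesicLine (h.frame x) (t + t₀ x))) ≠ C := by
      rw [ae_iff]
      simpa only [ne_eq, not_not] using h.coinTosses_velocitySet_eq_zero C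
    filter_upwards [h.ae_isRegular, h1] with x hx hxC
    rwa [hγ' x hx]
  have hprob := h.isErgodicPos.isProbabilityMeasure
  refine ⟨f, hf, F, h.isPreferredLift, h.measure, h.isErgodicPos, γ, hγ, htracked, ?_, ?_⟩
  · rintro ⟨C, hC⟩
    obtain ⟨s, h1, h2⟩ := (hC.and (hnull C)).exists
    exact h2 h1
  · intro E _ hE hcount
    refine hE.ne' (measure_eq_zero_iff_ae_notMem.mpr ?_)
    have h1 : ∀ᵐ s ∂h.measure, ∀ C ∈ (fun x => X.velocitySet (γ x)) '' (E ∩ X.trackedSet f F),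
        X.velocitySet (γ s) ≠ C := (ae_ball_iff hcount).mpr fun C _ => hnull C
    filter_upwards [h1, htracked] with s hs hst hsE
    exact hs _ ⟨s, ⟨hsE, hst⟩, rfl⟩ rfl
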